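/- Let $I=\mathbb{N}=\{0,1,2,\dots\}$ (put $l=0$) or $I=\mathbb{Z}$ (put $l=-\infty$), and let $\lambda(x),\mu(x)$, $x\in I$, be birth and death rates: all positive, except that $\mu(0)=0$ if $I=\mathbb{N}$. Let $\pi(0)=1$, $\pi(x)=\prod_{i=1}^{x}\frac{\lambda(i-1)}{\mu(i)}$ for $x\ge1$ and $\pi(x)=\prod_{i=1}^{-x}\frac{\mu(x+i)}{\lambda(x+i-1)}$ for $x\le-1$, and assume that the infinite ends of $I$ are natural boundaries, that is, if $I=\mathbb{N}$, $$\sum_{j\ge0}\frac{1}{\lambda(j)\pi(j)}\sum_{i=0}^{j}\pi(i)=\infty,\qquad \sum_{j\ge0}\frac{1}{\lambda(j)\pi(j)}\sum_{i\ge j+1}\pi(i)=\infty,$$ and, if $I=\mathbb{Z}$, $$\sum_{j\ge1}\frac{1}{\lambda(j)\pi(j)}\sum_{i=1}^{j}\pi(i)=\sum_{j\ge1}\pi(j)\sum_{i=1}^{j-1}\frac{1}{\lambda(i)\pi(i)}=\sum_{j\le-1}\frac{1}{\lambda(j)\pi(j)}\sum_{i=j+1}^{-1}\pi(i)=\sum_{j\le-1}\pi(j)\sum_{i=j}^{-1}\frac{1}{\lambda(i)\pi(i)}=\infty.$$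 Put $\hat\lambda(x)=\mu(x+1)$, $\hat\mu(x)=\lambda(x)$, and let $\hat\pi$ be defined as $\pi$, with $(\hat\lambda,\hat\mu)$ in place of $(\lambda,\mu)$. Let $\Phi=(\Phi_{s,t})$ be the coalescing flow on $I$ in which each site $x$ carries independent Poisson streams of up arrows $x\to x+1$ (rate $\lambda(x)$) and down arrows $x\to x-1$ (rate $\mu(x)$), and points follow the arrows. For $n\ge 0$ let $W^{n,n+1}$ be the set of $(x,y)\in I^{n+1}\times I^n$ with $x_1\le y_1<x_2\le y_2<\dots\le y_n<x_{n+1}$, and for $(x,y),(x',y')\in W^{n,n+1}$ let $$\mathsf q_t((x,y),(x',y'))=\frac{\prod_{i}\hat\pi(y_i')}{\prod_{i}\hat\pi(y_i)}(-1)^n\nabla_{y_1}\cdots\nabla_{y_n}(-1)^{n+1}\bar\nabla_{x_1'}\cdots\bar\nabla_{x_{n+1}'}\,\mathbb P\big(\Phi_{0,t}(x_i)\le x_i',\ \Phi_{0,t}(y_j)\le y_j'\ \text{for all } i,j\big),$$ where $\nabla f(a)=f(a+1)-f(a)$ and $\bar\nabla f(a)=f(a-1)-f(a)$. Let $\mathfrak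 D$ be the following matrix of push-block rates on $W^{n,n+1}$. From $z=(x,y)$: $x_i\to x_i+1$ at rate $\lambda(x_i)$, $x_i\to x_i-1$ at rate $\mu(x_i)$, $y_i\to y_i+1$ at rate $\hat\lambda(y_i)$, and $y_i\to y_i-1$ at rate $\hat\mu(y_i)$, each if the new configuration lies in $W^{n,n+1}$. Moreover, if $x_{i+1}=y_i+1$, then $(x_{i+1},y_i)\to(x_{i+1}+1,y_i+1)$ at rate $\hat\lambda(y_i)$, and if $x_i=y_i$, then $(x_i,y_i)\to(x_i-1,y_i-1)$ at rate $\hat\mu(y_i)$, again if the new configuration lies in $W^{n,n+1}$. All other off-diagonal entries are $0$, and $\mathfrak D(z,z)=-\sum\lambda(x_i)-\sum\mu(x_i)-\sum_{i=1}^n[\hat\lambda(y_i)+\hat\mu(y_i)]$, where the first (second) sum is over those $i$ for which $x_i\to x_i+1$ ($x_i\to x_i-1$) leads to a configuration in $W^{n,n+1}$. Add a cemetery state $\dagger$. Let $\tilde{\mathfrak D}=\mathfrak D$ on $W^{n,n+1}$, $\tilde{\mathfrak D}(\dagger,\cdot)=0$, and let $$\tilde{\mathfrak D}((x,y),\dagger)=\sum_{i=1}^{n-1}\mathbf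 1(y_i+1=y_{i+1})\big[\hat\lambda(y_i)+\hat\mu(y_i+1)\big]+\mathbf 1(n\ge1,\ y_1=l)\,\hat\mu(l)$$ be the rate at which two $Y$-particles collide or $Y_1$ leaves $I$. Let $\tilde{\mathsf q}_t=\mathsf q_t$ on $W^{n,n+1}$, $\tilde{\mathsf q}_t(\dagger,w)=\delta_{\dagger,w}$ and $\tilde{\mathsf q}_t(z,\dagger)=1-\sum_{w\in W^{n,n+1}}\mathsf q_t(z,w)$. Then: 1. For $t>0$ and $z,w\in W^{n,n+1}$, $\frac{d}{dt}\mathsf q_t(z,w)=(\mathfrak D\mathsf q_t)(z,w)$. 2. $\tilde{\mathfrak D}$ is a conservative rate matrix (nonnegative off the diagonal, rows summing to $0$), and $\tilde{\mathsf q}$ is a solution of the backward equation $\frac{d}{dt}S(t)=\tilde{\mathfrak D}S(t)$ $(t>0)$ with $S(0)=\mathrm{Id}$ among the families $(S(t))_{t\ge0}$ of nonnegative substochastic matrices on $W^{n,n+1}\cup\{\dagger\}$ whose entries are continuous at $t=0$. It is the only solution among these families. 3. $\tilde{\mathsf q}$ is a stochastic transition function (it satisfies the Chapman–Kolmogorov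 equation, and its rows are nonnegative with sum $1$) with matrix of transition rates $\tilde{\mathfrak D}$ (entrywise right derivative at $t=0$), and it is the transition function of the continuous-time Markov chain that jumps with rates $\tilde{\mathfrak D}$; that is, $\tilde{\mathsf q}_t(z,w)$ is the probability that this chain, started at $z$, is at $w$ at time $t$ after finitely many jumps. Likewise, $\mathsf q$ is the transition function of the push-block dynamics on $W^{n,n+1}$ with rates $\mathfrak D$, killed when two $Y$-particles collide or (if $I=\mathbb{N}$) when $Y_1$ jumps to $-1$. -/

import Mathlib

open scoped Classical in
/-- `fellerIter Q k t x y` is the probability that the continuous-time Markov chain with rate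
matrix `Q` (off-diagonal entries: jump rates; `-Q x x`: total exit rate), started at `x`, is at `y`
at time `t` after exactly `k` jumps (first-jump decomposition). -/
noncomputable def fellerIter {S : Type*} (Q : S → S → ℝ) : ℕ → ℝ → S → S → ℝ
  | 0, t, x, y => if x = y then Real.exp (Q x x * t) else 0
  | k + 1, t, x, y => ∫ s in (0 : ℝ)..t, Real.exp (Q x x * s) *
      ∑' z, if z = x then 0 else Q x z * fellerIter Q k (t - s) z y

/-- Transition function of the (minimal) continuous-time Markov chain with rate matrix `Q`:
the probability to be at `y` at time `t` after finitely many jumps, when started at `x`. -/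
noncomputable def chainTransition {S : Type*} (Q : S → S → ℝ) (t : ℝ) (x y : S) : ℝ :=
  ∑' k : ℕ, fellerIter Q k t x y

/-- `Q` is a conservative rate matrix: nonnegative off the diagonal, with rows summing to zero. -/
def IsConservativeRateMatrix {S : Type*} (Q : S → S → ℝ) : Prop :=
  (∀ x y, x ≠ y → 0 ≤ Q x y) ∧ ∀ x, HasSum (fun y => Q x y) 0

open scoped Classical in
/-- `P` is a nonnegative substochastic solution of the Kolmogorov backward equation
`dP/dt = Q P` for `t > 0`, with (continuously attained) initial condition `P 0 = Id`.
For the matrices `Q` used below, every row has finitely many nonzero entries. -/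
structure IsBackwardSolution {S : Type*} (Q : S → S → ℝ) (P : ℝ → S → S → ℝ) : Prop where
  init : ∀ x y, P 0 x y = if x = y then 1 else 0
  continuous_zero : ∀ x y, ContinuousWithinAt (fun t => P t x y) (Set.Ici 0) 0
  backward : ∀ t, 0 < t → ∀ x y, HasDerivAt (fun s => P s x y) (∑' z, Q x z * P t z y) t
  nonneg : ∀ t, 0 ≤ t → ∀ x y, 0 ≤ P t x y
  summable : ∀ t, 0 ≤ t → ∀ x, Summable (fun y => P t x y)
  tsum_le_one : ∀ t, 0 ≤ t → ∀ x, ∑' y, P t x y ≤ 1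

open scoped Classical in
/-- `P` is a stochastic (honest) transition function whose matrix of transition rates is `Q`. -/
structure IsStochasticTransitionFunction {S : Type*} (Q : S → S → ℝ) (P : ℝ → S → S → ℝ) :
    Prop where
  init : ∀ x y, P 0 x y = if x = y then 1 else 0
  nonneg : ∀ t, 0 ≤ t → ∀ x y, 0 ≤ P t x y
  hasSum_one : ∀ t, 0 ≤ t → ∀ x, HasSum (fun y => P t x y) 1
  chapman_kolmogorov : ∀ s t, 0 ≤ s → 0 ≤ t → ∀ x y,
    HasSum (fun z => P s x z * P t z y) (P (s + t) x y)
  rates : ∀ x y, HasDerivWithinAt (fun t => P t x y) (Q x y) (Set.Ici 0) 0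

namespace PushBlock

/-- The two possible one-dimensional lattices `I`: the nonnegative integers, or all integers. -/
inductive SiteKind
  | halfLine
  | line

/-- The lattice `I` as a set of integers. -/
def SiteKind.sites : SiteKind → Set ℤ
  | .halfLine => Set.Ici 0
  | .line => Set.univ

/-- The symmetrizing measure, normalized by `π 0 = 1`, of the chain with birth rates `lam` and
death rates `mu`. -/
noncomputable def symmMeasure (lam mu : ℤ → ℝ) (x : ℤ) : ℝ :=
  if 0 ≤ x then ∏ i ∈ Finset.Icc (1 : ℤ) x, lam (i - 1) / mu i
  else ∏ i ∈ Finset.Icc (1 : ℤ) (-x), mu (x + i) / lam (x + i - 1)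

/-- Birth rates of the dual chain. -/
def dualBirth (mu : ℤ → ℝ) (x : ℤ) : ℝ := mu (x + 1)

/-- Death rates of the dual chain. -/
def dualDeath (lam : ℤ → ℝ) (x : ℤ) : ℝ := lam x

/-- The symmetrizing measure of the dual chain. -/
noncomputable def dualSymmMeasure (lam mu : ℤ → ℝ) (x : ℤ) : ℝ :=
  symmMeasure (dualBirth mu) (dualDeath lam) x

/-- The standing assumptions on the birth rates `lam` and death rates `mu`.
On the half-line the rates are rates on `{0, 1, 2, …}` that reflect at `0`; they are extended by
zero to the negative integers (a convention: a chain started in `{0, 1, 2, …}` stays there).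
The divergence conditions say that the infinite ends of the lattice are natural boundaries. -/
def NaturalRates (I : SiteKind) (lam mu : ℤ → ℝ) : Prop :=
  match I with
  | .halfLine =>
      (∀ x, 0 ≤ x → 0 < lam x) ∧ (∀ x, 1 ≤ x → 0 < mu x) ∧ mu 0 = 0 ∧
      (∀ x, x < 0 → lam x = 0 ∧ mu x = 0) ∧
      (∑' j : Set.Ici (0 : ℤ), ENNReal.ofReal (1 / (lam j * symmMeasure lam mu j)) *
        ∑ i ∈ Finset.Icc (0 : ℤ) j, ENNReal.ofReal (symmMeasure lam mu i) = ⊤) ∧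
      (∑' j : Set.Ici (0 : ℤ), ENNReal.ofReal (1 / (lam j * symmMeasure lam mu j)) *
        ∑' i : Set.Ici ((j : ℤ) + 1), ENNReal.ofReal (symmMeasure lam mu i) = ⊤)
  | .line =>
      (∀ x, 0 < lam x) ∧ (∀ x, 0 < mu x) ∧
      (∑' j : Set.Ici (1 : ℤ), ENNReal.ofReal (1 / (lam j * symmMeasure lam mu j)) *
        ∑ i ∈ Finset.Icc (1 : ℤ) j, ENNReal.ofReal (symmMeasure lam mu i) = ⊤) ∧
      (∑' j : Set.Ici (1 : ℤ), ENNReal.ofReal (symmMeasure lam mu j) *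
        ∑ i ∈ Finset.Icc (1 : ℤ) ((j : ℤ) - 1),
          ENNReal.ofReal (1 / (lam i * symmMeasure lam mu i)) = ⊤) ∧
      (∑' j : Set.Iic (-1 : ℤ), ENNReal.ofReal (1 / (lam j * symmMeasure lam mu j)) *
        ∑ i ∈ Finset.Icc ((j : ℤ) + 1) (-1), ENNReal.ofReal (symmMeasure lam mu i) = ⊤) ∧
      (∑' j : Set.Iic (-1 : ℤ), ENNReal.ofReal (symmMeasure lam mu j) *
        ∑ i ∈ Finset.Icc (j : ℤ) (-1),
          ENNReal.ofReal (1 / (lam i * symmMeasure lam mu i)) = ⊤)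

/-- Move all the points of the configuration `z` that sit at site `a` to site `b`. -/
def moveSite {ι : Type*} (z : ι → ℤ) (a b : ℤ) : ι → ℤ :=
  fun i => if z i = a then b else z i

/-- Rate matrix of the joint motion `t ↦ (Φ_{0,t}(z i))_i` of finitely many points under the
coalescing flow `Φ`: each site `a` carries independent Poisson streams of up arrows (rate `lam a`)
and of down arrows (rate `mu a`), and all the points at `a` follow the arrows of `a`. So points at
different sites move independently and points at the same site move together. -/
def flowRate {ι : Type*} [Fintype ι] (lam mu : ℤ → ℝ) (z w : ι → ℤ) : ℝ :=
  if w = z then -∑ a ∈ Finset.univ.image z, (lam a + mu a)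
  else ∑ a ∈ Finset.univ.image z,
    ((if w = moveSite z a (a + 1) then lam a else 0) +
      (if w = moveSite z a (a - 1) then mu a else 0))

open scoped Classical in
/-- The probability `ℙ(Φ_{0,t}(z i) ≤ z' i for all i)` for the coalescing flow `Φ`. -/
noncomputable def flowCDF {ι : Type*} [Fintype ι] (lam mu : ℤ → ℝ) (t : ℝ) (z z' : ι → ℤ) : ℝ :=
  ∑' w : ι → ℤ, if ∀ i, w i ≤ z' i then chainTransition (flowRate lam mu) t z w else 0

/-- The two-level interlacing space `W^{n,n+1}(I)`: pairs `(x, y)` in `I^{n+1} × I^n` with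
`x₁ ≤ y₁ < x₂ ≤ y₂ < ⋯ ≤ y_n < x_{n+1}`. -/
def interlacing (I : SiteKind) (n : ℕ) : Set ((Fin (n + 1) → ℤ) × (Fin n → ℤ)) :=
  {z | (∀ i, z.1 i ∈ I.sites) ∧ (∀ i, z.2 i ∈ I.sites) ∧
    ∀ i : Fin n, z.1 i.castSucc ≤ z.2 i ∧ z.2 i < z.1 i.succ}

/-- The two-level kernel `q_t^{n,n+1}((x,y),(x',y'))`, that is
`∏ π̂(y'_i) / ∏ π̂(y_i) * (-1)^n ∇_{y_1} ⋯ ∇_{y_n} (-1)^{n+1} ∇̄_{x'_1} ⋯ ∇̄_{x'_{n+1}}` applied to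
`ℙ(Φ_{0,t}(x_i) ≤ x'_i, Φ_{0,t}(y_j) ≤ y'_j for all i, j)`, where `∇f(a) = f(a+1) - f(a)` and
`∇̄f(a) = f(a-1) - f(a)`. The iterated differences are written out as alternating sums over the
set `A` of those `y_i` which are raised and the set `B` of those `x'_i` which are lowered. -/
noncomputable def twoLevelKernel (I : SiteKind) (n : ℕ) (lam mu : ℤ → ℝ) (t : ℝ)
    (z z' : interlacing I n) : ℝ :=
  (∏ i, dualSymmMeasure lam mu (z'.1.2 i)) / (∏ i, dualSymmMeasure lam mu (z.1.2 i)) *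
    ∑ A : Finset (Fin n), ∑ B : Finset (Fin (n + 1)), (-1 : ℝ) ^ (A.card + B.card) *
      flowCDF lam mu t
        (Sum.elim z.1.1 (fun i => if i ∈ A then z.1.2 i + 1 else z.1.2 i))
        (Sum.elim (fun i => if i ∈ B then z'.1.1 i - 1 else z'.1.1 i) z'.1.2)

open scoped Classical in
/-- Indices `i` for which the jump `x_i → x_i + d` keeps the configuration interlaced. -/
noncomputable def admissible {I : SiteKind} {n : ℕ} (z : interlacing I n) (d : ℤ) :
    Finset (Fin (n + 1)) :=
  Finset.univ.filter
    (fun i => (Function.update z.1.1 i (z.1.1 i + d), z.1.2) ∈ interlacing I n)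

/-- The rates of the push-block dynamics on `W^{n,n+1}(I)`, with killing. Off the diagonal, the
successive terms are: free jumps of `x`-particles; free jumps of `y`-particles; the jump of `y_i`
to the right pushing `x_{i+1} = y_i + 1`; the jump of `y_i` to the left pushing `x_i = y_i`.
Blocked jumps, and jumps which kill the process, do not occur since the target `w` is interlaced. -/
noncomputable def pushBlockRate (I : SiteKind) (n : ℕ) (lam mu : ℤ → ℝ)
    (z w : interlacing I n) : ℝ :=
  let x := z.1.1
  let y := z.1.2
  if w = z then
    -(∑ i ∈ admissible z 1, lam (x i)) - (∑ i ∈ admissible z (-1), mu (x i))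
      - ∑ i, (dualBirth mu (y i) + dualDeath lam (y i))
  else
    (∑ i, if w.1 = (Function.update x i (x i + 1), y) then lam (x i) else 0) +
    (∑ i, if w.1 = (Function.update x i (x i - 1), y) then mu (x i) else 0) +
    (∑ i, if w.1 = (x, Function.update y i (y i + 1)) then dualBirth mu (y i) else 0) +
    (∑ i, if w.1 = (x, Function.update y i (y i - 1)) then dualDeath lam (y i) else 0) +
    (∑ i : Fin n, if x i.succ = y i + 1 ∧
        w.1 = (Function.update x i.succ (x i.succ + 1), Function.update y i (y i + 1))
      then dualBirth mu (y i) else 0) +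
    (∑ i : Fin n, if x i.castSucc = y i ∧
        w.1 = (Function.update x i.castSucc (x i.castSucc - 1), Function.update y i (y i - 1))
      then dualDeath lam (y i) else 0)

open scoped Classical in
/-- The killing rate: two neighbouring `y`-particles collide, or, on the half-line, `y_1` jumps
from `0` to `-1`. -/
noncomputable def killingRate {I : SiteKind} {n : ℕ} (lam mu : ℤ → ℝ)
    (z : interlacing I n) : ℝ :=
  (∑ i : Fin n, ∑ j : Fin n, if (j : ℕ) = i + 1 ∧ z.1.2 i + 1 = z.1.2 j then
      dualBirth mu (z.1.2 i) + dualDeath lam (z.1.2 i + 1) else 0) +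
    ∑ i : Fin n, if (i : ℕ) = 0 ∧ z.1.2 i - 1 ∉ I.sites then dualDeath lam (z.1.2 i) else 0

/-- The push-block rate matrix with the cemetery state `none` added to the state space. -/
noncomputable def cemeteryRate (I : SiteKind) (n : ℕ) (lam mu : ℤ → ℝ) :
    Option (interlacing I n) → Option (interlacing I n) → ℝ
  | none, _ => 0
  | some z, none => killingRate lam mu z
  | some z, some w => pushBlockRate I n lam mu z w

/-- The two-level kernel with the cemetery state `none` added to the state space. -/
noncomputable def cemeteryKernel (I : SiteKind) (n : ℕ) (lam mu : ℤ → ℝ) (t : ℝ) :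
    Option (interlacing I n) → Option (interlacing I n) → ℝ
  | none, none => 1
  | none, some _ => 0
  | some z, none => 1 - ∑' w, twoLevelKernel I n lam mu t z w
  | some z, some w => twoLevelKernel I n lam mu t z w

end PushBlock

/-!
The two-level kernel is identified with the transition function of the killed push-block dynamics
by uniqueness for the backward equation.

**Rate matrices.** All the rate matrices occurring here have finite rows and a Lyapunov function:
a nonnegative function with finite sublevel sets and bounded drift (`IsTame`). For such a matrix a
maximum principle shows that bounded solutions of the backward equation are determined by their
initial values (`IsTame.unique`). Hence every bounded solution is the semigroup of the minimal
chain applied to its initial value (`IsTame.eq_expect`, `IsTame.eq_chain`), which also gives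
Chapman-Kolmogorov and, for conservative matrices, honesty.

**Lyapunov functions.** The expected time to reach a natural boundary is infinite, both for the
chain and for its dual. The expected hitting times `hitTime` have drift at most one, and sums of
them are Lyapunov functions for the flow (`NaturalRates.exists_lyapunov`) and for the push-block
dynamics (`NaturalRates.exists_isTame_pushBlockRate`).

**The kernel as a probability.** The flow preserves the order of points, so the alternating sum of
distribution functions in the definition of the kernel collapses to the probability that the
points started from `x` are at `x'` while the points started from `y_j` and `y_j + 1` straddle
`y'_j` (`sum_flowCDF_eq_straddleProb`). Consequently it is nonnegative, and it is additive in the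
interval between two straddling points (`straddleProb_split`).

**The backward equation.** An up arrow at `y_j` coalesces `y_j` with `y_j + 1` and annihilates the
straddling probability; an up arrow at `y_j + 1` lengthens the interval to `{y_j, y_j + 1, y_j +
2}`, and splitting it at `y_j + 1` gives the old configuration and the one with `y_j` raised,
which also moves an `x`-particle at `y_j + 1`: this is the pushing. Down arrows behave in the same
way. An arrow moving an `x`-particle across a second-level particle coalesces a straddling pair,
so that only its annihilating effect remains: this is the blocking. The result
(`straddleProb_hasDerivAt`) is a backward equation whose second-level rates are transposed, and
conjugation by the reversible measure of the dual chain turns them into the dual rates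
(`NaturalRates.weightedOp_eq`).

**Mass at most one.** Boundedness of the conjugated kernel is not obvious, because the ratio of
the weights is unbounded. It is proved for rates truncated to a window `[-N, N]`, where the
equation closes on a finite set and the total mass is controlled by the maximum principle
(`sum_weightedProb_trunc_le_one`), and then for the original rates by letting `N → ∞`
(`tendsto_expect_trunc`). So the kernel is a bounded solution started from the identity, that is,
the transition function of the killed dynamics; adding the cemetery makes the rate matrix
conservative.
-/

open Set Filter Topology MeasureTheory

namespace PushBlock

/-! ### Rate matrices and the maximum principle -/

section rateMatrix

variable {S : Type*}

/-- The action of the matrix `Q` on functions. It is only used for matrices with finitely many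
nonzero entries in every row. -/
noncomputable def genOp (Q : S → S → ℝ) (f : S → ℝ) (x : S) : ℝ := ∑' y, Q x y * f y

/-- A (sub)conservative rate matrix with finite rows and a Lyapunov function `V`: a nonnegative
function with finite sublevel sets whose drift under `Q` is at most the constant `C`. The existence
of `V` excludes explosion. -/
structure IsTame (Q : S → S → ℝ) (V : S → ℝ) (C : ℝ) : Prop where
  offDiag : ∀ x y, x ≠ y → 0 ≤ Q x y
  finite_row : ∀ x, (Function.support (Q x)).Finite
  row_nonpos : ∀ x, genOp Q (fun _ => 1) x ≤ 0
  V_nonneg : ∀ x, 0 ≤ V x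
  C_nonneg : 0 ≤ C
  drift : ∀ x, genOp Q V x ≤ C
  finite_sublevel : ∀ M, {x | V x ≤ M}.Finite

section genOp

variable {Q : S → S → ℝ}

theorem genOp_eq_sum (hQ : ∀ x, (Function.support (Q x)).Finite) (f : S → ℝ) (x : S) :
    genOp Q f x = ∑ y ∈ (hQ x).toFinset, Q x y * f y := by
  unfold genOp
  apply tsum_eq_sum
  intro y hy
  have : Q x y = 0 := by simpa using hy
  simp [this]

theorem summable_genOp (hQ : ∀ x, (Function.support (Q x)).Finite) (f : S → ℝ) (x : S) :
    Summable fun y => Q x y * f y := by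
  apply summable_of_hasFiniteSupport
  apply (hQ x).subset
  intro y hy
  simp only [Function.mem_support] at hy ⊢
  exact left_ne_zero_of_mul hy

theorem genOp_add (hQ : ∀ x, (Function.support (Q x)).Finite) (f g : S → ℝ) (x : S) :
    genOp Q (fun y => f y + g y) x = genOp Q f x + genOp Q g x := by
  simp only [genOp_eq_sum hQ, mul_add, Finset.sum_add_distrib]

theorem genOp_sub (hQ : ∀ x, (Function.support (Q x)).Finite) (f g : S → ℝ) (x : S) :
    genOp Q (fun y => f y - g y) x = genOp Q f x - genOp Q g x := by
  simp only [genOp_eq_sum hQ, mul_sub, Finset.sum_sub_distrib]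

theorem genOp_const_mul (c : ℝ) (f : S → ℝ) (x : S) :
    genOp Q (fun y => c * f y) x = c * genOp Q f x := by
  unfold genOp
  rw [← tsum_mul_left]
  congr 1; ext y; ring

theorem genOp_mul_const (c : ℝ) (f : S → ℝ) (x : S) :
    genOp Q (fun y => f y * c) x = genOp Q f x * c := by
  unfold genOp
  rw [← tsum_mul_right]
  congr 1; ext y; ring

theorem genOp_sum (hQ : ∀ x, (Function.support (Q x)).Finite) {κ : Type*} (F : Finset κ)
    (f : κ → S → ℝ) (x : S) :
    genOp Q (fun y => ∑ k ∈ F, f k y) x = ∑ k ∈ F, genOp Q (f k) x := by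
  simp only [genOp_eq_sum hQ, Finset.mul_sum]
  exact Finset.sum_comm

theorem abs_genOp_le (hQ : ∀ x, (Function.support (Q x)).Finite) {f : S → ℝ} {B : ℝ}
    (hf : ∀ y, |f y| ≤ B) (x : S) :
    |genOp Q f x| ≤ (∑ y ∈ (hQ x).toFinset, |Q x y|) * B := by
  rw [genOp_eq_sum hQ, Finset.sum_mul]
  refine (Finset.abs_sum_le_sum_abs _ _).trans (Finset.sum_le_sum fun y _ => ?_)
  rw [abs_mul]
  exact mul_le_mul_of_nonneg_left (hf y) (abs_nonneg _)

open scoped Classical in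
theorem genOp_eq_diag_add (hQ : ∀ x, (Function.support (Q x)).Finite) (f : S → ℝ) (x : S) :
    genOp Q f x = Q x x * f x + ∑' z, if z = x then 0 else Q x z * f z :=
  (summable_genOp hQ f x).tsum_eq_add_tsum_ite x

theorem genOp_sub_diag_mono (hQ : ∀ x, (Function.support (Q x)).Finite)
    (hoff : ∀ x y, x ≠ y → 0 ≤ Q x y) {f g : S → ℝ} (x : S)
    (hfg : ∀ y, y ≠ x → Q x y ≠ 0 → f y ≤ g y) :
    genOp Q f x - Q x x * f x ≤ genOp Q g x - Q x x * g x := by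
  classical
  have key : ∀ h : S → ℝ, genOp Q h x - Q x x * h x
      = ∑ y ∈ (hQ x).toFinset, (if y = x then 0 else Q x y * h y) := by
    intro h
    rw [genOp_eq_diag_add hQ, add_sub_cancel_left]
    apply tsum_eq_sum
    intro y hy
    have : Q x y = 0 := by simpa using hy
    simp [this]
  rw [key, key]
  refine Finset.sum_le_sum fun y hy => ?_
  split_ifs with h
  · exact le_rfl
  · exact mul_le_mul_of_nonneg_left (hfg y h (by simpa using hy)) (hoff x y (Ne.symm h))

/-- At a nonnegative global maximum, a subconservative rate matrix acts nonpositively. -/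
theorem genOp_nonpos_of_max (hQ : ∀ x, (Function.support (Q x)).Finite)
    (hoff : ∀ x y, x ≠ y → 0 ≤ Q x y) (x : S) (hrow : genOp Q (fun _ => 1) x ≤ 0) {f : S → ℝ}
    (h0 : 0 ≤ f x) (hmax : ∀ y, f y ≤ f x) : genOp Q f x ≤ 0 := by
  have h := genOp_sub_diag_mono hQ hoff (f := f) (g := fun _ => 1 * f x) x
    (fun y _ _ => by simpa using hmax y)
  rw [genOp_mul_const (f x) (fun _ => 1) x] at h
  nlinarith [mul_nonneg_of_nonpos_of_nonpos hrow (neg_nonpos.mpr h0)]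

end genOp

/-- Parabolic maximum principle on a finite set `K`: if the time derivative is nonpositive at
spatial maxima with positive value, then nonpositivity is preserved. -/
theorem finite_max_principle {K : Set S} (hK : K.Finite) {T : ℝ} (hT : 0 ≤ T) {f : ℝ → S → ℝ}
    (hc : ∀ x ∈ K, ContinuousOn (fun t => f t x) (Icc 0 T)) (h0 : ∀ x ∈ K, f 0 x ≤ 0)
    (hd : ∀ t ∈ Ioc 0 T, ∀ x ∈ K, 0 < f t x → (∀ y ∈ K, f t y ≤ f t x) →
      ∃ d ≤ 0, HasDerivAt (fun s => f s x) d t) :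
    ∀ x ∈ K, f T x ≤ 0 := by
  intro x hx
  by_contra! hpos
  -- tilting by `ε t` turns the maximum into a strict violation
  obtain ⟨ε, hε, hεT⟩ : ∃ ε : ℝ, 0 < ε ∧ 0 < f T x - ε * T := by
    refine ⟨f T x / (2 * (T + 1)), by positivity, ?_⟩
    have : f T x / (2 * (T + 1)) * T = f T x * (T / (2 * (T + 1))) := by ring
    rw [this]
    have h2 : T / (2 * (T + 1)) < 1 := by rw [div_lt_one (by positivity)]; linarith
    nlinarith
  have hex : ∀ y : S, ∃ t, y ∈ K → t ∈ Icc 0 T ∧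
      ∀ s ∈ Icc 0 T, f s y - ε * s ≤ f t y - ε * t := by
    intro y
    by_cases hy : y ∈ K
    · have hcont : ContinuousOn (fun t => f t y - ε * t) (Icc 0 T) :=
        (hc y hy).sub (by fun_prop)
      obtain ⟨t, ht, hmax⟩ := isCompact_Icc.exists_isMaxOn (nonempty_Icc.mpr hT) hcont
      exact ⟨t, fun _ => ⟨ht, fun s hs => hmax hs⟩⟩
    · exact ⟨0, fun h => absurd h hy⟩
  choose τ hτ using hex
  obtain ⟨y, hy, hmax⟩ := Set.exists_max_image K (fun y => f (τ y) y - ε * τ y) hK ⟨x, hx⟩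
  obtain ⟨⟨ht0, htT⟩, hty⟩ := hτ y hy
  set t := τ y
  have hval : 0 < f t y - ε * t := by
    refine lt_of_lt_of_le hεT ?_
    exact ((hτ x hx).2 T ⟨hT, le_rfl⟩).trans (hmax x hx)
  have htpos : 0 < t := by
    rcases ht0.lt_or_eq with h | h
    · exact h
    · exfalso
      rw [← h] at hval
      have := h0 y hy
      linarith
  have hglob : ∀ y' ∈ K, f t y' ≤ f t y := by
    intro y' hy'
    have h1 := (hτ y' hy').2 t ⟨ht0, htT⟩
    have h2 := hmax y' hy'
    linarith
  have hfpos : 0 < f t y := by nlinarith [mul_pos hε htpos]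
  obtain ⟨d, hd0, hder⟩ := hd t ⟨htpos, htT⟩ y hy hfpos hglob
  have hder' : HasDerivAt (fun s => f s y - ε * s) (d - ε) t := by
    simpa using hder.fun_sub ((hasDerivAt_id' t).const_mul ε)
  have hslope : Tendsto (slope (fun s => f s y - ε * s) t) (𝓝[<] t) (𝓝 (d - ε)) :=
    (hasDerivAt_iff_tendsto_slope_left_right.mp hder').1
  have hge : 0 ≤ d - ε := by
    refine ge_of_tendsto hslope ?_
    filter_upwards [Ioo_mem_nhdsLT htpos] with s hs
    rw [slope_def_field]
    apply div_nonneg_of_nonpos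
    · have := hty s ⟨hs.1.le, hs.2.le.trans htT⟩
      linarith
    · linarith [hs.2]
  linarith

/-- Maximum principle in the presence of a Lyapunov function. The differential inequality is only
needed where `V ≤ M` and `f > 0`; the bound degrades linearly with `1 / M`. -/
theorem IsTame.comparison {Q : S → S → ℝ} {V : S → ℝ} {C : ℝ} (hQ : IsTame Q V C) {B M T : ℝ}
    (hB : 0 ≤ B) (hM : 0 < M) (hT : 0 ≤ T) {f : ℝ → S → ℝ} (hle : ∀ t ∈ Icc 0 T, ∀ x, f t x ≤ B)
    (hc : ∀ x, ContinuousOn (fun t => f t x) (Icc 0 T)) (h0 : ∀ x, f 0 x ≤ 0)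
    (hd : ∀ t ∈ Ioc 0 T, ∀ x, V x ≤ M → 0 < f t x →
      ∃ d ≤ genOp Q (f t) x, HasDerivAt (fun s => f s x) d t) (x : S) :
    f T x ≤ B / M * (V x + C * T) := by
  have hBM : 0 ≤ B / M := div_nonneg hB hM.le
  -- where `V > M`, the bound `f ≤ B` is already stronger than the claim
  have outside : ∀ t ∈ Icc 0 T, ∀ y, M < V y → f t y - B / M * (V y + C * t) ≤ 0 := by
    intro t ht y hy
    have h1 : B ≤ B / M * V y := by
      rw [div_mul_eq_mul_div, le_div_iff₀ hM]
      exact mul_le_mul_of_nonneg_left hy.le hB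
    have h2 : 0 ≤ B / M * (C * t) := mul_nonneg hBM (mul_nonneg hQ.C_nonneg ht.1)
    have := hle t ht y
    linarith
  by_cases hx : V x ≤ M
  swap
  · have := outside T ⟨hT, le_rfl⟩ x (not_le.mp hx)
    linarith
  have := finite_max_principle (hQ.finite_sublevel M) hT
    (f := fun t y => f t y - B / M * (V y + C * t)) ?_ ?_ ?_ x hx
  · linarith
  · intro y _
    exact (hc y).sub (by fun_prop)
  · intro y _
    have h2 : 0 ≤ B / M * (V y + C * 0) := mul_nonneg hBM (by simpa using hQ.V_nonneg y)
    have := h0 y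
    linarith
  · intro t ht y hy hpos hmax
    have htI : t ∈ Icc 0 T := ⟨ht.1.le, ht.2⟩
    have hVC : 0 ≤ B / M * (V y + C * t) :=
      mul_nonneg hBM (add_nonneg (hQ.V_nonneg y) (mul_nonneg hQ.C_nonneg ht.1.le))
    obtain ⟨d, hdle, hder⟩ := hd t ht y hy (by linarith)
    refine ⟨d - B / M * C, ?_, ?_⟩
    · have hgmax : genOp Q (fun y => f t y - B / M * (V y + C * t)) y ≤ 0 := by
        refine genOp_nonpos_of_max hQ.finite_row hQ.offDiag y (hQ.row_nonpos y) hpos.le ?_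
        intro y'
        by_cases hy' : V y' ≤ M
        · exact hmax y' hy'
        · exact (outside t htI y' (not_le.mp hy')).trans hpos.le
      have hexp : genOp Q (fun y => f t y - B / M * (V y + C * t)) y
          = genOp Q (f t) y - B / M * (genOp Q V y + (C * t) * genOp Q (fun _ => 1) y) := by
        rw [genOp_sub hQ.finite_row, genOp_const_mul, genOp_add hQ.finite_row,
          ← genOp_const_mul (C * t) (fun _ => 1)]
        simp
      rw [hexp] at hgmax
      have h1 : C * t * genOp Q (fun _ => 1) y ≤ 0 :=
        mul_nonpos_of_nonneg_of_nonpos (mul_nonneg hQ.C_nonneg ht.1.le) (hQ.row_nonpos y)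
      have h2 : B / M * (genOp Q V y + (C * t) * genOp Q (fun _ => 1) y) ≤ B / M * C :=
        mul_le_mul_of_nonneg_left (by linarith [hQ.drift y]) hBM
      linarith
    · have h1 : HasDerivAt (fun s => B / M * (V y + C * s)) (B / M * C) t := by
        simpa using (((hasDerivAt_id' t).const_mul C).const_add (V y)).const_mul (B / M)
      exact hder.fun_sub h1

/-- `f` is a solution of the backward equation `∂f/∂t = Q f` for positive times, continuous up to
time `0` and bounded by `B`. -/
structure IsBddSolution (Q : S → S → ℝ) (f : ℝ → S → ℝ) (B : ℝ) : Prop where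
  cont : ∀ x, ContinuousOn (fun t => f t x) (Ici 0)
  deriv : ∀ t, 0 < t → ∀ x, HasDerivAt (fun s => f s x) (genOp Q (f t) x) t
  bdd : ∀ t, 0 ≤ t → ∀ x, |f t x| ≤ B

/-- Maximum principle: the bound of `IsTame.comparison`, as the level `M` tends to infinity. -/
theorem IsTame.nonpos_of_subsolution {Q : S → S → ℝ} {V : S → ℝ} {C : ℝ} (hQ : IsTame Q V C)
    {B : ℝ} {f : ℝ → S → ℝ} (hle : ∀ t, 0 ≤ t → ∀ x, f t x ≤ B)
    (hc : ∀ x, ContinuousOn (fun t => f t x) (Ici 0)) (h0 : ∀ x, f 0 x ≤ 0)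
    (hd : ∀ t, 0 < t → ∀ x, 0 < f t x → ∃ d ≤ genOp Q (f t) x, HasDerivAt (fun s => f s x) d t)
    {T : ℝ} (hT : 0 ≤ T) (x : S) : f T x ≤ 0 := by
  have key : ∀ M : ℝ, 0 < M → f T x ≤ max B 0 / M * (V x + C * T) := fun M hM =>
    hQ.comparison (le_max_right _ _) hM hT (fun t ht x => (hle t ht.1 x).trans (le_max_left _ _))
      (fun x => (hc x).mono Icc_subset_Ici_self) h0 (fun t ht x _ => hd t ht.1 x) x
  have hlim : Tendsto (fun M : ℝ => max B 0 / M * (V x + C * T)) atTop (𝓝 0) := by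
    have h1 : Tendsto (fun M : ℝ => max B 0 / M) atTop (𝓝 0) :=
      tendsto_const_nhds.div_atTop tendsto_id
    simpa using h1.mul_const (V x + C * T)
  exact ge_of_tendsto hlim (by filter_upwards [eventually_gt_atTop 0] with M hM using key M hM)

/-- Bounded solutions of the backward equation are determined by their initial values. -/
theorem IsTame.unique {Q : S → S → ℝ} {V : S → ℝ} {C : ℝ} (hQ : IsTame Q V C) {f g : ℝ → S → ℝ}
    {B B' : ℝ} (hf : IsBddSolution Q f B) (hg : IsBddSolution Q g B') (h0 : ∀ x, f 0 x = g 0 x)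
    {t : ℝ} (ht : 0 ≤ t) (x : S) : f t x = g t x := by
  have key : ∀ {f g : ℝ → S → ℝ} {B B' : ℝ}, IsBddSolution Q f B → IsBddSolution Q g B' →
      (∀ x, f 0 x = g 0 x) → f t x ≤ g t x := by
    intro f g B B' hf hg h0
    have := hQ.nonpos_of_subsolution (f := fun t x => f t x - g t x) (B := B + B')
      (fun t ht x => by
        have h1 := abs_le.mp (hf.bdd t ht x)
        have h2 := abs_le.mp (hg.bdd t ht x)
        linarith)
      (fun x => (hf.cont x).sub (hg.cont x)) (fun x => by simp [h0 x])
      (fun t ht x _ => ⟨_, (genOp_sub hQ.finite_row (f t) (g t) x).ge,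
        (hf.deriv t ht x).sub (hg.deriv t ht x)⟩) ht x
    simpa using this
  exact le_antisymm (key hf hg h0) (key hg hf fun x => (h0 x).symm)

/-! ### The minimal chain and its semigroup -/

theorem continuousOn_genOp {Q : S → S → ℝ} (hQ : ∀ x, (Function.support (Q x)).Finite)
    {f : ℝ → S → ℝ} {s : Set ℝ} (hf : ∀ x, ContinuousOn (fun t => f t x) s) (x : S) :
    ContinuousOn (fun t => genOp Q (f t) x) s := by
  simp only [genOp_eq_sum hQ]
  exact continuousOn_finsetSum _ fun y _ => (hf y).const_smul (Q x y)

/-- Bounded pointwise limits of functions whose derivatives converge to `Q f` solve the backward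
equation. The limit is taken in the integrated equation, by dominated convergence. -/
theorem isBddSolution_of_tendsto {Q : S → S → ℝ} (hQ : ∀ x, (Function.support (Q x)).Finite)
    {ι : Type*} {l : Filter ι} [l.NeBot] [l.IsCountablyGenerated] {F G : ι → ℝ → S → ℝ}
    {f : ℝ → S → ℝ} {B : ℝ} {B' : S → ℝ}
    (hFc : ∀ i x, ContinuousOn (fun t => F i t x) (Ici 0))
    (hGc : ∀ i x, ContinuousOn (fun t => G i t x) (Ici 0))
    (hd : ∀ i t, 0 < t → ∀ x, HasDerivAt (fun s => F i s x) (G i t x) t)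
    (hB : ∀ i t, 0 ≤ t → ∀ x, |F i t x| ≤ B) (hB' : ∀ i t, 0 ≤ t → ∀ x, |G i t x| ≤ B' x)
    (hlim : ∀ t, 0 ≤ t → ∀ x, Tendsto (fun i => F i t x) l (𝓝 (f t x)))
    (hlimG : ∀ t, 0 ≤ t → ∀ x, Tendsto (fun i => G i t x) l (𝓝 (genOp Q (f t) x))) :
    IsBddSolution Q f B := by
  have hint : ∀ i x s t, 0 ≤ s → s ≤ t → F i t x - F i s x = ∫ r in s..t, G i r x := by
    intro i x s t hs hst
    have hsub : Icc s t ⊆ Ici 0 := fun r hr => hs.trans hr.1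
    refine (intervalIntegral.integral_eq_sub_of_hasDerivAt_of_le hst ((hFc i x).mono hsub)
      (fun r hr => hd i r (hs.trans_lt hr.1) x) ?_).symm
    apply ContinuousOn.intervalIntegrable
    rw [uIcc_of_le hst]
    exact (hGc i x).mono hsub
  have hcont : ∀ x, ContinuousOn (fun t => f t x) (Ici 0) := by
    intro x
    have key : ∀ s t, 0 ≤ s → s ≤ t → |f t x - f s x| ≤ B' x * |t - s| := by
      intro s t hs hst
      refine le_of_tendsto ((hlim t (hs.trans hst) x).sub (hlim s hs x)).abs ?_
      refine Eventually.of_forall fun i => ?_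
      rw [hint i x s t hs hst, ← Real.norm_eq_abs]
      refine intervalIntegral.norm_integral_le_of_norm_le_const fun r hr => ?_
      rw [uIoc_of_le hst] at hr
      exact hB' i r (hs.trans hr.1.le) x
    refine (LipschitzOnWith.of_dist_le' (K := B' x) fun t ht s hs => ?_).continuousOn
    rcases le_total s t with h | h
    · exact key s t hs h
    · rw [dist_comm, dist_comm t s]; exact key t s ht h
  have hgc : ∀ x, ContinuousOn (fun t => genOp Q (f t) x) (Ici 0) := continuousOn_genOp hQ hcont
  have hintf : ∀ x t, 0 ≤ t → f t x = f 0 x + ∫ r in (0 : ℝ)..t, genOp Q (f r) x := by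
    intro x t ht
    have h1 := (hlim t ht x).sub (hlim 0 le_rfl x)
    have h2 : Tendsto (fun i => ∫ r in (0 : ℝ)..t, G i r x) l
        (𝓝 (∫ r in (0 : ℝ)..t, genOp Q (f r) x)) := by
      refine intervalIntegral.tendsto_integral_filter_of_dominated_convergence (fun _ => B' x)
        (Eventually.of_forall fun i => ?_) (Eventually.of_forall fun i => ?_) (by simp) ?_
      · refine ContinuousOn.aestronglyMeasurable ?_ measurableSet_uIoc
        rw [uIoc_of_le ht]
        exact (hGc i x).mono fun r hr => hr.1.le
      · refine ae_of_all _ fun r hr => ?_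
        rw [uIoc_of_le ht] at hr
        exact hB' i r hr.1.le x
      · refine ae_of_all _ fun r hr => ?_
        rw [uIoc_of_le ht] at hr
        exact hlimG r hr.1.le x
    simp only [hint _ x 0 t le_rfl ht] at h1
    have := tendsto_nhds_unique h1 h2
    linarith
  refine ⟨hcont, fun t ht x => ?_, fun t ht x =>
    le_of_tendsto (hlim t ht x).abs (Eventually.of_forall fun i => hB i t ht x)⟩
  have h1 : HasDerivAt (fun s => f 0 x + ∫ r in (0 : ℝ)..s, genOp Q (f r) x)
      (genOp Q (f t) x) t := by
    refine (intervalIntegral.integral_hasDerivAt_right ?_ ?_ ?_).const_add _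
    · apply ContinuousOn.intervalIntegrable
      rw [uIcc_of_le ht.le]
      exact (hgc x).mono Icc_subset_Ici_self
    · exact ContinuousOn.stronglyMeasurableAtFilter isOpen_Ioi
        ((hgc x).mono Ioi_subset_Ici_self) t ht
    · exact (hgc x).continuousAt (Ici_mem_nhds ht)
  refine h1.congr_of_eventuallyEq ?_
  filter_upwards [Ioi_mem_nhds ht] with s hs using hintf x s (le_of_lt hs)

/-- A bounded solution of the backward equation has the right derivative `Q f` at time `0`. -/
theorem IsBddSolution.hasDerivWithinAt_zero {Q : S → S → ℝ}
    (hQ : ∀ x, (Function.support (Q x)).Finite) {f : ℝ → S → ℝ} {B : ℝ}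
    (hf : IsBddSolution Q f B) (x : S) :
    HasDerivWithinAt (fun t => f t x) (genOp Q (f 0) x) (Ici 0) 0 := by
  refine hasDerivWithinAt_Ici_of_tendsto_deriv (s := Ioi 0)
    (fun t ht => (hf.deriv t ht x).differentiableAt.differentiableWithinAt)
    ((hf.cont x 0 self_mem_Ici).mono Ioi_subset_Ici_self) self_mem_nhdsWithin ?_
  have h1 := (continuousOn_genOp hQ hf.cont x 0 self_mem_Ici).mono Ioi_subset_Ici_self
  refine Tendsto.congr' ?_ h1
  filter_upwards [self_mem_nhdsWithin] with t ht using (hf.deriv t ht x).deriv.symm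

theorem IsBddSolution.sum_smul {Q : S → S → ℝ} (hQ : ∀ x, (Function.support (Q x)).Finite)
    {κ : Type*} (F : Finset κ) (c : κ → ℝ) {f : κ → ℝ → S → ℝ} {B : κ → ℝ}
    (hf : ∀ k ∈ F, IsBddSolution Q (f k) (B k)) :
    IsBddSolution Q (fun t x => ∑ k ∈ F, c k * f k t x) (∑ k ∈ F, |c k| * B k) where
  cont x := continuousOn_finsetSum _ fun k hk => ((hf k hk).cont x).const_smul (c k)
  deriv t ht x := by
    rw [genOp_sum hQ F (fun k x => c k * f k t x)]
    simp only [genOp_const_mul]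
    exact HasDerivAt.fun_sum fun k hk => ((hf k hk).deriv t ht x).const_mul (c k)
  bdd t ht x := by
    refine (Finset.abs_sum_le_sum_abs _ _).trans (Finset.sum_le_sum fun k hk => ?_)
    rw [abs_mul]
    exact mul_le_mul_of_nonneg_left ((hf k hk).bdd t ht x) (abs_nonneg _)

theorem IsBddSolution.shift {Q : S → S → ℝ} {f : ℝ → S → ℝ} {B : ℝ} (hf : IsBddSolution Q f B)
    {t : ℝ} (ht : 0 ≤ t) : IsBddSolution Q (fun s x => f (s + t) x) B where
  cont x := (hf.cont x).comp (by fun_prop) fun s hs => add_nonneg hs ht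
  deriv s hs x := (hf.deriv (s + t) (by linarith) x).comp_add_const s t
  bdd s hs x := hf.bdd (s + t) (add_nonneg hs ht) x

section feller

variable {Q : S → S → ℝ}

/-- The first-jump decomposition with time reversed, so that the upper limit of integration is the
only dependence on `t` under the integral. -/
theorem fellerIter_succ_eq (hQ : ∀ x, (Function.support (Q x)).Finite) (k : ℕ) (t : ℝ) (x y : S) :
    fellerIter Q (k + 1) t x y = Real.exp (Q x x * t) * ∫ r in (0 : ℝ)..t,
      Real.exp (-(Q x x * r)) *
        (genOp Q (fun z => fellerIter Q k r z y) x - Q x x * fellerIter Q k r x y) := by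
  classical
  have h := intervalIntegral.integral_comp_sub_left (a := 0) (b := t)
    (fun r => Real.exp (Q x x * (t - r)) *
      (genOp Q (fun z => fellerIter Q k r z y) x - Q x x * fellerIter Q k r x y)) t
  rw [← intervalIntegral.integral_const_mul]
  simp only [sub_self, sub_zero, sub_sub_cancel] at h
  rw [fellerIter]
  have e : ∀ s, (∑' z, if z = x then 0 else Q x z * fellerIter Q k (t - s) z y)
      = genOp Q (fun z => fellerIter Q k (t - s) z y) x - Q x x * fellerIter Q k (t - s) x y := by
    intro s
    rw [genOp_eq_diag_add hQ (fun z => fellerIter Q k (t - s) z y) x, add_sub_cancel_left]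
  simp only [e]
  rw [h]
  congr 1
  ext r
  rw [← mul_assoc, ← Real.exp_add]
  congr 2
  ring

theorem fellerIter_continuous (hQ : ∀ x, (Function.support (Q x)).Finite) (k : ℕ) (x y : S) :
    Continuous fun t => fellerIter Q k t x y := by
  induction k generalizing x with
  | zero =>
    simp only [fellerIter]
    split_ifs <;> fun_prop
  | succ k ih =>
    simp only [fellerIter_succ_eq hQ, genOp_eq_sum hQ]
    refine Continuous.mul (by fun_prop) (intervalIntegral.continuous_primitive (fun a b => ?_) 0)
    exact Continuous.intervalIntegrable (by fun_prop) _ _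

theorem continuous_genOp_fellerIter (hQ : ∀ x, (Function.support (Q x)).Finite) (k : ℕ) (x y : S) :
    Continuous fun t => genOp Q (fun z => fellerIter Q k t z y) x := by
  simp only [genOp_eq_sum hQ]
  have := fellerIter_continuous hQ k
  fun_prop

theorem fellerIter_succ_hasDerivAt (hQ : ∀ x, (Function.support (Q x)).Finite) (k : ℕ) (t : ℝ)
    (x y : S) :
    HasDerivAt (fun t => fellerIter Q (k + 1) t x y) (Q x x * fellerIter Q (k + 1) t x y +
      (genOp Q (fun z => fellerIter Q k t z y) x - Q x x * fellerIter Q k t x y)) t := by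
  have hcont : Continuous fun r => Real.exp (-(Q x x * r)) *
      (genOp Q (fun z => fellerIter Q k r z y) x - Q x x * fellerIter Q k r x y) := by
    have h1 := continuous_genOp_fellerIter hQ k x y
    have h2 := fellerIter_continuous hQ k x y
    fun_prop
  have h1 := hcont.integral_hasStrictDerivAt 0 t |>.hasDerivAt
  have h2 : HasDerivAt (fun t => Real.exp (Q x x * t)) (Real.exp (Q x x * t) * Q x x) t := by
    simpa using ((hasDerivAt_id' t).const_mul (Q x x)).exp
  have h3 := h2.fun_mul h1
  simp only [← fellerIter_succ_eq hQ] at h3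
  refine h3.congr_deriv ?_
  rw [fellerIter_succ_eq hQ, ← mul_assoc (Real.exp (Q x x * t)), ← Real.exp_add]
  simp only [add_neg_cancel, Real.exp_zero, one_mul]
  ring

theorem fellerIter_nonneg (hoff : ∀ x y, x ≠ y → 0 ≤ Q x y) (k : ℕ) {t : ℝ} (ht : 0 ≤ t) (x y : S) :
    0 ≤ fellerIter Q k t x y := by
  induction k generalizing t x with
  | zero =>
    simp only [fellerIter]
    split_ifs <;> positivity
  | succ k ih =>
    rw [fellerIter]
    refine intervalIntegral.integral_nonneg ht fun s hs => ?_
    refine mul_nonneg (Real.exp_pos _).le (tsum_nonneg fun z => ?_)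
    split_ifs with h
    · exact le_rfl
    · exact mul_nonneg (hoff x z (Ne.symm h)) (ih (sub_nonneg.mpr hs.2) z)

/-- The probability to be at `y` at time `t` after fewer than `K` jumps. -/
noncomputable def fellerSum (Q : S → S → ℝ) (K : ℕ) (t : ℝ) (x y : S) : ℝ :=
  ∑ k ∈ Finset.range K, fellerIter Q k t x y

theorem fellerSum_nonneg (hoff : ∀ x y, x ≠ y → 0 ≤ Q x y) (K : ℕ) {t : ℝ} (ht : 0 ≤ t) (x y : S) :
    0 ≤ fellerSum Q K t x y :=
  Finset.sum_nonneg fun k _ => fellerIter_nonneg hoff k ht x y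

theorem fellerSum_continuous (hQ : ∀ x, (Function.support (Q x)).Finite) (K : ℕ) (x y : S) :
    Continuous fun t => fellerSum Q K t x y :=
  continuous_finsetSum _ fun k _ => fellerIter_continuous hQ k x y

theorem fellerSum_hasDerivAt (hQ : ∀ x, (Function.support (Q x)).Finite) (K : ℕ) (t : ℝ)
    (x y : S) :
    HasDerivAt (fun t => fellerSum Q (K + 1) t x y) (Q x x * fellerSum Q (K + 1) t x y +
      (genOp Q (fun z => fellerSum Q K t z y) x - Q x x * fellerSum Q K t x y)) t := by
  simp only [fellerSum, Finset.sum_range_succ']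
  have h0 : HasDerivAt (fun t => fellerIter Q 0 t x y) (Q x x * fellerIter Q 0 t x y) t := by
    simp only [fellerIter]
    split_ifs with h
    · simpa [mul_comm] using ((hasDerivAt_id' t).const_mul (Q x x)).exp
    · simpa using hasDerivAt_const t (0 : ℝ)
  have h1 := HasDerivAt.fun_sum (u := Finset.range K) fun k _ =>
    fellerIter_succ_hasDerivAt hQ k t x y
  refine (h1.fun_add h0).congr_deriv ?_
  rw [genOp_sum hQ, Finset.sum_add_distrib, Finset.sum_sub_distrib, ← Finset.mul_sum,
    ← Finset.mul_sum]
  ring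

open scoped Classical in
theorem fellerSum_zero (K : ℕ) (x y : S) :
    fellerSum Q (K + 1) 0 x y = if x = y then 1 else 0 := by
  rw [fellerSum, Finset.sum_range_succ']
  simp [fellerIter]

/-- The minimal chain is substochastic, already when only paths with few jumps are counted. -/
theorem fellerSum_sum_le_one (hQ : ∀ x, (Function.support (Q x)).Finite)
    (hoff : ∀ x y, x ≠ y → 0 ≤ Q x y) (hrow : ∀ x, genOp Q (fun _ => 1) x ≤ 0) (F : Finset S)
    (K : ℕ) {t : ℝ} (ht : 0 ≤ t) (x : S) : ∑ y ∈ F, fellerSum Q K t x y ≤ 1 := by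
  classical
  induction K generalizing t x with
  | zero => simp [fellerSum]
  | succ K ih =>
    set T : ℝ → S → ℝ := fun t x => ∑ y ∈ F, fellerSum Q K t x y with hT
    set T' : ℝ → ℝ := fun t => ∑ y ∈ F, fellerSum Q (K + 1) t x y with hT'
    have hder : ∀ t, HasDerivAt T' (Q x x * T' t + (genOp Q (T t) x - Q x x * T t x)) t := by
      intro t
      refine (HasDerivAt.fun_sum fun y _ => fellerSum_hasDerivAt hQ K t x y).congr_deriv ?_
      rw [genOp_sum hQ, Finset.sum_add_distrib, Finset.sum_sub_distrib, ← Finset.mul_sum,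
        ← Finset.mul_sum]
    -- the deficit `1 - T'` is compared with the exponential `exp (Q x x * t)`
    have hder2 : ∀ t, HasDerivAt (fun t => Real.exp (-(Q x x * t)) * (T' t - 1))
        (Real.exp (-(Q x x * t)) * (Q x x + (genOp Q (T t) x - Q x x * T t x))) t := by
      intro t
      have h2 : HasDerivAt (fun t => Real.exp (-(Q x x * t)))
          (Real.exp (-(Q x x * t)) * (-Q x x)) t := by
        simpa using ((hasDerivAt_id' t).const_mul (Q x x)).fun_neg.exp
      refine (h2.fun_mul ((hder t).sub_const 1)).congr_deriv ?_
      ring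
    have hanti : AntitoneOn (fun t => Real.exp (-(Q x x * t)) * (T' t - 1)) (Ici 0) := by
      refine antitoneOn_of_deriv_nonpos (convex_Ici 0)
        (fun t _ => (hder2 t).continuousAt.continuousWithinAt)
        (fun t _ => (hder2 t).differentiableAt.differentiableWithinAt) fun t ht => ?_
      rw [interior_Ici] at ht
      rw [(hder2 t).deriv]
      refine mul_nonpos_of_nonneg_of_nonpos (Real.exp_pos _).le ?_
      have h1 := genOp_sub_diag_mono hQ hoff (f := T t) (g := fun _ => 1) x
        fun y _ _ => ih (le_of_lt ht) y
      have h2 := hrow x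
      linarith
    have h0 : T' 0 ≤ 1 := by
      simp only [hT', fellerSum_zero]
      rw [Finset.sum_ite_eq]
      split_ifs <;> norm_num
    have h1 := hanti (self_mem_Ici) ht ht
    simp only [mul_zero, neg_zero, Real.exp_zero, one_mul] at h1
    have h2 : Real.exp (-(Q x x * t)) * (T' t - 1) ≤ 0 := h1.trans (by linarith)
    have h3 := nonpos_of_mul_nonpos_right h2 (Real.exp_pos _)
    change T' t ≤ 1
    linarith

end feller

namespace IsTame

variable {Q : S → S → ℝ} {V : S → ℝ} {C : ℝ}

theorem countable (hQ : IsTame Q V C) : Countable S := by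
  rw [← Set.countable_univ_iff]
  have : (univ : Set S) = ⋃ n : ℕ, {x | V x ≤ n} := by
    ext x
    simpa using exists_nat_ge (V x)
  rw [this]
  exact countable_iUnion fun n => (hQ.finite_sublevel n).countable

theorem fellerSum_le_one (hQ : IsTame Q V C) (K : ℕ) {t : ℝ} (ht : 0 ≤ t) (x y : S) :
    fellerSum Q K t x y ≤ 1 := by
  simpa using fellerSum_sum_le_one hQ.finite_row hQ.offDiag hQ.row_nonpos {y} K ht x

theorem tendsto_fellerSum (hQ : IsTame Q V C) {t : ℝ} (ht : 0 ≤ t) (x y : S) :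
    Tendsto (fun K => fellerSum Q K t x y) atTop (𝓝 (chainTransition Q t x y)) := by
  have h : Summable fun k => fellerIter Q k t x y :=
    summable_of_sum_range_le (fun k => fellerIter_nonneg hQ.offDiag k ht x y)
      fun K => hQ.fellerSum_le_one K ht x y
  exact h.hasSum.tendsto_sum_nat

theorem chain_nonneg (hQ : IsTame Q V C) {t : ℝ} (ht : 0 ≤ t) (x y : S) :
    0 ≤ chainTransition Q t x y :=
  tsum_nonneg fun k => fellerIter_nonneg hQ.offDiag k ht x y

theorem sum_chain_le_one (hQ : IsTame Q V C) (F : Finset S) {t : ℝ} (ht : 0 ≤ t) (x : S) :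
    ∑ y ∈ F, chainTransition Q t x y ≤ 1 :=
  le_of_tendsto (tendsto_finsetSum F fun y _ => hQ.tendsto_fellerSum ht x y)
    (Eventually.of_forall fun K =>
      fellerSum_sum_le_one hQ.finite_row hQ.offDiag hQ.row_nonpos F K ht x)

theorem summable_chain (hQ : IsTame Q V C) {t : ℝ} (ht : 0 ≤ t) (x : S) :
    Summable fun y => chainTransition Q t x y :=
  summable_of_sum_le (fun y => hQ.chain_nonneg ht x y) fun F => hQ.sum_chain_le_one F ht x

open scoped Classical in
theorem chain_zero (hQ : IsTame Q V C) (x y : S) :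
    chainTransition Q 0 x y = if x = y then 1 else 0 := by
  refine tendsto_nhds_unique ((hQ.tendsto_fellerSum le_rfl x y).comp (tendsto_add_atTop_nat 1)) ?_
  simp [Function.comp_def, fellerSum_zero]

theorem tendsto_genOp (hQ : IsTame Q V C) {ι : Type*} {l : Filter ι} {F : ι → S → ℝ} {f : S → ℝ}
    (h : ∀ x, Tendsto (fun i => F i x) l (𝓝 (f x))) (x : S) :
    Tendsto (fun i => genOp Q (F i) x) l (𝓝 (genOp Q f x)) := by
  simp only [genOp_eq_sum hQ.finite_row]
  exact tendsto_finsetSum _ fun y _ => (h y).const_mul _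

/-- The transition function of the minimal chain solves the backward equation. -/
theorem isBddSolution_chain (hQ : IsTame Q V C) (y : S) :
    IsBddSolution Q (fun t x => chainTransition Q t x y) 1 := by
  have hb : ∀ K t, 0 ≤ t → ∀ x, |fellerSum Q K t x y| ≤ 1 := fun K t ht x => by
    rw [abs_of_nonneg (fellerSum_nonneg hQ.offDiag K ht x y)]
    exact hQ.fellerSum_le_one K ht x y
  have hlim := fun t (ht : 0 ≤ t) x => hQ.tendsto_fellerSum ht x y
  have hlim1 := fun t (ht : 0 ≤ t) x => (hlim t ht x).comp (tendsto_add_atTop_nat 1)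
  refine isBddSolution_of_tendsto hQ.finite_row (l := atTop)
    (F := fun K t x => fellerSum Q (K + 1) t x y)
    (G := fun K t x => Q x x * fellerSum Q (K + 1) t x y +
      (genOp Q (fun z => fellerSum Q K t z y) x - Q x x * fellerSum Q K t x y))
    (B' := fun x => |Q x x| * 1 +
      ((∑ y ∈ (hQ.finite_row x).toFinset, |Q x y|) * 1 + |Q x x| * 1))
    (fun K x => (fellerSum_continuous hQ.finite_row _ x y).continuousOn) ?_
    (fun K t _ x => fellerSum_hasDerivAt hQ.finite_row K t x y)
    (fun K t ht x => hb _ t ht x) ?_ hlim1 ?_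
  · intro K x
    have h0 := continuousOn_genOp hQ.finite_row (s := Ici 0)
      (fun z => (fellerSum_continuous hQ.finite_row K z y).continuousOn) x
    have h1 := (fellerSum_continuous hQ.finite_row (K + 1) x y).continuousOn (s := Ici 0)
    have h2 := (fellerSum_continuous hQ.finite_row K x y).continuousOn (s := Ici 0)
    fun_prop
  · intro K t ht x
    refine (abs_add_le _ _).trans (add_le_add ?_ ((abs_sub _ _).trans (add_le_add ?_ ?_)))
    · rw [abs_mul]; exact mul_le_mul_of_nonneg_left (hb _ t ht x) (abs_nonneg _)
    · exact abs_genOp_le hQ.finite_row (hb K t ht) x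
    · rw [abs_mul]; exact mul_le_mul_of_nonneg_left (hb _ t ht x) (abs_nonneg _)
  · intro t ht x
    have h1 := (hlim1 t ht x).const_mul (Q x x)
    have h2 := (hlim t ht x).const_mul (Q x x)
    have h3 := hQ.tendsto_genOp (hlim t ht) x
    have h4 := h1.add (h3.sub h2)
    rw [add_sub_cancel] at h4
    exact h4

end IsTame

/-- `expect Q t a x` is the expectation of `a` at time `t` for the minimal chain with rate matrix
`Q` started at `x`. -/
noncomputable def expect (Q : S → S → ℝ) (t : ℝ) (a : S → ℝ) (x : S) : ℝ :=
  ∑' y, chainTransition Q t x y * a y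

namespace IsTame

variable {Q : S → S → ℝ} {V : S → ℝ} {C : ℝ}

theorem summable_expect (hQ : IsTame Q V C) {t : ℝ} (ht : 0 ≤ t) {a : S → ℝ} {B : ℝ}
    (ha : ∀ y, |a y| ≤ B) (x : S) : Summable fun y => chainTransition Q t x y * a y := by
  refine Summable.of_norm_bounded ((hQ.summable_chain ht x).mul_right B) fun y => ?_
  rw [Real.norm_eq_abs, abs_mul, abs_of_nonneg (hQ.chain_nonneg ht x y)]
  exact mul_le_mul_of_nonneg_left (ha y) (hQ.chain_nonneg ht x y)

theorem expect_zero (hQ : IsTame Q V C) (a : S → ℝ) (x : S) : expect Q 0 a x = a x := by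
  classical
  unfold expect
  simp only [hQ.chain_zero]
  rw [tsum_eq_single x fun y hy => by simp [Ne.symm hy]]
  simp

/-- Expectations of bounded functions solve the backward equation. -/
theorem isBddSolution_expect (hQ : IsTame Q V C) {a : S → ℝ} {B : ℝ} (ha : ∀ y, |a y| ≤ B) :
    IsBddSolution Q (fun t x => expect Q t a x) B := by
  have := hQ.countable
  have hsol : ∀ F : Finset S, IsBddSolution Q
      (fun t x => ∑ y ∈ F, a y * chainTransition Q t x y) (∑ y ∈ F, |a y| * 1) := fun F =>
    IsBddSolution.sum_smul hQ.finite_row F a (f := fun y t x => chainTransition Q t x y)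
      fun y _ => hQ.isBddSolution_chain y
  have hB : ∀ (F : Finset S) t, 0 ≤ t → ∀ x, |∑ y ∈ F, a y * chainTransition Q t x y| ≤ B := by
    intro F t ht x
    have hB0 : 0 ≤ B := (abs_nonneg _).trans (ha x)
    calc |∑ y ∈ F, a y * chainTransition Q t x y|
        ≤ ∑ y ∈ F, |a y * chainTransition Q t x y| := Finset.abs_sum_le_sum_abs _ _
      _ ≤ ∑ y ∈ F, B * chainTransition Q t x y := by
          refine Finset.sum_le_sum fun y _ => ?_
          rw [abs_mul, abs_of_nonneg (hQ.chain_nonneg ht x y)]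
          exact mul_le_mul_of_nonneg_right (ha y) (hQ.chain_nonneg ht x y)
      _ = B * ∑ y ∈ F, chainTransition Q t x y := (Finset.mul_sum _ _ _).symm
      _ ≤ B * 1 := mul_le_mul_of_nonneg_left (hQ.sum_chain_le_one F ht x) hB0
      _ = B := mul_one B
  have hlim : ∀ t, 0 ≤ t → ∀ x, Tendsto (fun F : Finset S => ∑ y ∈ F, a y * chainTransition Q t x y)
      atTop (𝓝 (expect Q t a x)) := by
    intro t ht x
    have := (hQ.summable_expect ht ha x).hasSum
    simp only [mul_comm (a _)]
    exact this
  exact isBddSolution_of_tendsto hQ.finite_row (l := atTop)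
    (F := fun F t x => ∑ y ∈ F, a y * chainTransition Q t x y)
    (G := fun F t x => genOp Q (fun x => ∑ y ∈ F, a y * chainTransition Q t x y) x)
    (B' := fun x => (∑ y ∈ (hQ.finite_row x).toFinset, |Q x y|) * B)
    (fun F => (hsol F).cont) (fun F => continuousOn_genOp hQ.finite_row (hsol F).cont)
    (fun F => (hsol F).deriv) hB (fun F t ht x => abs_genOp_le hQ.finite_row (hB F t ht) x) hlim
    (fun t ht => hQ.tendsto_genOp (hlim t ht))

/-- A bounded solution of the backward equation is the expectation of its initial value. -/
theorem eq_expect (hQ : IsTame Q V C) {f : ℝ → S → ℝ} {B : ℝ} (hf : IsBddSolution Q f B) {t : ℝ}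
    (ht : 0 ≤ t) (x : S) : f t x = expect Q t (f 0) x :=
  hQ.unique hf (hQ.isBddSolution_expect (hf.bdd 0 le_rfl)) (fun x => (hQ.expect_zero _ x).symm) ht x

open scoped Classical in
/-- A bounded solution of the backward equation started from the indicator of `y` is the transition
probability to `y`. -/
theorem eq_chain (hQ : IsTame Q V C) {f : ℝ → S → ℝ} {B : ℝ} (hf : IsBddSolution Q f B) (y : S)
    (h0 : ∀ x, f 0 x = if x = y then 1 else 0) {t : ℝ} (ht : 0 ≤ t) (x : S) :
    f t x = chainTransition Q t x y :=
  hQ.unique hf (hQ.isBddSolution_chain y) (fun x => by rw [h0, hQ.chain_zero]) ht x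

/-- A conservative rate matrix with a Lyapunov function does not explode: its minimal chain is
honest. -/
theorem hasSum_chain (hQ : IsTame Q V C) (hcons : ∀ x, genOp Q (fun _ => 1) x = 0) {t : ℝ}
    (ht : 0 ≤ t) (x : S) : HasSum (fun y => chainTransition Q t x y) 1 := by
  have h1 : IsBddSolution Q (fun _ _ => (1 : ℝ)) 1 :=
    ⟨fun x => continuousOn_const, fun t _ x => by rw [hcons]; exact hasDerivAt_const t 1,
      fun t _ x => by simp⟩
  have h2 := hQ.eq_expect h1 ht x
  simp only [expect, mul_one] at h2
  rw [h2]
  exact (hQ.summable_chain ht x).hasSum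

theorem chapman_kolmogorov (hQ : IsTame Q V C) {s t : ℝ} (hs : 0 ≤ s) (ht : 0 ≤ t) (x y : S) :
    HasSum (fun z => chainTransition Q s x z * chainTransition Q t z y)
      (chainTransition Q (s + t) x y) := by
  have h := hQ.eq_expect ((hQ.isBddSolution_chain y).shift ht) hs x
  simp only [zero_add] at h
  rw [h]
  exact (hQ.summable_expect hs ((hQ.isBddSolution_chain y).bdd t ht) x).hasSum

end IsTame

end rateMatrix

/-! ### Coalescing flows -/

/-- `u` is a Lyapunov function for the birth and death chain with rates `lam`, `mu`: nonnegative,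
with finite sublevel sets and with drift at most `c`. -/
structure IsLyapunov (lam mu : ℤ → ℝ) (u : ℤ → ℝ) (c : ℝ) : Prop where
  lam_nonneg : ∀ x, 0 ≤ lam x
  mu_nonneg : ∀ x, 0 ≤ mu x
  nonneg : ∀ x, 0 ≤ u x
  const_nonneg : 0 ≤ c
  drift : ∀ x, lam x * (u (x + 1) - u x) + mu x * (u (x - 1) - u x) ≤ c
  finite_sublevel : ∀ M, {x | u x ≤ M}.Finite

theorem hasSum_ite_eq_mul {S : Type*} [DecidableEq S] (p : S) (c : ℝ) (f : S → ℝ) :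
    HasSum (fun w => (if w = p then c else 0) * f w) (c * f p) := by
  convert hasSum_ite_eq p (c * f p) using 2 with w
  split_ifs with h
  · rw [h]
  · rw [zero_mul]

section flow

variable {ι : Type*} [Fintype ι]

theorem moveSite_ne {z : ι → ℤ} {a b : ℤ} (ha : a ∈ Finset.univ.image z) (hb : b ≠ a) :
    moveSite z a b ≠ z := by
  obtain ⟨i, -, hi⟩ := Finset.mem_image.mp ha
  intro h
  have := congrFun h i
  simp only [moveSite, hi, if_true] at this
  exact hb this

theorem moveSite_eq_self {z : ι → ℤ} {a b : ℤ} (ha : a ∉ Finset.univ.image z) :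
    moveSite z a b = z := by
  ext i
  rw [moveSite, if_neg]
  rintro rfl
  exact ha (Finset.mem_image_of_mem z (Finset.mem_univ i))

theorem flowRate_eq (lam mu : ℤ → ℝ) (z w : ι → ℤ) :
    flowRate lam mu z w = ∑ a ∈ Finset.univ.image z,
      (((if w = moveSite z a (a + 1) then lam a else 0) - (if w = z then lam a else 0)) +
        ((if w = moveSite z a (a - 1) then mu a else 0) - (if w = z then mu a else 0))) := by
  unfold flowRate
  split_ifs with h
  · rw [← Finset.sum_neg_distrib]
    refine Finset.sum_congr rfl fun a ha => ?_
    rw [if_neg, if_neg]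
    · ring
    · rw [h]; exact (moveSite_ne ha (by omega)).symm
    · rw [h]; exact (moveSite_ne ha (by omega)).symm
  · simp

/-- The generator of the coalescing flow, site by site; `T` is any finite set of sites which
contains all the occupied ones. -/
theorem genOp_flowRate (lam mu : ℤ → ℝ) (f : (ι → ℤ) → ℝ) (z : ι → ℤ) {T : Finset ℤ}
    (hT : ∀ i, z i ∈ T) :
    genOp (flowRate lam mu) f z = ∑ a ∈ T, (lam a * (f (moveSite z a (a + 1)) - f z) +
      mu a * (f (moveSite z a (a - 1)) - f z)) := by
  have hsub : Finset.univ.image z ⊆ T := by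
    intro a ha
    obtain ⟨i, -, rfl⟩ := Finset.mem_image.mp ha
    exact hT i
  rw [← Finset.sum_subset hsub]
  · unfold genOp
    refine HasSum.tsum_eq ?_
    simp only [flowRate_eq, Finset.sum_mul]
    refine hasSum_sum fun a _ => ?_
    simp only [add_mul, sub_mul, mul_sub]
    exact ((hasSum_ite_eq_mul _ _ f).sub (hasSum_ite_eq_mul _ _ f)).add
      ((hasSum_ite_eq_mul _ _ f).sub (hasSum_ite_eq_mul _ _ f))
  · intro a _ ha
    simp [moveSite_eq_self ha]

theorem flowRate_finite_row (lam mu : ℤ → ℝ) (z : ι → ℤ) :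
    (Function.support (flowRate lam mu z)).Finite := by
  classical
  refine ((Finset.univ.image z).finite_toSet.image (fun a => moveSite z a (a + 1)) |>.union
    (((Finset.univ.image z).finite_toSet.image fun a => moveSite z a (a - 1)).union
      (finite_singleton z))).subset ?_
  intro w hw
  by_contra hcon
  simp only [mem_union, mem_image, mem_singleton_iff, not_or, not_exists, not_and] at hcon
  apply hw
  rw [flowRate_eq]
  refine Finset.sum_eq_zero fun a ha => ?_
  rw [if_neg fun h => hcon.1 a (by simpa using ha) h.symm, if_neg hcon.2.2,
    if_neg fun h => hcon.2.1 a (by simpa using ha) h.symm, if_neg hcon.2.2]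
  simp

/-- A Lyapunov function of the single-particle chain, summed over the particles, is one for the
coalescing flow. -/
theorem isTame_flowRate {lam mu u : ℤ → ℝ} {c : ℝ} (h : IsLyapunov lam mu u c) :
    IsTame (flowRate (ι := ι) lam mu) (fun z => ∑ i, u (z i)) (Fintype.card ι * c) where
  offDiag z w hzw := by
    rw [flowRate, if_neg (Ne.symm hzw)]
    refine Finset.sum_nonneg fun a _ => add_nonneg ?_ ?_
    · split_ifs; exacts [h.lam_nonneg a, le_rfl]
    · split_ifs; exacts [h.mu_nonneg a, le_rfl]
  finite_row := flowRate_finite_row lam mu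
  row_nonpos z := by
    rw [genOp_flowRate lam mu _ z (T := Finset.univ.image z) (by simp)]
    simp
  V_nonneg z := Finset.sum_nonneg fun i _ => h.nonneg _
  C_nonneg := mul_nonneg (Nat.cast_nonneg _) h.const_nonneg
  drift z := by
    rw [genOp_flowRate lam mu _ z (T := Finset.univ.image z) (by simp)]
    have key : ∀ a, lam a * (∑ i, u (moveSite z a (a + 1) i) - ∑ i, u (z i)) +
        mu a * (∑ i, u (moveSite z a (a - 1) i) - ∑ i, u (z i)) =
        ∑ i, if z i = a then
          lam (z i) * (u (z i + 1) - u (z i)) + mu (z i) * (u (z i - 1) - u (z i)) else 0 := by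
      intro a
      rw [← Finset.sum_sub_distrib, ← Finset.sum_sub_distrib, Finset.mul_sum, Finset.mul_sum,
        ← Finset.sum_add_distrib]
      refine Finset.sum_congr rfl fun i _ => ?_
      simp only [moveSite]
      split_ifs with hi
      · rw [hi]
      · simp
    simp only [key]
    rw [Finset.sum_comm]
    have : ∀ i ∈ Finset.univ, (∑ a ∈ Finset.univ.image z, if z i = a then
          lam (z i) * (u (z i + 1) - u (z i)) + mu (z i) * (u (z i - 1) - u (z i)) else 0) ≤ c := by
      intro i _
      rw [Finset.sum_ite_eq, if_pos (by simp)]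
      exact h.drift (z i)
    refine (Finset.sum_le_sum this).trans ?_
    simp
  finite_sublevel M := by
    refine (Set.Finite.pi' fun _ : ι => h.finite_sublevel M).subset ?_
    intro z hz i
    exact (Finset.single_le_sum (f := fun i => u (z i)) (fun i _ => h.nonneg _)
      (Finset.mem_univ i)).trans hz

section

variable {lam mu : ℤ → ℝ} {V : (ι → ℤ) → ℝ} {C : ℝ}

/-- The flow preserves the order of the points and keeps coinciding points together; so
expectations only depend on the values on the configurations which are ordered like the initial
one. -/
theorem expect_flow_mono (hQ : IsTame (flowRate lam mu) V C) {a a' : (ι → ℤ) → ℝ} {B B' : ℝ}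
    (ha : ∀ w, |a w| ≤ B) (ha' : ∀ w, |a' w| ≤ B') {z : ι → ℤ}
    (h : ∀ w : ι → ℤ, (∀ k l, z k ≤ z l → w k ≤ w l) → a w ≤ a' w) {t : ℝ} (ht : 0 ≤ t) :
    expect (flowRate lam mu) t a z ≤ expect (flowRate lam mu) t a' z := by
  classical
  -- `O` is invariant under the flow, so the maximum principle can be applied on `O` only
  set O : Set (ι → ℤ) := {w | ∀ k l, z k ≤ z l → w k ≤ w l} with hO
  have hmove : ∀ w ∈ O, ∀ c d : ℤ, (d = c + 1 ∨ d = c - 1) → moveSite w c d ∈ O := by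
    intro w hw c d hd k l hkl
    have := hw k l hkl
    simp only [moveSite]
    split_ifs <;> omega
  have s1 := hQ.isBddSolution_expect ha
  have s2 := hQ.isBddSolution_expect ha'
  set f : ℝ → (ι → ℤ) → ℝ := fun t w => if w ∈ O then
    expect (flowRate lam mu) t a w - expect (flowRate lam mu) t a' w else 0 with hf
  have hB0 : 0 ≤ B := (abs_nonneg _).trans (ha z)
  have hB0' : 0 ≤ B' := (abs_nonneg _).trans (ha' z)
  have hz : z ∈ O := fun k l hkl => hkl
  have := hQ.nonpos_of_subsolution (f := f) (B := B + B') ?_ ?_ ?_ ?_ ht z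
  · simp only [hf, if_pos hz] at this
    linarith
  · intro t ht x
    simp only [hf]
    split_ifs
    · have h1 := abs_le.mp (s1.bdd t ht x)
      have h2 := abs_le.mp (s2.bdd t ht x)
      linarith
    · linarith
  · intro x
    simp only [hf]
    split_ifs
    · exact (s1.cont x).sub (s2.cont x)
    · exact continuousOn_const
  · intro x
    simp only [hf]
    split_ifs with hx
    · rw [hQ.expect_zero, hQ.expect_zero]
      linarith [h x hx]
    · exact le_rfl
  · intro t ht x hpos
    have hx : x ∈ O := by
      by_contra hx
      simp [hf, hx] at hpos
    refine ⟨genOp (flowRate lam mu) (expect (flowRate lam mu) t a) x -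
      genOp (flowRate lam mu) (expect (flowRate lam mu) t a') x, ?_, ?_⟩
    rotate_left
    · simp only [hf, if_pos hx]
      exact (s1.deriv t ht x).fun_sub (s2.deriv t ht x)
    · rw [← genOp_sub hQ.finite_row, genOp_flowRate lam mu _ x (T := Finset.univ.image x) (by simp),
        genOp_flowRate lam mu _ x (T := Finset.univ.image x) (by simp)]
      refine le_of_eq (Finset.sum_congr rfl fun c _ => ?_)
      simp only [hf, if_pos hx, if_pos (hmove x hx c (c + 1) (Or.inl rfl)),
        if_pos (hmove x hx c (c - 1) (Or.inr rfl))]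

theorem expect_flow_congr (hQ : IsTame (flowRate lam mu) V C) {a a' : (ι → ℤ) → ℝ} {B B' : ℝ}
    (ha : ∀ w, |a w| ≤ B) (ha' : ∀ w, |a' w| ≤ B') {z : ι → ℤ}
    (h : ∀ w : ι → ℤ, (∀ k l, z k ≤ z l → w k ≤ w l) → a w = a' w) {t : ℝ} (ht : 0 ≤ t) :
    expect (flowRate lam mu) t a z = expect (flowRate lam mu) t a' z :=
  le_antisymm (expect_flow_mono hQ ha ha' (fun w hw => (h w hw).le) ht)
    (expect_flow_mono hQ ha' ha (fun w hw => (h w hw).ge) ht)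

/-- Consistency of the flow: the points selected by `σ` evolve like the flow with index set
`ι'`. -/
theorem expect_flow_comp {ι' : Type*} [Fintype ι'] (hQ : IsTame (flowRate lam mu) V C)
    {V' : (ι' → ℤ) → ℝ} {C' : ℝ} (hQ' : IsTame (flowRate lam mu) V' C') (σ : ι' → ι)
    {a : (ι' → ℤ) → ℝ} {B : ℝ} (ha : ∀ w, |a w| ≤ B) {t : ℝ} (ht : 0 ≤ t) (z : ι → ℤ) :
    expect (flowRate lam mu) t a (z ∘ σ) =
      expect (flowRate lam mu) t (fun w => a (w ∘ σ)) z := by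
  have s := hQ'.isBddSolution_expect ha
  have hs : IsBddSolution (flowRate lam mu)
      (fun t (z : ι → ℤ) => expect (flowRate lam mu) t a (z ∘ σ)) B := by
    refine ⟨fun x => s.cont _, fun t ht x => ?_, fun t ht x => s.bdd t ht _⟩
    refine (s.deriv t ht (x ∘ σ)).congr_deriv ?_
    rw [genOp_flowRate lam mu _ x (T := Finset.univ.image x) (by simp),
      genOp_flowRate lam mu _ (x ∘ σ) (T := Finset.univ.image x) (by simp)]
    rfl
  rw [hQ.eq_expect hs ht z]
  simp only [hQ'.expect_zero]

/-- Two flows whose rates agree where `V ≤ M` have close expectations. -/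
theorem abs_expect_flow_sub_le (hQ : IsTame (flowRate lam mu) V C) {lam' mu' : ℤ → ℝ}
    {V' : (ι → ℤ) → ℝ} {C' : ℝ} (hQ' : IsTame (flowRate lam' mu') V' C') {M : ℝ} (hM : 0 < M)
    (hagree : ∀ w, V w ≤ M → ∀ i, lam' (w i) = lam (w i) ∧ mu' (w i) = mu (w i))
    {a : (ι → ℤ) → ℝ} {B : ℝ} (ha : ∀ w, |a w| ≤ B) {t : ℝ} (ht : 0 ≤ t) (z : ι → ℤ) :
    |expect (flowRate lam' mu') t a z - expect (flowRate lam mu) t a z|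
      ≤ 2 * B / M * (V z + C * t) := by
  have s := hQ.isBddSolution_expect ha
  have s' := hQ'.isBddSolution_expect ha
  have hB0 : 0 ≤ B := (abs_nonneg _).trans (ha z)
  have hgen : ∀ f w, V w ≤ M → genOp (flowRate lam' mu') f w = genOp (flowRate lam mu) f w := by
    intro f w hw
    rw [genOp_flowRate lam mu _ w (T := Finset.univ.image w) (by simp),
      genOp_flowRate lam' mu' _ w (T := Finset.univ.image w) (by simp)]
    refine Finset.sum_congr rfl fun c hc => ?_
    obtain ⟨i, -, rfl⟩ := Finset.mem_image.mp hc
    rw [(hagree w hw i).1, (hagree w hw i).2]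
  rw [abs_le']
  constructor
  · refine hQ.comparison (f := fun t w => expect (flowRate lam' mu') t a w -
      expect (flowRate lam mu) t a w) (by positivity) hM ht (fun t ht x => ?_)
      (fun x => ((s'.cont x).sub (s.cont x)).mono Icc_subset_Ici_self) (fun x => ?_)
      (fun t ht x hx _ => ⟨_, ?_, (s'.deriv t ht.1 x).fun_sub (s.deriv t ht.1 x)⟩) z
    · have h1 := abs_le.mp (s.bdd t ht.1 x)
      have h2 := abs_le.mp (s'.bdd t ht.1 x)
      linarith
    · simp [hQ.expect_zero, hQ'.expect_zero]
    · rw [genOp_sub hQ.finite_row, hgen _ x hx]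
  · rw [neg_sub]
    refine hQ.comparison (f := fun t w => expect (flowRate lam mu) t a w -
      expect (flowRate lam' mu') t a w) (by positivity) hM ht (fun t ht x => ?_)
      (fun x => ((s.cont x).sub (s'.cont x)).mono Icc_subset_Ici_self) (fun x => ?_)
      (fun t ht x hx _ => ⟨_, ?_, (s.deriv t ht.1 x).fun_sub (s'.deriv t ht.1 x)⟩) z
    · have h1 := abs_le.mp (s.bdd t ht.1 x)
      have h2 := abs_le.mp (s'.bdd t ht.1 x)
      linarith
    · simp [hQ.expect_zero, hQ'.expect_zero]
    · rw [genOp_sub hQ.finite_row, hgen _ x hx]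

end

end flow

/-- Birth rates of the chain reflected at the ends of the window `[-N, N]`. -/
noncomputable def truncBirth (N : ℕ) (lam : ℤ → ℝ) (x : ℤ) : ℝ :=
  if -(N : ℤ) ≤ x ∧ x < N then lam x else 0

/-- Death rates of the chain reflected at the ends of the window `[-N, N]`. -/
noncomputable def truncDeath (N : ℕ) (mu : ℤ → ℝ) (x : ℤ) : ℝ :=
  if -(N : ℤ) < x ∧ x ≤ N then mu x else 0

theorem isLyapunov_trunc {lam mu : ℤ → ℝ} (hlam : ∀ x, 0 ≤ lam x) (hmu : ∀ x, 0 ≤ mu x) (N : ℕ) :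
    IsLyapunov (truncBirth N lam) (truncDeath N mu) (fun x => |(x : ℝ)|)
      (∑ x ∈ Finset.Icc (-(N : ℤ)) N, (lam x + mu x)) := by
  have hc : 0 ≤ ∑ x ∈ Finset.Icc (-(N : ℤ)) N, (lam x + mu x) :=
    Finset.sum_nonneg fun x _ => add_nonneg (hlam x) (hmu x)
  have h1 : ∀ x, 0 ≤ truncBirth N lam x := fun x => by
    unfold truncBirth; split_ifs; exacts [hlam x, le_rfl]
  have h2 : ∀ x, 0 ≤ truncDeath N mu x := fun x => by
    unfold truncDeath; split_ifs; exacts [hmu x, le_rfl]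
  refine ⟨h1, h2, fun x => abs_nonneg _, hc, fun x => ?_, fun M => ?_⟩
  · have e1 : |((x + 1 : ℤ) : ℝ)| - |(x : ℝ)| ≤ 1 := by
      push_cast
      have := abs_add_le (x : ℝ) 1
      rw [abs_one] at this
      linarith
    have e2 : |((x - 1 : ℤ) : ℝ)| - |(x : ℝ)| ≤ 1 := by
      push_cast
      have := abs_sub (x : ℝ) 1
      rw [abs_one] at this
      linarith
    have e3 : truncBirth N lam x + truncDeath N mu x ≤
        ∑ x ∈ Finset.Icc (-(N : ℤ)) N, (lam x + mu x) := by
      by_cases hx : x ∈ Finset.Icc (-(N : ℤ)) N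
      · refine le_trans ?_ (Finset.single_le_sum (f := fun x => lam x + mu x)
          (fun x _ => add_nonneg (hlam x) (hmu x)) hx)
        unfold truncBirth truncDeath
        have := hlam x
        have := hmu x
        split_ifs <;> linarith
      · rw [Finset.mem_Icc] at hx
        rw [truncBirth, truncDeath, if_neg (by omega), if_neg (by omega), add_zero]
        exact hc
    have e4 := mul_le_mul_of_nonneg_left e1 (h1 x)
    have e5 := mul_le_mul_of_nonneg_left e2 (h2 x)
    linarith
  · refine (Set.finite_Icc (-⌈M⌉) ⌈M⌉).subset fun x hx => ?_
    have hx : |(x : ℝ)| ≤ M := hx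
    rw [← Int.cast_abs] at hx
    have : |x| ≤ ⌈M⌉ := by
      have := hx.trans (Int.le_ceil M)
      exact_mod_cast this
    exact ⟨(abs_le.mp this).1, (abs_le.mp this).2⟩

/-- The flows reflected at the ends of large windows approximate a nonexplosive flow. -/
theorem tendsto_expect_trunc {ι : Type*} [Fintype ι] {lam mu : ℤ → ℝ} {V : (ι → ℤ) → ℝ} {C : ℝ}
    (hlam : ∀ x, 0 ≤ lam x) (hmu : ∀ x, 0 ≤ mu x) (hQ : IsTame (flowRate lam mu) V C)
    {a : (ι → ℤ) → ℝ} {B : ℝ} (ha : ∀ w, |a w| ≤ B) {t : ℝ} (ht : 0 ≤ t) (z : ι → ℤ) :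
    Tendsto (fun N => expect (flowRate (truncBirth N lam) (truncDeath N mu)) t a z) atTop
      (𝓝 (expect (flowRate lam mu) t a z)) := by
  have key : ∀ M : ℝ, 0 < M → ∀ᶠ N : ℕ in atTop,
      |expect (flowRate (truncBirth N lam) (truncDeath N mu)) t a z -
        expect (flowRate lam mu) t a z| ≤ 2 * B / M * (V z + C * t) := by
    intro M hM
    have hfin := hQ.finite_sublevel M
    have hbd : ∀ᶠ N : ℕ in atTop, ∀ w ∈ {w | V w ≤ M}, ∀ i, |w i| < N := by
      rw [hfin.eventually_all]
      intro w _
      rw [eventually_all]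
      intro i
      filter_upwards [eventually_gt_atTop (w i).natAbs] with N hN
      rw [abs_lt]
      constructor <;> omega
    filter_upwards [hbd] with N hN
    refine abs_expect_flow_sub_le hQ (isTame_flowRate (isLyapunov_trunc hlam hmu N)) hM
      (fun w hw i => ?_) ha ht z
    have := abs_lt.mp (hN w hw i)
    rw [truncBirth, truncDeath, if_pos (by omega), if_pos (by omega)]
    exact ⟨rfl, rfl⟩
  have hlim : Tendsto (fun M : ℝ => 2 * B / M * (V z + C * t)) atTop (𝓝 0) := by
    have h1 : Tendsto (fun M : ℝ => 2 * B / M) atTop (𝓝 0) :=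
      tendsto_const_nhds.div_atTop tendsto_id
    simpa using h1.mul_const (V z + C * t)
  rw [Metric.tendsto_atTop']
  intro ε hε
  obtain ⟨M, hMε, hM⟩ := ((hlim.eventually_lt_const hε).and (eventually_gt_atTop 0)).exists
  obtain ⟨N₀, hN₀⟩ := eventually_atTop.mp (key M hM)
  exact ⟨N₀, fun N hN => (hN₀ N hN.le).trans_lt hMε⟩

/-! ### The push-block generator -/

theorem SiteKind.mem_sites_of_le {I : SiteKind} {a b : ℤ} (ha : a ∈ I.sites) (hab : a ≤ b) :
    b ∈ I.sites := by
  cases I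
  · exact le_trans ha hab
  · exact mem_univ b

/-- Configurations of `n + 1` particles on the first and `n` particles on the second level. -/
abbrev Config (n : ℕ) : Type := (Fin (n + 1) → ℤ) × (Fin n → ℤ)

section moves

variable {n : ℕ}

/-- The configuration after the jump `x_i → x_i + d`. -/
def moveX (z : Config n) (i : Fin (n + 1)) (d : ℤ) : Config n :=
  (Function.update z.1 i (z.1 i + d), z.2)

/-- The configuration after the jump `y_j → y_j + 1`, with `x_{j+1}` pushed if necessary. -/
def upY (z : Config n) (j : Fin n) : Config n :=
  (if z.1 j.succ = z.2 j + 1 then Function.update z.1 j.succ (z.1 j.succ + 1) else z.1,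
    Function.update z.2 j (z.2 j + 1))

/-- The configuration after the jump `y_j → y_j - 1`, with `x_j` pushed if necessary. -/
def downY (z : Config n) (j : Fin n) : Config n :=
  (if z.1 j.castSucc = z.2 j then Function.update z.1 j.castSucc (z.1 j.castSucc - 1) else z.1,
    Function.update z.2 j (z.2 j - 1))

variable {I : SiteKind} {z : Config n}

theorem interlacing_strictMono_fst (hz : z ∈ interlacing I n) : StrictMono z.1 :=
  Fin.strictMono_iff_lt_succ.mpr fun i => (hz.2.2 i).1.trans_lt (hz.2.2 i).2

theorem interlacing_le (hz : z ∈ interlacing I n) {i : Fin (n + 1)} {j : Fin n}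
    (h : i ≤ j.castSucc) : z.1 i ≤ z.2 j :=
  ((interlacing_strictMono_fst hz).monotone h).trans (hz.2.2 j).1

theorem interlacing_lt (hz : z ∈ interlacing I n) {i : Fin (n + 1)} {j : Fin n}
    (h : j.castSucc < i) : z.2 j < z.1 i :=
  (hz.2.2 j).2.trans_le ((interlacing_strictMono_fst hz).monotone
    (Fin.castSucc_lt_iff_succ_le.mp h))

theorem interlacing_strictMono_snd (hz : z ∈ interlacing I n) : StrictMono z.2 := fun _ k hjk =>
  (interlacing_lt hz (Fin.castSucc_lt_castSucc_iff.mpr hjk)).trans_le (hz.2.2 k).1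

/-- Raising `y_j` fails only by a collision with `y_{j+1}`: the particle `x_{j+1}` is pushed. -/
theorem upY_mem_iff (hz : z ∈ interlacing I n) (j : Fin n) :
    upY z j ∈ interlacing I n ↔ ∀ k : Fin n, (k : ℕ) = j + 1 → z.2 j + 1 ≠ z.2 k := by
  constructor
  · rintro ⟨-, -, h⟩ k hk heq
    have hcs : k.castSucc = j.succ := Fin.ext (by simpa using hk)
    have h1 := hz.2.2 j
    have h2 := hz.2.2 k
    rw [hcs] at h2
    have hx : z.1 j.succ = z.2 j + 1 := by omega
    have h3 := (h k).1
    have hkj : k ≠ j := fun h => by rw [h] at hk; omega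
    simp only [upY, if_pos hx, hcs, Function.update_self, Function.update_of_ne hkj] at h3
    omega
  · intro h
    have hj := hz.2.2 j
    refine ⟨fun i => ?_, fun i => ?_, fun i => ?_⟩
    · refine SiteKind.mem_sites_of_le (hz.1 i) ?_
      simp only [upY]
      split_ifs
      · rw [Function.update_apply]; split_ifs with h
        · rw [h]; omega
        · exact le_rfl
      · exact le_rfl
    · refine SiteKind.mem_sites_of_le (hz.2.1 i) ?_
      simp only [upY]
      rw [Function.update_apply]; split_ifs with h
      · rw [h]; omega
      · exact le_rfl
    · have hi := hz.2.2 i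
      by_cases hij : i = j
      · subst hij
        have hne : i.castSucc ≠ i.succ := (Fin.castSucc_lt_succ).ne
        simp only [upY, Function.update_self]
        split_ifs with hx
        · simp only [Function.update_of_ne hne, Function.update_self]
          omega
        · omega
      · have hss : i.succ ≠ j.succ := fun h => hij (Fin.succ_injective _ h)
        simp only [upY, Function.update_of_ne hij]
        split_ifs with hx
        · rw [Function.update_of_ne hss]
          refine ⟨?_, hi.2⟩
          by_cases hc : i.castSucc = j.succ
          · rw [hc, Function.update_self]
            have hk : (i : ℕ) = j + 1 := by simpa using congrArg Fin.val hc
            have h1 := h i hk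
            have h2 := hi.1
            rw [hc] at h2
            omega
          · rw [Function.update_of_ne hc]; exact hi.1
        · exact hi

/-- Lowering `y_j` fails only by a collision with `y_{j-1}` or, for the lowest particle, by leaving
the lattice. -/
theorem downY_mem_iff (hz : z ∈ interlacing I n) (j : Fin n) :
    downY z j ∈ interlacing I n ↔ (∀ k : Fin n, (j : ℕ) = k + 1 → z.2 k + 1 ≠ z.2 j) ∧
      ¬ ((j : ℕ) = 0 ∧ z.2 j - 1 ∉ I.sites) := by
  constructor
  · rintro ⟨-, hs, h⟩
    constructor
    · intro k hk heq
      have hcs : k.succ = j.castSucc := Fin.ext (by simpa using hk.symm)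
      have h1 := hz.2.2 j
      have h2 := hz.2.2 k
      rw [hcs] at h2
      have hx : z.1 j.castSucc = z.2 j := by omega
      have h3 := (h k).2
      have hkj : k ≠ j := fun h => by rw [h] at hk; omega
      simp only [downY, if_pos hx, hcs, Function.update_self, Function.update_of_ne hkj] at h3
      omega
    · rintro ⟨-, h0⟩
      apply h0
      simpa [downY] using hs j
  · rintro ⟨h, h0⟩
    have hj := hz.2.2 j
    have hsite : z.2 j - 1 ∈ I.sites := by
      by_cases hj0 : (j : ℕ) = 0
      · by_contra hcon; exact h0 ⟨hj0, hcon⟩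
      · have hlt : (⟨j - 1, by omega⟩ : Fin n) < j := by
          rw [Fin.lt_def]; simp only; omega
        refine SiteKind.mem_sites_of_le (hz.2.1 ⟨j - 1, by omega⟩) ?_
        have := interlacing_strictMono_snd hz hlt
        omega
    refine ⟨fun i => ?_, fun i => ?_, fun i => ?_⟩
    · simp only [downY]
      split_ifs with hx
      · rw [Function.update_apply]
        split_ifs
        · rw [hx]; exact hsite
        · exact hz.1 i
      · exact hz.1 i
    · simp only [downY]
      rw [Function.update_apply]
      split_ifs
      · exact hsite
      · exact hz.2.1 i
    · have hi := hz.2.2 i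
      by_cases hij : i = j
      · subst hij
        have hne : i.succ ≠ i.castSucc := (Fin.castSucc_lt_succ).ne'
        simp only [downY, Function.update_self]
        split_ifs with hx
        · simp only [Function.update_of_ne hne, Function.update_self]
          omega
        · omega
      · have hss : i.castSucc ≠ j.castSucc := fun h => hij (Fin.castSucc_injective _ h)
        simp only [downY, Function.update_of_ne hij]
        split_ifs with hx
        · rw [Function.update_of_ne hss]
          refine ⟨hi.1, ?_⟩
          by_cases hc : i.succ = j.castSucc
          · rw [hc, Function.update_self]
            have hk : (j : ℕ) = i + 1 := by simpa using (congrArg Fin.val hc).symm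
            have h1 := h i hk
            have h2 := hi.2
            rw [hc] at h2
            omega
          · rw [Function.update_of_ne hc]; exact hi.2
        · exact hi

end moves

open scoped Classical in
/-- Extension by zero of a function on interlacing configurations. -/
noncomputable def extendZero {I : SiteKind} {n : ℕ} (f : interlacing I n → ℝ) (p : Config n) : ℝ :=
  if h : p ∈ interlacing I n then f ⟨p, h⟩ else 0

section extendZero

variable {I : SiteKind} {n : ℕ} (f : interlacing I n → ℝ)

theorem extendZero_of_mem {p : Config n} (h : p ∈ interlacing I n) : extendZero f p = f ⟨p, h⟩ :=
  dif_pos h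

theorem extendZero_of_notMem {p : Config n} (h : p ∉ interlacing I n) : extendZero f p = 0 :=
  dif_neg h

theorem hasSum_ite_val_eq_mul (p : Config n) (c : ℝ) :
    HasSum (fun w : interlacing I n => (if w.1 = p then c else 0) * f w) (c * extendZero f p) := by
  classical
  by_cases h : p ∈ interlacing I n
  · rw [extendZero_of_mem f h]
    convert hasSum_ite_eq_mul (⟨p, h⟩ : interlacing I n) c f using 4 with w
    exact ⟨fun e => Subtype.ext e, fun e => congrArg Subtype.val e⟩
  · rw [extendZero_of_notMem f h, mul_zero]
    convert hasSum_zero (α := ℝ) (β := interlacing I n) using 2 with w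
    rw [if_neg, zero_mul]
    intro hw
    exact h (hw ▸ w.2)

end extendZero

section rates

variable {I : SiteKind} {n : ℕ} {lam mu : ℤ → ℝ}

/-- The total rate at which the push-block dynamics leaves `z`. -/
noncomputable def exitRate (lam mu : ℤ → ℝ) (z : interlacing I n) : ℝ :=
  (∑ i ∈ admissible z 1, lam (z.1.1 i)) + (∑ i ∈ admissible z (-1), mu (z.1.1 i))
      + ∑ i, (dualBirth mu (z.1.2 i) + dualDeath lam (z.1.2 i))

theorem update_add_ne {ι : Type*} [DecidableEq ι] (x : ι → ℤ) (i : ι) {d : ℤ} (hd : d ≠ 0) :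
    Function.update x i (x i + d) ≠ x := by
  intro h
  have := congrFun h i
  rw [Function.update_self] at this
  omega

theorem moveX_ne (z : Config n) (i : Fin (n + 1)) {d : ℤ} (hd : d ≠ 0) : moveX z i d ≠ z := fun h =>
  update_add_ne z.1 i hd (congrArg Prod.fst h)

theorem upY_ne (z : Config n) (j : Fin n) : upY z j ≠ z := fun h =>
  update_add_ne z.2 j one_ne_zero (congrArg Prod.snd h)

theorem downY_ne (z : Config n) (j : Fin n) : downY z j ≠ z := fun h =>
  update_add_ne z.2 j (neg_ne_zero.mpr one_ne_zero) (congrArg Prod.snd h)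

open scoped Classical in
/-- The rates of the push-block dynamics, with the free and the pushing jumps of a second-level
particle merged into the single move `upY` or `downY`. -/
theorem pushBlockRate_eq (z w : interlacing I n) :
    pushBlockRate I n lam mu z w = (if w.1 = z.1 then -exitRate lam mu z else 0) +
      (∑ i, if w.1 = moveX z.1 i 1 then lam (z.1.1 i) else 0) +
      (∑ i, if w.1 = moveX z.1 i (-1) then mu (z.1.1 i) else 0) +
      (∑ j, if w.1 = upY z.1 j then dualBirth mu (z.1.2 j) else 0) +
      (∑ j, if w.1 = downY z.1 j then dualDeath lam (z.1.2 j) else 0) := by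
  by_cases h : w = z
  · subst h
    rw [pushBlockRate]
    simp only [if_true, (moveX_ne w.1 _ one_ne_zero).symm,
      (moveX_ne w.1 _ (neg_ne_zero.mpr one_ne_zero)).symm, (upY_ne w.1 _).symm,
      (downY_ne w.1 _).symm, if_false, Finset.sum_const_zero, add_zero]
    rw [exitRate]
    ring
  · have hw : ¬ w.1 = z.1 := fun h' => h (Subtype.ext h')
    simp only [pushBlockRate, if_neg h, if_neg hw, zero_add]
    have e1 : ∀ j : Fin n, (if w.1 = upY z.1 j then dualBirth mu (z.1.2 j) else 0) =
        (if w.1 = (z.1.1, Function.update z.1.2 j (z.1.2 j + 1)) then dualBirth mu (z.1.2 j)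
          else 0) +
        (if z.1.1 j.succ = z.1.2 j + 1 ∧
          w.1 = (Function.update z.1.1 j.succ (z.1.1 j.succ + 1),
            Function.update z.1.2 j (z.1.2 j + 1)) then dualBirth mu (z.1.2 j) else 0) := by
      intro j
      by_cases hx : z.1.1 j.succ = z.1.2 j + 1
      · have hne : w.1 ≠ (z.1.1, Function.update z.1.2 j (z.1.2 j + 1)) := by
          intro h'
          have h1 := (w.2.2.2 j).2
          rw [h'] at h1
          simp only [Function.update_self] at h1
          omega
        simp only [upY, hx, if_true, true_and, if_neg hne, zero_add]
      · simp [upY, hx]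
    have e2 : ∀ j : Fin n, (if w.1 = downY z.1 j then dualDeath lam (z.1.2 j) else 0) =
        (if w.1 = (z.1.1, Function.update z.1.2 j (z.1.2 j - 1)) then dualDeath lam (z.1.2 j)
          else 0) +
        (if z.1.1 j.castSucc = z.1.2 j ∧
          w.1 = (Function.update z.1.1 j.castSucc (z.1.1 j.castSucc - 1),
            Function.update z.1.2 j (z.1.2 j - 1)) then dualDeath lam (z.1.2 j) else 0) := by
      intro j
      by_cases hx : z.1.1 j.castSucc = z.1.2 j
      · have hne : w.1 ≠ (z.1.1, Function.update z.1.2 j (z.1.2 j - 1)) := by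
          intro h'
          have h1 := (w.2.2.2 j).1
          rw [h'] at h1
          simp only [Function.update_self] at h1
          omega
        simp only [downY, hx, if_true, true_and, if_neg hne, zero_add]
      · simp [downY, hx]
    simp only [e1, e2, Finset.sum_add_distrib, moveX, sub_eq_add_neg]
    ring_nf

theorem hasSum_pushBlockRate_mul (f : interlacing I n → ℝ) (z : interlacing I n) :
    HasSum (fun w => pushBlockRate I n lam mu z w * f w)
      (-exitRate lam mu z * f z + (∑ i, lam (z.1.1 i) * extendZero f (moveX z.1 i 1)) +
        (∑ i, mu (z.1.1 i) * extendZero f (moveX z.1 i (-1))) +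
        (∑ j, dualBirth mu (z.1.2 j) * extendZero f (upY z.1 j)) +
        (∑ j, dualDeath lam (z.1.2 j) * extendZero f (downY z.1 j))) := by
  classical
  simp only [pushBlockRate_eq, add_mul, Finset.sum_mul]
  have h0 := hasSum_ite_val_eq_mul f z.1 (-exitRate lam mu z)
  rw [extendZero_of_mem f z.2] at h0
  refine (((h0.add ?_).add ?_).add ?_).add ?_ <;>
    exact hasSum_sum fun i _ => hasSum_ite_val_eq_mul f _ _

open scoped Classical in
/-- The generator of the killed push-block dynamics; killing is encoded by `extendZero`. -/
theorem genOp_pushBlockRate (f : interlacing I n → ℝ) (z : interlacing I n) :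
    genOp (pushBlockRate I n lam mu) f z =
      (∑ i, if moveX z.1 i 1 ∈ interlacing I n then
        lam (z.1.1 i) * (extendZero f (moveX z.1 i 1) - f z) else 0) +
      (∑ i, if moveX z.1 i (-1) ∈ interlacing I n then
        mu (z.1.1 i) * (extendZero f (moveX z.1 i (-1)) - f z) else 0) +
      (∑ j, dualBirth mu (z.1.2 j) * (extendZero f (upY z.1 j) - f z)) +
      (∑ j, dualDeath lam (z.1.2 j) * (extendZero f (downY z.1 j) - f z)) := by
  rw [genOp, (hasSum_pushBlockRate_mul f z).tsum_eq]
  have key : ∀ (d : ℤ) (r : ℤ → ℝ), (∑ i, if moveX z.1 i d ∈ interlacing I n then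
        r (z.1.1 i) * (extendZero f (moveX z.1 i d) - f z) else 0) =
      (∑ i, r (z.1.1 i) * extendZero f (moveX z.1 i d)) -
        (∑ i ∈ admissible z d, r (z.1.1 i)) * f z := by
    intro d r
    rw [admissible, Finset.sum_filter, Finset.sum_mul, ← Finset.sum_sub_distrib]
    refine Finset.sum_congr rfl fun i _ => ?_
    change _ = _ - (if moveX z.1 i d ∈ interlacing I n then _ else _) * _
    split_ifs with h
    · ring
    · rw [extendZero_of_notMem f h]; ring
  rw [key, key, exitRate]
  simp only [mul_sub, Finset.sum_sub_distrib, Finset.sum_add_distrib, ← Finset.sum_mul]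
  ring

theorem pushBlockRate_finite_row (z : interlacing I n) :
    (Function.support (pushBlockRate I n lam mu z)).Finite := by
  classical
  have hfin : (({z.1} ∪ (range fun i => moveX z.1 i 1) ∪ (range fun i => moveX z.1 i (-1)) ∪
    (range fun j => upY z.1 j) ∪ (range fun j => downY z.1 j) : Set (Config n))).Finite := by
    refine ((((finite_singleton _).union ?_).union ?_).union ?_).union ?_ <;> exact finite_range _
  refine (hfin.preimage (f := Subtype.val) Subtype.val_injective.injOn).subset fun w hw => ?_
  by_contra hcon
  simp only [mem_preimage, mem_union, mem_singleton_iff, mem_range, not_or, not_exists] at hcon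
  obtain ⟨⟨⟨⟨h0, h1⟩, h2⟩, h3⟩, h4⟩ := hcon
  apply hw
  rw [pushBlockRate_eq, if_neg h0]
  rw [Finset.sum_eq_zero fun i _ => if_neg fun h => h1 i h.symm,
    Finset.sum_eq_zero fun i _ => if_neg fun h => h2 i h.symm,
    Finset.sum_eq_zero fun i _ => if_neg fun h => h3 i h.symm,
    Finset.sum_eq_zero fun i _ => if_neg fun h => h4 i h.symm]
  simp

theorem pushBlockRate_offDiag (hlam : ∀ x, 0 ≤ lam x) (hmu : ∀ x, 0 ≤ mu x)
    (z w : interlacing I n) (h : z ≠ w) : 0 ≤ pushBlockRate I n lam mu z w := by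
  classical
  rw [pushBlockRate_eq, if_neg fun h' => h (Subtype.ext h'.symm)]
  have h1 : ∀ (p : Prop) [Decidable p] (c : ℝ), 0 ≤ c → 0 ≤ if p then c else 0 := by
    intro p _ c hc
    split_ifs
    exacts [hc, le_rfl]
  refine add_nonneg (add_nonneg (add_nonneg (add_nonneg le_rfl ?_) ?_) ?_) ?_ <;>
    refine Finset.sum_nonneg fun i _ => h1 _ _ ?_
  exacts [hlam _, hmu _, hmu _, hlam _]

/-- The rows of the push-block matrix miss exactly the killing rate. -/
theorem genOp_pushBlockRate_one (z : interlacing I n) :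
    genOp (pushBlockRate I n lam mu) (fun _ => 1) z = -killingRate lam mu z := by
  classical
  rw [genOp_pushBlockRate]
  have e0 : ∀ p : Config n, extendZero (I := I) (fun _ => (1 : ℝ)) p - 1 =
      if p ∈ interlacing I n then 0 else -1 := by
    intro p
    split_ifs with h
    · rw [extendZero_of_mem _ h, sub_self]
    · rw [extendZero_of_notMem _ h, zero_sub]
  have e1 : ∀ d : ℤ, ∀ r : ℤ → ℝ, (∑ i, if moveX z.1 i d ∈ interlacing I n then
      r (z.1.1 i) * (extendZero (I := I) (fun _ => (1 : ℝ)) (moveX z.1 i d) - 1) else 0) = 0 := by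
    intro d r
    refine Finset.sum_eq_zero fun i _ => ?_
    split_ifs with h
    · rw [e0, if_pos h, mul_zero]
    · rfl
  rw [e1, e1, killingRate]
  have hst := interlacing_strictMono_snd z.2
  have hUp : ∀ j : Fin n, dualBirth mu (z.1.2 j) *
      (extendZero (I := I) (fun _ => (1 : ℝ)) (upY z.1 j) - 1) =
      -∑ k : Fin n, if (k : ℕ) = j + 1 ∧ z.1.2 j + 1 = z.1.2 k then dualBirth mu (z.1.2 j)
        else 0 := by
    intro j
    rw [e0]
    by_cases h : ∃ k : Fin n, (k : ℕ) = j + 1 ∧ z.1.2 j + 1 = z.1.2 k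
    · obtain ⟨k, hk, hy⟩ := h
      rw [if_neg fun h => (upY_mem_iff z.2 j).mp h k hk hy, Finset.sum_eq_single k, if_pos ⟨hk, hy⟩]
      · ring
      · intro k' _ hk'
        rw [if_neg]
        exact fun h => hk' (Fin.ext (h.1.trans hk.symm))
      · simp
    · push Not at h
      rw [if_pos ((upY_mem_iff z.2 j).mpr h), Finset.sum_eq_zero]
      · ring
      · intro k _
        rw [if_neg]
        exact fun h' => h k h'.1 h'.2
  have hDown : ∀ j : Fin n, dualDeath lam (z.1.2 j) *
      (extendZero (I := I) (fun _ => (1 : ℝ)) (downY z.1 j) - 1) =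
      -((∑ k : Fin n, if (j : ℕ) = k + 1 ∧ z.1.2 k + 1 = z.1.2 j then
        dualDeath lam (z.1.2 k + 1) else 0) +
        if (j : ℕ) = 0 ∧ z.1.2 j - 1 ∉ I.sites then dualDeath lam (z.1.2 j) else 0) := by
    intro j
    rw [e0]
    by_cases h : ∃ k : Fin n, (j : ℕ) = k + 1 ∧ z.1.2 k + 1 = z.1.2 j
    · obtain ⟨k, hk, hy⟩ := h
      rw [if_neg fun h => ((downY_mem_iff z.2 j).mp h).1 k hk hy, Finset.sum_eq_single k,
        if_pos ⟨hk, hy⟩, if_neg, hy]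
      · ring
      · rintro ⟨h0, -⟩; omega
      · intro k' _ hk'
        rw [if_neg]
        exact fun h => hk' (Fin.ext (by omega))
      · simp
    · push Not at h
      rw [Finset.sum_eq_zero]
      · by_cases h0 : (j : ℕ) = 0 ∧ z.1.2 j - 1 ∉ I.sites
        · rw [if_pos h0, if_neg fun h' => ((downY_mem_iff z.2 j).mp h').2 h0]
          ring
        · rw [if_neg h0, if_pos ((downY_mem_iff z.2 j).mpr ⟨h, h0⟩)]
          ring
      · intro k _
        rw [if_neg]
        exact fun h' => h k h'.1 h'.2
  simp only [hUp, hDown, Finset.sum_neg_distrib, Finset.sum_add_distrib]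
  have hcomm : (∑ j : Fin n, ∑ k : Fin n, if (j : ℕ) = k + 1 ∧ z.1.2 k + 1 = z.1.2 j then
        dualDeath lam (z.1.2 k + 1) else 0) =
      ∑ i : Fin n, ∑ j : Fin n, if (j : ℕ) = i + 1 ∧ z.1.2 i + 1 = z.1.2 j then
        dualDeath lam (z.1.2 i + 1) else 0 := Finset.sum_comm
  have hsplit : (∑ i : Fin n, ∑ j : Fin n, if (j : ℕ) = i + 1 ∧ z.1.2 i + 1 = z.1.2 j then
      dualBirth mu (z.1.2 i) + dualDeath lam (z.1.2 i + 1) else 0) =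
      (∑ i : Fin n, ∑ j : Fin n, if (j : ℕ) = i + 1 ∧ z.1.2 i + 1 = z.1.2 j then
        dualBirth mu (z.1.2 i) else 0) +
      ∑ i : Fin n, ∑ j : Fin n, if (j : ℕ) = i + 1 ∧ z.1.2 i + 1 = z.1.2 j then
        dualDeath lam (z.1.2 i + 1) else 0 := by
    rw [← Finset.sum_add_distrib]
    refine Finset.sum_congr rfl fun i _ => ?_
    rw [← Finset.sum_add_distrib]
    refine Finset.sum_congr rfl fun j _ => ?_
    split_ifs <;> simp
  rw [hcomm, hsplit]
  ring

theorem killingRate_nonneg (hlam : ∀ x, 0 ≤ lam x) (hmu : ∀ x, 0 ≤ mu x) (z : interlacing I n) :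
    0 ≤ killingRate lam mu z := by
  refine add_nonneg (Finset.sum_nonneg fun i _ => Finset.sum_nonneg fun j _ => ?_)
    (Finset.sum_nonneg fun i _ => ?_)
  · split_ifs
    exacts [add_nonneg (hmu _) (hlam _), le_rfl]
  · split_ifs
    exacts [hlam _, le_rfl]

/-! ### The cemetery state -/

theorem hasSum_option {α : Type*} {f : Option α → ℝ} {s : ℝ} (h : HasSum (fun a => f (some a)) s) :
    HasSum f (f none + s) := by
  have h1 : HasSum (fun x : Option α => if x = none then f none else 0) (f none) :=
    hasSum_ite_eq none (f none)
  have h2 : HasSum (fun x : Option α => if x = none then 0 else f x) s := by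
    refine (Function.Injective.hasSum_iff (Option.some_injective α) ?_).mp ?_
    · intro x hx
      cases x with
      | none => simp
      | some a => exact absurd ⟨a, rfl⟩ hx
    · simpa [Function.comp_def] using h
  convert h1.add h2 using 2 with x
  split_ifs with hx <;> simp [hx]

theorem genOp_cemeteryRate_none (f : Option (interlacing I n) → ℝ) :
    genOp (cemeteryRate I n lam mu) f none = 0 := by
  simp [genOp, cemeteryRate]

theorem genOp_cemeteryRate_some (f : Option (interlacing I n) → ℝ) (z : interlacing I n) :
    genOp (cemeteryRate I n lam mu) f (some z) = killingRate lam mu z * f none +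
      genOp (pushBlockRate I n lam mu) (fun w => f (some w)) z :=
  (hasSum_option (f := fun w => cemeteryRate I n lam mu (some z) w * f w)
    (summable_genOp pushBlockRate_finite_row _ z).hasSum).tsum_eq

theorem cemeteryRate_finite_row (z : Option (interlacing I n)) :
    (Function.support (cemeteryRate I n lam mu z)).Finite := by
  cases z with
  | none => simp [Function.support, cemeteryRate]
  | some z =>
    refine (((pushBlockRate_finite_row (lam := lam) (mu := mu) z).image some).union
      (finite_singleton none)).subset fun w hw => ?_
    cases w with
    | none => exact Or.inr rfl
    | some w => exact Or.inl ⟨w, hw, rfl⟩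

theorem genOp_cemeteryRate_one (z : Option (interlacing I n)) :
    genOp (cemeteryRate I n lam mu) (fun _ => 1) z = 0 := by
  cases z with
  | none => exact genOp_cemeteryRate_none _
  | some z => rw [genOp_cemeteryRate_some, genOp_pushBlockRate_one]; ring

theorem cemeteryRate_offDiag (hlam : ∀ x, 0 ≤ lam x) (hmu : ∀ x, 0 ≤ mu x)
    (z w : Option (interlacing I n)) (h : z ≠ w) : 0 ≤ cemeteryRate I n lam mu z w := by
  match z, w with
  | none, _ => exact le_rfl
  | some z, none => exact killingRate_nonneg hlam hmu z
  | some z, some w => exact pushBlockRate_offDiag hlam hmu z w fun h' => h (congrArg some h')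

/-- A Lyapunov function for the push-block dynamics, extended by zero, is one for the dynamics with
cemetery. -/
theorem IsTame.cemetery (hlam : ∀ x, 0 ≤ lam x) (hmu : ∀ x, 0 ≤ mu x) {V : interlacing I n → ℝ}
    {C : ℝ} (hV : IsTame (pushBlockRate I n lam mu) V C) :
    IsTame (cemeteryRate I n lam mu) (fun o => o.elim 0 V) C where
  offDiag := cemeteryRate_offDiag hlam hmu
  finite_row := cemeteryRate_finite_row
  row_nonpos z := (genOp_cemeteryRate_one z).le
  V_nonneg z := by
    cases z with
    | none => exact le_rfl
    | some z => exact hV.V_nonneg z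
  C_nonneg := hV.C_nonneg
  drift z := by
    cases z with
    | none => rw [genOp_cemeteryRate_none]; exact hV.C_nonneg
    | some z => rw [genOp_cemeteryRate_some]; simpa using hV.drift z
  finite_sublevel M := by
    refine (((hV.finite_sublevel M).image some).union (finite_singleton none)).subset fun z hz => ?_
    cases z with
    | none => exact Or.inr rfl
    | some z => exact Or.inl ⟨z, hz, rfl⟩

end rates

/-! ### Natural boundaries -/

/-- The expected time which the chain with birth rates `lam`, reversible with respect to `p` and
reflected at `b`, needs to go from `b` up to `x`; it vanishes for `x ≤ b`. -/
noncomputable def hitTime (lam p : ℤ → ℝ) (x b : ℤ) : ℝ :=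
  ∑ k ∈ Finset.Ico b x, 1 / (lam k * p k) * ∑ i ∈ Finset.Icc b k, p i

/-- The chain with rates `lam`, `mu` is reversible with respect to `p` on `[b₀, ∞)`, and the
expected time to reach `∞` is infinite. -/
structure NaturalEnd (lam mu p : ℤ → ℝ) (b₀ : ℤ) : Prop where
  lam_pos : ∀ k, b₀ ≤ k → 0 < lam k
  p_pos : ∀ k, b₀ ≤ k → 0 < p k
  balance : ∀ k, b₀ ≤ k → lam k * p k = mu (k + 1) * p (k + 1)
  unbounded : ∃ b, b₀ ≤ b ∧ ∀ M : ℝ, ∃ x, M < hitTime lam p x b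

theorem hitTime_of_le {lam p : ℤ → ℝ} {x b : ℤ} (h : x ≤ b) : hitTime lam p x b = 0 := by
  rw [hitTime, Finset.Ico_eq_empty (by omega), Finset.sum_empty]

theorem hitTime_add_one {lam p : ℤ → ℝ} {x b : ℤ} (h : b ≤ x) :
    hitTime lam p (x + 1) b =
      hitTime lam p x b + 1 / (lam x * p x) * ∑ i ∈ Finset.Icc b x, p i := by
  have : Finset.Ico b (x + 1) = insert x (Finset.Ico b x) := by ext; simp; omega
  rw [hitTime, this, Finset.sum_insert (by simp), hitTime, add_comm]

theorem hitTime_sub {lam p : ℤ → ℝ} {x b : ℤ} :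
    hitTime lam p x b - hitTime lam p x (b + 1) =
      p b * ∑ k ∈ Finset.Ico b x, 1 / (lam k * p k) := by
  have h1 : hitTime lam p x (b + 1) =
      ∑ k ∈ Finset.Ico b x, 1 / (lam k * p k) * ∑ i ∈ Finset.Icc (b + 1) k, p i := by
    rw [hitTime]
    refine Finset.sum_subset (fun k hk => ?_) fun k hk hk' => ?_
    · rw [Finset.mem_Ico] at *; omega
    · rw [Finset.mem_Ico] at *
      rw [Finset.Icc_eq_empty (by omega), Finset.sum_empty, mul_zero]
  rw [h1, hitTime, ← Finset.sum_sub_distrib, Finset.mul_sum]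
  refine Finset.sum_congr rfl fun k hk => ?_
  rw [Finset.mem_Ico] at hk
  have : Finset.Icc b k = insert b (Finset.Icc (b + 1) k) := by ext; simp; omega
  rw [this, Finset.sum_insert (by simp)]
  ring

namespace NaturalEnd

variable {lam mu p : ℤ → ℝ} {b₀ : ℤ}

theorem hitTime_nonneg (h : NaturalEnd lam mu p b₀) {b : ℤ} (hb : b₀ ≤ b) (x : ℤ) :
    0 ≤ hitTime lam p x b := by
  refine Finset.sum_nonneg fun k hk => ?_
  rw [Finset.mem_Ico] at hk
  refine mul_nonneg ?_ (Finset.sum_nonneg fun i hi => ?_)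
  · have := mul_pos (h.lam_pos k (by omega)) (h.p_pos k (by omega))
    positivity
  · rw [Finset.mem_Icc] at hi
    exact (h.p_pos i (by omega)).le

theorem hitTime_mono (h : NaturalEnd lam mu p b₀) {b : ℤ} (hb : b₀ ≤ b) :
    Monotone fun x => hitTime lam p x b := by
  intro x x' hxx'
  refine Finset.sum_le_sum_of_subset_of_nonneg (Finset.Ico_subset_Ico_right hxx') fun k hk _ => ?_
  rw [Finset.mem_Ico] at hk
  refine mul_nonneg ?_ (Finset.sum_nonneg fun i hi => ?_)
  · have := mul_pos (h.lam_pos k (by omega)) (h.p_pos k (by omega))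
    positivity
  · rw [Finset.mem_Icc] at hi
    exact (h.p_pos i (by omega)).le

/-- The expected hitting time increases at unit speed under the generator. -/
theorem drift_fst (h : NaturalEnd lam mu p b₀) {b : ℤ} (hb : b₀ ≤ b) (x : ℤ) :
    lam x * (hitTime lam p (x + 1) b - hitTime lam p x b) +
      mu x * (hitTime lam p (x - 1) b - hitTime lam p x b) = if b ≤ x then 1 else 0 := by
  split_ifs with hx
  swap
  · rw [hitTime_of_le (by omega), hitTime_of_le (by omega), hitTime_of_le (by omega)]
    ring
  have hlx := (h.lam_pos x (by omega)).ne'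
  have hpx := (h.p_pos x (by omega)).ne'
  rw [hitTime_add_one hx]
  rcases hx.eq_or_lt with rfl | hx'
  · rw [hitTime_of_le (x := b - 1) (by omega), hitTime_of_le le_rfl, Finset.Icc_self,
      Finset.sum_singleton]
    field_simp
    ring
  · have h1 := hitTime_add_one (lam := lam) (p := p) (x := x - 1) (b := b) (by omega)
    rw [sub_add_cancel] at h1
    have h2 := h.balance (x - 1) (by omega)
    rw [sub_add_cancel] at h2
    have h3 : Finset.Icc b x = insert x (Finset.Icc b (x - 1)) := by ext; simp; omega
    have hmx : mu x ≠ 0 := by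
      have := mul_pos (h.lam_pos (x - 1) (by omega)) (h.p_pos (x - 1) (by omega))
      rw [h2] at this
      exact left_ne_zero_of_mul this.ne'
    rw [h1, h2, h3, Finset.sum_insert (by simp)]
    field_simp
    ring

/-- Moving the reflecting barrier `b` by the dual chain, the hitting time also increases at unit
speed. -/
theorem drift_snd (h : NaturalEnd lam mu p b₀) {b x : ℤ} (hb : b₀ ≤ b - 1) (hx : b ≤ x) :
    mu b * (hitTime lam p x (b + 1) - hitTime lam p x b) +
      lam (b - 1) * (hitTime lam p x (b - 1) - hitTime lam p x b) = 1 := by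
  have h1 := hitTime_sub (lam := lam) (p := p) (x := x) (b := b)
  have h2 := hitTime_sub (lam := lam) (p := p) (x := x) (b := b - 1)
  rw [sub_add_cancel] at h2
  have h3 : Finset.Ico (b - 1) x = insert (b - 1) (Finset.Ico b x) := by ext; simp; omega
  rw [h3, Finset.sum_insert (by simp)] at h2
  have h4 := h.balance (b - 1) hb
  rw [sub_add_cancel] at h4
  have hl := (h.lam_pos (b - 1) (by omega)).ne'
  have hp := (h.p_pos (b - 1) (by omega)).ne'
  rw [h2, ← neg_sub, h1]
  have : lam (b - 1) * (p (b - 1) * (1 / (lam (b - 1) * p (b - 1)) +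
      ∑ k ∈ Finset.Ico b x, 1 / (lam k * p k))) =
      1 + (lam (b - 1) * p (b - 1)) * ∑ k ∈ Finset.Ico b x, 1 / (lam k * p k) := by
    field_simp
  rw [this, h4]
  ring

/-- The divergence of the hitting times does not depend on the position of the barrier. -/
theorem unbounded' (h : NaturalEnd lam mu p b₀) {b : ℤ} (hb : b₀ ≤ b) (M : ℝ) :
    ∃ x, M < hitTime lam p x b := by
  obtain ⟨c, hc, hunb⟩ := h.unbounded
  have hanti : ∀ b, b₀ ≤ b → ∀ x, hitTime lam p x (b + 1) ≤ hitTime lam p x b := by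
    intro b hb x
    rw [← sub_nonneg, hitTime_sub]
    refine mul_nonneg (h.p_pos b hb).le (Finset.sum_nonneg fun k hk => ?_)
    rw [Finset.mem_Ico] at hk
    have := mul_pos (h.lam_pos k (by omega)) (h.p_pos k (by omega))
    positivity
  -- raising the barrier by one costs at most a constant factor and a constant
  have hstep : ∀ b, b₀ ≤ b → ∀ x, hitTime lam p x b ≤
      (1 + p b / p (b + 1)) * hitTime lam p x (b + 1) + 1 / (lam b) := by
    intro b hb x
    have hpb := h.p_pos b hb
    have hpb' := h.p_pos (b + 1) (by omega)
    have hlb := h.lam_pos b hb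
    by_cases hx : x ≤ b
    · rw [hitTime_of_le hx, hitTime_of_le (by omega)]
      rw [mul_zero, zero_add]; positivity
    · have h1 := hitTime_sub (lam := lam) (p := p) (x := x) (b := b)
      have h3 : Finset.Ico b x = insert b (Finset.Ico (b + 1) x) := by ext; simp; omega
      rw [h3, Finset.sum_insert (by simp)] at h1
      have h4 : p (b + 1) * ∑ k ∈ Finset.Ico (b + 1) x, 1 / (lam k * p k) ≤
          hitTime lam p x (b + 1) := by
        rw [hitTime, Finset.mul_sum]
        refine Finset.sum_le_sum fun k hk => ?_
        rw [Finset.mem_Ico] at hk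
        rw [mul_comm]
        have := mul_pos (h.lam_pos k (by omega)) (h.p_pos k (by omega))
        refine mul_le_mul_of_nonneg_left ?_ (by positivity)
        refine Finset.single_le_sum (f := p) (fun i hi => ?_) (by simp; omega)
        rw [Finset.mem_Icc] at hi
        exact (h.p_pos i (by omega)).le
      have h5 : p b * ∑ k ∈ Finset.Ico (b + 1) x, 1 / (lam k * p k) ≤
          p b / p (b + 1) * hitTime lam p x (b + 1) := by
        rw [div_mul_eq_mul_div, le_div_iff₀ hpb', mul_assoc]
        refine mul_le_mul_of_nonneg_left ?_ hpb.le
        rw [mul_comm]; exact h4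
      have h6 : p b * (1 / (lam b * p b)) = 1 / lam b := by field_simp
      rw [mul_add, h6] at h1
      linarith
  rcases le_total b c with hbc | hcb
  · have : ∀ x, hitTime lam p x c ≤ hitTime lam p x b := by
      intro x
      induction c, hbc using Int.leInduction with
      | base => exact le_rfl
      | succ c hc' ih =>
        exact (hanti c (by omega) x).trans (ih (by omega) fun M => by
          obtain ⟨x, hx⟩ := hunb M
          exact ⟨x, hx.trans_le (hanti c (by omega) x)⟩)
    obtain ⟨x, hx⟩ := hunb M
    exact ⟨x, hx.trans_le (this x)⟩
  · clear hb
    induction b, hcb using Int.leInduction generalizing M with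
    | base => exact hunb M
    | succ b hb ih =>
      have hpb := h.p_pos b (by omega)
      have hpb' := h.p_pos (b + 1) (by omega)
      obtain ⟨x, hx⟩ := ih ((1 + p b / p (b + 1)) * M + 1 / lam b)
      have h1 := hstep b (by omega) x
      refine ⟨x, lt_of_mul_lt_mul_left (a := 1 + p b / p (b + 1)) ?_ (by positivity)⟩
      linarith

theorem exists_bound (h : NaturalEnd lam mu p b₀) {b : ℤ} (hb : b₀ ≤ b) (M : ℝ) :
    ∃ R : ℤ, ∀ x, hitTime lam p x b ≤ M → x ≤ R := by
  obtain ⟨R, hR⟩ := h.unbounded' hb M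
  refine ⟨R, fun x hx => ?_⟩
  by_contra! hcon
  have := h.hitTime_mono hb hcon.le
  simp only at this
  linarith

end NaturalEnd

/-! ### Divergent series and the symmetrizing measure -/

theorem exists_lt_sum_of_tsum_eq_top {g : ℤ → ℝ} {b : ℤ} (hg : ∀ k, b ≤ k → 0 ≤ g k)
    (h : ∑' j : Set.Ici b, ENNReal.ofReal (g j) = ⊤) (M : ℝ) :
    ∃ x, M < ∑ k ∈ Finset.Ico b x, g k := by
  by_contra! hcon
  have : ∑' j : Set.Ici b, ENNReal.ofReal (g j) ≤ ENNReal.ofReal M := by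
    rw [ENNReal.tsum_eq_iSup_sum]
    refine iSup_le fun F => ?_
    obtain ⟨x, hx⟩ : ∃ x : ℤ, ∀ j ∈ F, (j : ℤ) < x := by
      obtain ⟨y, hy⟩ := (F.image Subtype.val).bddAbove
      exact ⟨y + 1, fun j hj => Int.lt_add_one_of_le
        (hy (Finset.mem_coe.mpr (Finset.mem_image_of_mem _ hj)))⟩
    rw [← ENNReal.ofReal_sum_of_nonneg fun (j : Set.Ici b) _ => hg j j.2]
    refine ENNReal.ofReal_le_ofReal (le_trans ?_ (hcon x))
    rw [← Finset.sum_image (f := g) (g := Subtype.val) fun a _ c _ h => Subtype.ext h]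
    refine Finset.sum_le_sum_of_subset_of_nonneg (fun k hk => ?_) fun k hk _ => ?_
    · obtain ⟨j, hj, rfl⟩ := Finset.mem_image.mp hk
      exact Finset.mem_Ico.mpr ⟨j.2, hx j hj⟩
    · exact hg k (Finset.mem_Ico.mp hk).1
  rw [h] at this
  exact ENNReal.ofReal_ne_top (top_le_iff.mp this)

section symmMeasure

variable {lam mu : ℤ → ℝ}

theorem symmMeasure_of_nonpos {x : ℤ} (hx : x ≤ 0) :
    symmMeasure lam mu x = ∏ k ∈ Finset.Icc (x + 1) 0, mu k / lam (k - 1) := by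
  rcases hx.eq_or_lt with rfl | hx
  · simp [symmMeasure]
  · rw [symmMeasure, if_neg (by omega)]
    refine Finset.prod_bij (fun i _ => x + i) ?_ ?_ ?_ ?_
    · intro i hi
      rw [Finset.mem_Icc] at *
      omega
    · intro i _ j _ h
      omega
    · intro k hk
      refine ⟨k - x, ?_, by omega⟩
      rw [Finset.mem_Icc] at *
      omega
    · intro i _
      rfl

/-- Detailed balance. -/
theorem symmMeasure_balance {x : ℤ} (hl : lam x ≠ 0) (hm : mu (x + 1) ≠ 0) :
    lam x * symmMeasure lam mu x = mu (x + 1) * symmMeasure lam mu (x + 1) := by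
  rcases le_or_gt 0 x with hx | hx
  · have : Finset.Icc 1 (x + 1) = insert (x + 1) (Finset.Icc 1 x) := by ext; simp; omega
    rw [symmMeasure, symmMeasure, if_pos hx, if_pos (by omega), this,
      Finset.prod_insert (by simp), add_sub_cancel_right]
    field_simp
  · have : Finset.Icc (x + 1) 0 = insert (x + 1) (Finset.Icc (x + 1 + 1) 0) := by
      ext; simp; omega
    rw [symmMeasure_of_nonpos hx.le, symmMeasure_of_nonpos (x := x + 1) (by omega), this,
      Finset.prod_insert (by simp), add_sub_cancel_right]
    field_simp

theorem symmMeasure_pos_of_nonneg (hl : ∀ x, 0 ≤ x → 0 < lam x) (hm : ∀ x, 1 ≤ x → 0 < mu x) {x : ℤ}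
    (hx : 0 ≤ x) : 0 < symmMeasure lam mu x := by
  rw [symmMeasure, if_pos hx]
  refine Finset.prod_pos fun i hi => ?_
  rw [Finset.mem_Icc] at hi
  exact div_pos (hl _ (by omega)) (hm _ (by omega))

theorem symmMeasure_pos (hl : ∀ x, 0 < lam x) (hm : ∀ x, 0 < mu x) (x : ℤ) :
    0 < symmMeasure lam mu x := by
  unfold symmMeasure
  split_ifs <;> exact Finset.prod_pos fun i _ => div_pos (by first | exact hl _ | exact hm _)
    (by first | exact hl _ | exact hm _)

end symmMeasure

theorem ofReal_mul_sum {c : ℝ} {g : ℤ → ℝ} {s : Finset ℤ} (hc : 0 ≤ c) (hg : ∀ i ∈ s, 0 ≤ g i) :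
    ENNReal.ofReal c * ∑ i ∈ s, ENNReal.ofReal (g i) = ENNReal.ofReal (c * ∑ i ∈ s, g i) := by
  rw [ENNReal.ofReal_mul hc, ENNReal.ofReal_sum_of_nonneg hg]

/-! ### The divergence conditions -/

theorem sum_le_sum_shift {g : ℤ → ℝ} {b : ℤ} (hg : ∀ k, b ≤ k → 0 ≤ g k) (hb : g b = 0) (x : ℤ) :
    ∑ k ∈ Finset.Ico b x, g k ≤ ∑ k ∈ Finset.Ico b x, g (k + 1) := by
  rw [Finset.sum_Ico_add']
  have : ∑ k ∈ Finset.Ico b x, g k = ∑ k ∈ Finset.Ico (b + 1) x, g k := by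
    refine (Finset.sum_subset (fun k hk => ?_) fun k hk hk' => ?_).symm
    · rw [Finset.mem_Ico] at *; omega
    · rw [Finset.mem_Ico] at *
      rw [show k = b by omega, hb]
  rw [this]
  refine Finset.sum_le_sum_of_subset_of_nonneg (fun k hk => ?_) fun k hk _ => ?_
  · rw [Finset.mem_Ico] at *; omega
  · rw [Finset.mem_Ico] at hk
    exact hg k (by omega)

theorem sum_Icc_neg (f : ℤ → ℝ) (k : ℤ) :
    ∑ i ∈ Finset.Icc 1 k, f (-i) = ∑ i ∈ Finset.Icc (-k) (-1), f i := by
  refine Finset.sum_nbij' (fun i => -i) (fun i => -i) ?_ ?_ ?_ ?_ ?_ <;>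
    intro i hi <;> simp only [Finset.mem_Icc, neg_neg] at * <;> omega

theorem tsum_Iic_eq_tsum_Ici (F : ℤ → ENNReal) :
    ∑' j : Set.Iic (-1 : ℤ), F j = ∑' k : Set.Ici (1 : ℤ), F (-k) :=
  (((Equiv.neg ℤ).subtypeEquiv (p := fun a => a ∈ Set.Ici (1 : ℤ))
    (q := fun a => a ∈ Set.Iic (-1 : ℤ)) fun a => by
      simp only [mem_Ici, mem_Iic, Equiv.neg_apply]; omega).tsum_eq
      (fun j : Set.Iic (-1 : ℤ) => F j)).symm

/-- The dual of a chain reversible with respect to `p` is reversible with respect to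
`1 / (lam * p)`. -/
theorem naturalEnd_dual {lam mu p : ℤ → ℝ} {b₀ : ℤ} (hl : ∀ k, b₀ ≤ k → 0 < lam k)
    (hm : ∀ k, b₀ ≤ k → 0 < mu (k + 1)) (hp : ∀ k, b₀ ≤ k → 0 < p k)
    (hbal : ∀ k, b₀ ≤ k → lam k * p k = mu (k + 1) * p (k + 1))
    (hunb : ∃ b, b₀ ≤ b ∧ ∀ M : ℝ, ∃ x, M < ∑ k ∈ Finset.Ico b x,
      p (k + 1) * ∑ i ∈ Finset.Icc b k, 1 / (lam i * p i)) :
    NaturalEnd (dualBirth mu) (dualDeath lam) (fun i => 1 / (lam i * p i)) b₀ := by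
  refine ⟨hm, fun k hk => ?_, fun k hk => ?_, ?_⟩
  · have := mul_pos (hl k hk) (hp k hk)
    positivity
  · have h1 := (hl (k + 1) (by omega)).ne'
    have h2 := (hp (k + 1) (by omega)).ne'
    have h3 := (hm k hk).ne'
    rw [hbal k hk, dualBirth, dualDeath]
    field_simp
  · obtain ⟨b, hb, h⟩ := hunb
    refine ⟨b, hb, fun M => ?_⟩
    obtain ⟨x, hx⟩ := h M
    refine ⟨x, hx.trans_le (le_of_eq (Finset.sum_congr rfl fun k hk => ?_))⟩
    rw [Finset.mem_Ico] at hk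
    have h3 := (hm k (by omega)).ne'
    have h2 := (hp (k + 1) (by omega)).ne'
    congr 1
    change p (k + 1) = 1 / (mu (k + 1) * (1 / (lam k * p k)))
    rw [hbal k (by omega)]
    field_simp

theorem naturalEnd_right_line {lam mu : ℤ → ℝ} (h : NaturalRates .line lam mu) (b₀ : ℤ) :
    NaturalEnd lam mu (symmMeasure lam mu) b₀ := by
  obtain ⟨hl, hm, h1, -, -, -⟩ := h
  have hp := symmMeasure_pos hl hm
  refine ⟨fun k _ => hl k, fun k _ => hp k,
    fun k _ => symmMeasure_balance (hl k).ne' (hm _).ne', ?_⟩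
  refine ⟨max b₀ 1, le_max_left _ _, ?_⟩
  have h1' : ∀ M : ℝ, ∃ x, M < hitTime lam (symmMeasure lam mu) x 1 := by
    intro M
    refine exists_lt_sum_of_tsum_eq_top (g := fun k => 1 / (lam k * symmMeasure lam mu k) *
      ∑ i ∈ Finset.Icc 1 k, symmMeasure lam mu i) ?_ ?_ M
    · intro k _
      have := mul_pos (hl k) (hp k)
      exact mul_nonneg (by positivity) (Finset.sum_nonneg fun i _ => (hp i).le)
    · rw [← h1]
      refine tsum_congr fun j => (ofReal_mul_sum ?_ fun i _ => (hp i).le).symm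
      have := mul_pos (hl j) (hp j)
      positivity
  have hN : NaturalEnd lam mu (symmMeasure lam mu) 1 := ⟨fun k _ => hl k, fun k _ => hp k,
    fun k _ => symmMeasure_balance (hl k).ne' (hm _).ne', 1, le_rfl, h1'⟩
  exact fun M => hN.unbounded' (le_max_right _ _) M

theorem naturalEnd_right_line_dual {lam mu : ℤ → ℝ} (h : NaturalRates .line lam mu) :
    NaturalEnd (dualBirth mu) (dualDeath lam) (fun i => 1 / (lam i * symmMeasure lam mu i)) 1 := by
  obtain ⟨hl, hm, -, h1, -, -⟩ := h
  have hp := symmMeasure_pos hl hm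
  have hc : ∀ i, 0 ≤ 1 / (lam i * symmMeasure lam mu i) := fun i => by
    have := mul_pos (hl i) (hp i)
    positivity
  refine naturalEnd_dual (fun k _ => hl k) (fun k _ => hm _) (fun k _ => hp k)
    (fun k _ => symmMeasure_balance (hl k).ne' (hm _).ne') ⟨1, le_rfl, fun M => ?_⟩
  have hg : ∀ k, 1 ≤ k → 0 ≤ symmMeasure lam mu k *
      ∑ i ∈ Finset.Icc 1 (k - 1), 1 / (lam i * symmMeasure lam mu i) := fun k _ =>
    mul_nonneg (hp k).le (Finset.sum_nonneg fun i _ => hc i)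
  obtain ⟨x, hx⟩ := exists_lt_sum_of_tsum_eq_top (g := fun k => symmMeasure lam mu k *
      ∑ i ∈ Finset.Icc 1 (k - 1), 1 / (lam i * symmMeasure lam mu i)) hg (by
    rw [← h1]
    exact tsum_congr fun j => (ofReal_mul_sum (hp _).le fun i _ => hc i).symm) M
  refine ⟨x, hx.trans_le ((sum_le_sum_shift hg (by simp) x).trans_eq ?_)⟩
  simp only [add_sub_cancel_right]

theorem naturalEnd_left_line {lam mu : ℤ → ℝ} (h : NaturalRates .line lam mu) (b₀ : ℤ) :
    NaturalEnd (fun x => mu (-x)) (fun x => lam (-x)) (fun x => symmMeasure lam mu (-x)) b₀ := by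
  obtain ⟨hl, hm, -, -, h1, -⟩ := h
  have hp := symmMeasure_pos hl hm
  have hbal : ∀ k : ℤ, mu (-k) * symmMeasure lam mu (-k) =
      lam (-(k + 1)) * symmMeasure lam mu (-(k + 1)) := by
    intro k
    have := symmMeasure_balance (lam := lam) (mu := mu) (x := -(k + 1)) (hl _).ne' (hm _).ne'
    rw [this]
    congr 2 <;> ring
  have h1' : ∀ M : ℝ, ∃ x,
      M < hitTime (fun x => mu (-x)) (fun x => symmMeasure lam mu (-x)) x 1 := by
    intro M
    have hg : ∀ k, 1 ≤ k → 0 ≤ 1 / (lam (-k) * symmMeasure lam mu (-k)) *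
        ∑ i ∈ Finset.Icc (-k + 1) (-1), symmMeasure lam mu i := fun k _ => by
      have := mul_pos (hl (-k)) (hp (-k))
      exact mul_nonneg (by positivity) (Finset.sum_nonneg fun i _ => (hp i).le)
    obtain ⟨x, hx⟩ := exists_lt_sum_of_tsum_eq_top (g := fun k =>
        1 / (lam (-k) * symmMeasure lam mu (-k)) *
          ∑ i ∈ Finset.Icc (-k + 1) (-1), symmMeasure lam mu i) hg (by
      rw [← h1, tsum_Iic_eq_tsum_Ici fun j => ENNReal.ofReal (1 / (lam j * symmMeasure lam mu j)) *
        ∑ i ∈ Finset.Icc (j + 1) (-1), ENNReal.ofReal (symmMeasure lam mu i)]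
      refine tsum_congr fun j => (ofReal_mul_sum ?_ fun i _ => (hp i).le).symm
      have := mul_pos (hl (-j)) (hp (-j))
      positivity) M
    refine ⟨x, hx.trans_le ((sum_le_sum_shift hg (by simp) x).trans_eq ?_)⟩
    refine Finset.sum_congr rfl fun k _ => ?_
    rw [sum_Icc_neg (symmMeasure lam mu), hbal k, show -(k + 1) + 1 = -k by ring]
  have hN : NaturalEnd (fun x => mu (-x)) (fun x => lam (-x))
      (fun x => symmMeasure lam mu (-x)) 1 :=
    ⟨fun k _ => hm _, fun k _ => hp _, fun k _ => hbal k, 1, le_rfl, h1'⟩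
  exact ⟨fun k _ => hm _, fun k _ => hp _, fun k _ => hbal k, max b₀ 1, le_max_left _ _,
    fun M => hN.unbounded' (le_max_right _ _) M⟩

theorem naturalEnd_left_line_dual {lam mu : ℤ → ℝ} (h : NaturalRates .line lam mu) :
    NaturalEnd (fun x => dualDeath lam (-x)) (fun x => dualBirth mu (-x))
      (fun i => 1 / (lam (-i) * symmMeasure lam mu (-i))) 1 := by
  obtain ⟨hl, hm, -, -, -, h1⟩ := h
  have hp := symmMeasure_pos hl hm
  have hc : ∀ i, 0 < 1 / (lam i * symmMeasure lam mu i) := fun i => by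
    have := mul_pos (hl i) (hp i)
    positivity
  refine ⟨fun k _ => hl _, fun k _ => hc _, fun k _ => ?_, 1, le_rfl, fun M => ?_⟩
  · have := symmMeasure_balance (lam := lam) (mu := mu) (x := -(k + 1)) (hl _).ne' (hm _).ne'
    rw [this, dualDeath, dualBirth, show -(k + 1) + 1 = -k by ring]
    have h1 := (hl (-k)).ne'
    have h2 := (hm (-k)).ne'
    have h3 := (hp (-k)).ne'
    field_simp
  · have hg : ∀ k, 1 ≤ k → 0 ≤ symmMeasure lam mu (-k) *
        ∑ i ∈ Finset.Icc (-k) (-1), 1 / (lam i * symmMeasure lam mu i) := fun k _ =>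
      mul_nonneg (hp _).le (Finset.sum_nonneg fun i _ => (hc i).le)
    obtain ⟨x, hx⟩ := exists_lt_sum_of_tsum_eq_top (g := fun k => symmMeasure lam mu (-k) *
        ∑ i ∈ Finset.Icc (-k) (-1), 1 / (lam i * symmMeasure lam mu i)) hg (by
      rw [← h1, tsum_Iic_eq_tsum_Ici fun j => ENNReal.ofReal (symmMeasure lam mu j) *
        ∑ i ∈ Finset.Icc j (-1), ENNReal.ofReal (1 / (lam i * symmMeasure lam mu i))]
      exact tsum_congr fun j => (ofReal_mul_sum (hp _).le fun i _ => (hc i).le).symm) M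
    refine ⟨x, hx.trans_le (le_of_eq (Finset.sum_congr rfl fun k _ => ?_))⟩
    rw [sum_Icc_neg fun i => 1 / (lam i * symmMeasure lam mu i)]
    congr 1
    change _ = 1 / (lam (-k) * (1 / (lam (-k) * symmMeasure lam mu (-k))))
    have h1 := (hl (-k)).ne'
    have h3 := (hp (-k)).ne'
    field_simp

theorem naturalEnd_halfLine {lam mu : ℤ → ℝ} (h : NaturalRates .halfLine lam mu) :
    NaturalEnd lam mu (symmMeasure lam mu) 0 := by
  obtain ⟨hl, hm, -, -, h1, -⟩ := h
  have hp := fun k hk => symmMeasure_pos_of_nonneg hl hm (x := k) hk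
  refine ⟨hl, hp, fun k hk => symmMeasure_balance (hl k hk).ne' (hm _ (by omega)).ne', 0, le_rfl,
    fun M => ?_⟩
  refine exists_lt_sum_of_tsum_eq_top (g := fun k => 1 / (lam k * symmMeasure lam mu k) *
      ∑ i ∈ Finset.Icc 0 k, symmMeasure lam mu i) ?_ ?_ M
  · intro k hk
    have := mul_pos (hl k hk) (hp k hk)
    exact mul_nonneg (by positivity)
      (Finset.sum_nonneg fun i hi => (hp i (Finset.mem_Icc.mp hi).1).le)
  · rw [← h1]
    refine tsum_congr fun j =>
      (ofReal_mul_sum ?_ fun i hi => (hp i (Finset.mem_Icc.mp hi).1).le).symm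
    have := mul_pos (hl j j.2) (hp j j.2)
    positivity

theorem tsum_tail_swap (c p : ℤ → ENNReal) :
    ∑' j : Set.Ici (0 : ℤ), c j * ∑' i : Set.Ici ((j : ℤ) + 1), p i =
      ∑' i : Set.Ici (0 : ℤ), p i * ∑ j ∈ Finset.Icc 0 ((i : ℤ) - 1), c j := by
  have e1 : ∀ j : ℤ, c j * ∑' i : Set.Ici (j + 1), p i =
      ∑' i : ℤ, if j + 1 ≤ i then c j * p i else 0 := by
    intro j
    rw [tsum_subtype (Set.Ici (j + 1)) p, ← ENNReal.tsum_mul_left]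
    refine tsum_congr fun i => ?_
    simp only [indicator_apply, mem_Ici]
    split_ifs <;> simp
  have e2 : ∀ i : ℤ, p i * ∑ j ∈ Finset.Icc 0 (i - 1), c j =
      ∑' j : Set.Ici (0 : ℤ), if (j : ℤ) + 1 ≤ i then c j * p i else 0 := by
    intro i
    rw [tsum_subtype (Set.Ici (0 : ℤ)) fun j => if j + 1 ≤ i then c j * p i else 0,
      Finset.mul_sum, tsum_eq_sum (s := Finset.Icc 0 (i - 1))]
    · refine Finset.sum_congr rfl fun j hj => ?_
      rw [Finset.mem_Icc] at hj
      rw [indicator_of_mem (by simpa using hj.1), if_pos (by omega), mul_comm]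
    · intro j hj
      rw [Finset.mem_Icc] at hj
      simp only [indicator_apply, mem_Ici]
      split_ifs
      · omega
      · rfl
      · rfl
  have e3 : ∀ j : Set.Ici (0 : ℤ), (∑' i : ℤ, if (j : ℤ) + 1 ≤ i then c j * p i else 0) =
      ∑' i : Set.Ici (0 : ℤ), if (j : ℤ) + 1 ≤ i then c j * p i else 0 := by
    intro j
    rw [tsum_subtype (Set.Ici (0 : ℤ)) fun i => if (j : ℤ) + 1 ≤ i then c j * p i else 0]
    refine tsum_congr fun i => ?_
    have := j.2
    simp only [mem_Ici] at this
    simp only [indicator_apply, mem_Ici]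
    split_ifs
    · rfl
    · omega
    · rfl
    · rfl
  simp only [e1, e2, e3]
  exact ENNReal.tsum_comm

theorem naturalEnd_halfLine_dual {lam mu : ℤ → ℝ} (h : NaturalRates .halfLine lam mu) :
    NaturalEnd (dualBirth mu) (dualDeath lam) (fun i => 1 / (lam i * symmMeasure lam mu i)) 0 := by
  obtain ⟨hl, hm, -, -, -, h1⟩ := h
  have hp := fun k hk => symmMeasure_pos_of_nonneg hl hm (x := k) hk
  have hc : ∀ i, 0 ≤ i → 0 ≤ 1 / (lam i * symmMeasure lam mu i) := fun i hi => by
    have := mul_pos (hl i hi) (hp i hi)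
    positivity
  refine naturalEnd_dual hl (fun k hk => hm _ (by omega)) hp
    (fun k hk => symmMeasure_balance (hl k hk).ne' (hm _ (by omega)).ne') ⟨0, le_rfl, fun M => ?_⟩
  have hg : ∀ k, 0 ≤ k → 0 ≤ symmMeasure lam mu k *
      ∑ i ∈ Finset.Icc 0 (k - 1), 1 / (lam i * symmMeasure lam mu i) := fun k hk =>
    mul_nonneg (hp k hk).le (Finset.sum_nonneg fun i hi => hc i (Finset.mem_Icc.mp hi).1)
  obtain ⟨x, hx⟩ := exists_lt_sum_of_tsum_eq_top (g := fun k => symmMeasure lam mu k *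
      ∑ i ∈ Finset.Icc 0 (k - 1), 1 / (lam i * symmMeasure lam mu i)) hg (by
    rw [← h1, tsum_tail_swap (fun j => ENNReal.ofReal (1 / (lam j * symmMeasure lam mu j)))
      fun i => ENNReal.ofReal (symmMeasure lam mu i)]
    exact tsum_congr fun j => (ofReal_mul_sum (hp _ j.2).le fun i hi =>
      hc i (Finset.mem_Icc.mp hi).1).symm) M
  refine ⟨x, hx.trans_le ((sum_le_sum_shift hg (by simp) x).trans_eq ?_)⟩
  simp only [add_sub_cancel_right]

/-! ### Lyapunov functions -/

theorem NaturalRates.lam_nonneg {I : SiteKind} {lam mu : ℤ → ℝ} (h : NaturalRates I lam mu)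
    (x : ℤ) : 0 ≤ lam x := by
  cases I
  · rcases le_or_gt 0 x with hx | hx
    · exact (h.1 x hx).le
    · exact (h.2.2.2.1 x hx).1.ge
  · exact (h.1 x).le

theorem NaturalRates.mu_nonneg {I : SiteKind} {lam mu : ℤ → ℝ} (h : NaturalRates I lam mu) (x : ℤ) :
    0 ≤ mu x := by
  cases I
  · rcases lt_trichotomy x 0 with hx | rfl | hx
    · exact (h.2.2.2.1 x hx).2.ge
    · exact h.2.2.1.ge
    · exact (h.2.1 x hx).le
  · exact (h.2.1 x).le

theorem NaturalRates.mu_eq_zero {I : SiteKind} {lam mu : ℤ → ℝ} (h : NaturalRates I lam mu) {a : ℤ}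
    (ha : a ∈ I.sites) (ha' : a - 1 ∉ I.sites) : mu a = 0 := by
  cases I
  · have h1 : (0 : ℤ) ≤ a := ha
    have h2 : ¬ (0 : ℤ) ≤ a - 1 := ha'
    rw [show a = 0 by omega]
    exact h.2.2.1
  · exact absurd (mem_univ _) ha'

theorem NaturalEnd.drift_fst_neg {lam mu p : ℤ → ℝ} {b₀ : ℤ}
    (h : NaturalEnd (fun x => mu (-x)) (fun x => lam (-x)) p b₀) {b : ℤ} (hb : b₀ ≤ b) (x : ℤ) :
    lam x * (hitTime (fun x => mu (-x)) p (-(x + 1)) b - hitTime (fun x => mu (-x)) p (-x) b) +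
      mu x * (hitTime (fun x => mu (-x)) p (-(x - 1)) b - hitTime (fun x => mu (-x)) p (-x) b) =
    if b ≤ -x then 1 else 0 := by
  rw [← h.drift_fst hb (-x), show -(x + 1) = -x - 1 by ring, show -(x - 1) = -x + 1 by ring,
    neg_neg]
  ring

/-- Away from the boundaries, the single-particle chain has a Lyapunov function: the sum of the
expected hitting times of its two ends. -/
theorem NaturalEnd.lyapunov_line {lam mu p p' : ℤ → ℝ} {b : ℤ} (h : NaturalEnd lam mu p b)
    (h' : NaturalEnd (fun x => mu (-x)) (fun x => lam (-x)) p' b) (hl : ∀ x, 0 ≤ lam x)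
    (hm : ∀ x, 0 ≤ mu x) : IsLyapunov lam mu
      (fun x => hitTime lam p x b + hitTime (fun x => mu (-x)) p' (-x) b) 2 := by
  refine ⟨hl, hm, fun x => add_nonneg (h.hitTime_nonneg le_rfl _) (h'.hitTime_nonneg le_rfl _),
    by norm_num, fun x => ?_, fun M => ?_⟩
  · have h1 := h.drift_fst le_rfl x
    have h2 := h'.drift_fst_neg le_rfl x
    have h3 : (if b ≤ x then (1 : ℝ) else 0) ≤ 1 := by split_ifs <;> norm_num
    have h4 : (if b ≤ -x then (1 : ℝ) else 0) ≤ 1 := by split_ifs <;> norm_num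
    linarith
  · obtain ⟨R, hR⟩ := h.exists_bound le_rfl M
    obtain ⟨R', hR'⟩ := h'.exists_bound le_rfl M
    refine (Set.finite_Icc (-R') R).subset fun x hx => ?_
    have hx : hitTime lam p x b + hitTime (fun x => mu (-x)) p' (-x) b ≤ M := hx
    have h1 := hR x (by linarith [h'.hitTime_nonneg le_rfl (-x)])
    have h2 := hR' (-x) (by linarith [h.hitTime_nonneg le_rfl x])
    exact ⟨by omega, h1⟩

theorem NaturalRates.exists_lyapunov {I : SiteKind} {lam mu : ℤ → ℝ} (h : NaturalRates I lam mu) :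
    ∃ u c, IsLyapunov lam mu u c := by
  cases I with
  | line =>
    exact ⟨_, _, (naturalEnd_right_line h 0).lyapunov_line (naturalEnd_left_line h 0)
      h.lam_nonneg h.mu_nonneg⟩
  | halfLine =>
    have hN := naturalEnd_halfLine h
    refine ⟨fun x => hitTime lam (symmMeasure lam mu) x 0 + max (-(x : ℝ)) 0, 1, h.lam_nonneg,
      h.mu_nonneg, fun x => add_nonneg (hN.hitTime_nonneg le_rfl _) (le_max_right _ _),
      zero_le_one, fun x => ?_, fun M => ?_⟩
    · rcases lt_or_ge x 0 with hx | hx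
      · rw [(h.2.2.2.1 x hx).1, (h.2.2.2.1 x hx).2]
        norm_num
      · have h1 := hN.drift_fst le_rfl x
        rw [if_pos hx] at h1
        have hx' : (0 : ℝ) ≤ x := by exact_mod_cast hx
        have e1 : max (-((x + 1 : ℤ) : ℝ)) 0 = 0 := max_eq_right (by push_cast; linarith)
        have e0 : max (-(x : ℝ)) 0 = 0 := max_eq_right (by linarith)
        rcases hx.eq_or_lt with rfl | hx2
        · simp only [e1, e0, add_zero, h.2.2.1, zero_mul] at h1 ⊢
          exact h1.le
        · have hx3 : (1 : ℝ) ≤ x := by exact_mod_cast hx2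
          have e2 : max (-((x - 1 : ℤ) : ℝ)) 0 = 0 := max_eq_right (by push_cast; linarith)
          simp only [e1, e0, e2, add_zero]
          exact h1.le
    · obtain ⟨R, hR⟩ := hN.exists_bound le_rfl M
      refine (Set.finite_Icc (-⌈M⌉) R).subset fun x hx => ?_
      have hx : hitTime lam (symmMeasure lam mu) x 0 + max (-(x : ℝ)) 0 ≤ M := hx
      refine ⟨?_, hR x (by linarith [le_max_right (-(x : ℝ)) 0])⟩
      have h1 : -(x : ℝ) ≤ M := by
        linarith [le_max_left (-(x : ℝ)) 0, hN.hitTime_nonneg le_rfl x]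
      have h2 := h1.trans (Int.le_ceil M)
      have h3 : -x ≤ ⌈M⌉ := by exact_mod_cast h2
      omega

theorem NaturalRates.exists_dual_lyapunov {I : SiteKind} {lam mu : ℤ → ℝ}
    (h : NaturalRates I lam mu) :
    ∃ v : ℤ → ℝ, ∃ c : ℝ, (∀ y, 0 ≤ v y) ∧ 0 ≤ c ∧
      (∀ y, dualBirth mu y * (v (y + 1) - v y) + dualDeath lam y * (v (y - 1) - v y) ≤ c) ∧
      ∀ M, {y | y ∈ I.sites ∧ v y ≤ M}.Finite := by
  cases I with
  | line =>
    have hL := (naturalEnd_right_line_dual h).lyapunov_line (naturalEnd_left_line_dual h)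
      (fun y => h.mu_nonneg (y + 1)) h.lam_nonneg
    exact ⟨_, _, hL.nonneg, hL.const_nonneg, hL.drift,
      fun M => (hL.finite_sublevel M).subset fun y hy => hy.2⟩
  | halfLine =>
    have hN := naturalEnd_halfLine_dual h
    refine ⟨_, 1, hN.hitTime_nonneg le_rfl, zero_le_one, fun y => ?_, fun M => ?_⟩
    · rw [hN.drift_fst le_rfl]
      split_ifs <;> norm_num
    · obtain ⟨R, hR⟩ := hN.exists_bound le_rfl M
      exact (Set.finite_Icc 0 R).subset fun y hy => ⟨hy.1, hR y hy.2⟩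

section pushBlock

variable {I : SiteKind} {n : ℕ} {lam mu : ℤ → ℝ}

theorem moveX_up_mem_iff {z : Config n} (hz : z ∈ interlacing I n) (i : Fin (n + 1)) :
    moveX z i 1 ∈ interlacing I n ↔ ∀ j : Fin n, j.castSucc = i → z.1 i < z.2 j := by
  constructor
  · rintro h j rfl
    have := (h.2.2 j).1
    simp only [moveX, Function.update_self] at this
    omega
  · intro h
    refine ⟨fun k => ?_, hz.2.1, fun j => ?_⟩
    · refine SiteKind.mem_sites_of_le (hz.1 k) ?_
      simp only [moveX, Function.update_apply]
      split_ifs with hk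
      · rw [hk]; omega
      · exact le_rfl
    · have h1 := hz.2.2 j
      have h2 := h j
      simp only [moveX, Function.update_apply]
      split_ifs with h3 h4 h4
      · exact absurd (h3.trans h4.symm) (Fin.castSucc_lt_succ).ne
      · have := h2 h3
        rw [← h3] at *
        omega
      · rw [← h4] at *
        omega
      · exact h1

theorem moveX_down_mem_iff {z : Config n} (hz : z ∈ interlacing I n) (i : Fin (n + 1)) :
    moveX z i (-1) ∈ interlacing I n ↔
      z.1 i - 1 ∈ I.sites ∧ ∀ j : Fin n, j.succ = i → z.2 j + 1 < z.1 i := by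
  constructor
  · intro h
    refine ⟨by simpa [moveX, sub_eq_add_neg] using h.1 i, ?_⟩
    rintro j rfl
    have := (h.2.2 j).2
    simp only [moveX, Function.update_self] at this
    omega
  · rintro ⟨hs, h⟩
    refine ⟨fun k => ?_, hz.2.1, fun j => ?_⟩
    · simp only [moveX, Function.update_apply]
      split_ifs with hk
      · exact hs
      · exact hz.1 k
    · have h1 := hz.2.2 j
      have h2 := h j
      simp only [moveX, Function.update_apply]
      split_ifs with h3 h4 h4
      · exact absurd (h3.trans h4.symm) (Fin.castSucc_lt_succ).ne
      · rw [← h3] at *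
        omega
      · have := h2 h4
        rw [← h4] at *
        omega
      · exact h1

open scoped Classical in
/-- The push-block generator without killing, on functions of arbitrary configurations. -/
noncomputable def unkilledOp (lam mu : ℤ → ℝ) (F : Config n → ℝ) (z : interlacing I n) : ℝ :=
  (∑ i, if moveX z.1 i 1 ∈ interlacing I n then
    lam (z.1.1 i) * (F (moveX z.1 i 1) - F z.1) else 0) +
  (∑ i, if moveX z.1 i (-1) ∈ interlacing I n then
    mu (z.1.1 i) * (F (moveX z.1 i (-1)) - F z.1) else 0) +
  (∑ j, dualBirth mu (z.1.2 j) * (F (upY z.1 j) - F z.1)) +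
  (∑ j, dualDeath lam (z.1.2 j) * (F (downY z.1 j) - F z.1))

theorem unkilledOp_add (F G : Config n → ℝ) (z : interlacing I n) :
    unkilledOp lam mu (fun p => F p + G p) z = unkilledOp lam mu F z + unkilledOp lam mu G z := by
  classical
  have e : ∀ (p : Prop) [Decidable p] (a b : ℝ),
      (if p then a + b else 0) = (if p then a else 0) + (if p then b else 0) := by
    intros
    split_ifs <;> ring
  simp only [unkilledOp, add_sub_add_comm, e, mul_add, Finset.sum_add_distrib]
  ring

theorem unkilledOp_sum {κ : Type*} (s : Finset κ) (F : κ → Config n → ℝ) (z : interlacing I n) :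
    unkilledOp lam mu (fun p => ∑ k ∈ s, F k p) z = ∑ k ∈ s, unkilledOp lam mu (F k) z := by
  classical
  induction s using Finset.induction_on with
  | empty => simp [unkilledOp]
  | insert k s hk ih =>
    simp only [Finset.sum_insert hk]
    rw [unkilledOp_add, ih]

/-- Killing can only decrease the drift of a nonnegative function. -/
theorem genOp_le_unkilledOp (hlam : ∀ x, 0 ≤ lam x) (hmu : ∀ x, 0 ≤ mu x) {F : Config n → ℝ}
    (hF : ∀ z ∈ interlacing I n, ∀ j, 0 ≤ F (upY z j) ∧ 0 ≤ F (downY z j))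
    (z : interlacing I n) :
    genOp (pushBlockRate I n lam mu) (fun w => F w.1) z ≤ unkilledOp lam mu F z := by
  classical
  rw [genOp_pushBlockRate, unkilledOp]
  have hle : ∀ p : Config n, 0 ≤ F p → extendZero (I := I) (fun w => F w.1) p ≤ F p := by
    intro p hp
    by_cases h : p ∈ interlacing I n
    · rw [extendZero_of_mem _ h]
    · rw [extendZero_of_notMem _ h]; exact hp
  refine add_le_add (add_le_add (add_le_add ?_ ?_) ?_) ?_
  · refine Finset.sum_le_sum fun i _ => ?_
    split_ifs with h
    · rw [extendZero_of_mem _ h]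
    · exact le_rfl
  · refine Finset.sum_le_sum fun i _ => ?_
    split_ifs with h
    · rw [extendZero_of_mem _ h]
    · exact le_rfl
  · refine Finset.sum_le_sum fun j _ => mul_le_mul_of_nonneg_left ?_ (hmu _)
    exact sub_le_sub_right (hle _ (hF z.1 z.2 j).1) _
  · refine Finset.sum_le_sum fun j _ => mul_le_mul_of_nonneg_left ?_ (hlam _)
    exact sub_le_sub_right (hle _ (hF z.1 z.2 j).2) _

theorem unkilledOp_snd (v : ℤ → ℝ) (k : Fin n) (z : interlacing I n) :
    unkilledOp lam mu (fun p => v (p.2 k)) z =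
      dualBirth mu (z.1.2 k) * (v (z.1.2 k + 1) - v (z.1.2 k)) +
        dualDeath lam (z.1.2 k) * (v (z.1.2 k - 1) - v (z.1.2 k)) := by
  classical
  rw [unkilledOp, Finset.sum_eq_zero, Finset.sum_eq_zero, Finset.sum_eq_single k,
    Finset.sum_eq_single k]
  · simp [upY, downY]
  · intro j _ hj
    simp [downY, Function.update_of_ne hj.symm]
  · simp
  · intro j _ hj
    simp [upY, Function.update_of_ne hj.symm]
  · simp
  · intro i _
    simp [moveX]
  · intro i _
    simp [moveX]

/-- The hitting time of the last first-level particle from the barrier given by its second-level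
neighbour, which moves by the dual dynamics: both motions contribute drift one. The jumps that are
blocked or pushed do no harm, since the hitting time vanishes at and below the barrier. -/
theorem unkilledOp_top_le {m : ℕ} {p : ℤ → ℝ} {b₀ : ℤ} (h : NaturalEnd lam mu p b₀)
    (z : interlacing I (m + 1)) (hb : b₀ ≤ z.1.2 (Fin.last m)) :
    unkilledOp lam mu (fun q : Config (m + 1) =>
      hitTime lam p (q.1 (Fin.last m).succ) (q.2 (Fin.last m) + 1)) z ≤ 2 := by
  classical
  set l := Fin.last m with hl
  have hz := z.2.2.2 l
  set x := z.1.1 l.succ with hx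
  set y := z.1.2 l with hy
  have hlast : ∀ j : Fin (m + 1), j.castSucc ≠ l.succ := by
    intro j hj
    have := congrArg Fin.val hj
    simp [hl] at this
    omega
  have e1 : (∑ i, if moveX z.1 i 1 ∈ interlacing I (m + 1) then
      lam (z.1.1 i) * (hitTime lam p ((moveX z.1 i 1).1 l.succ) ((moveX z.1 i 1).2 l + 1) -
        hitTime lam p x (y + 1)) else 0) =
      lam x * (hitTime lam p (x + 1) (y + 1) - hitTime lam p x (y + 1)) := by
    rw [Finset.sum_eq_single l.succ]
    · rw [if_pos ((moveX_up_mem_iff z.2 _).mpr fun j hj => absurd hj (hlast j))]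
      simp [moveX, hx, hy]
    · intro i _ hi
      simp [moveX, Function.update_of_ne hi.symm, hx, hy]
    · simp
  have e2 : (∑ i, if moveX z.1 i (-1) ∈ interlacing I (m + 1) then
      mu (z.1.1 i) * (hitTime lam p ((moveX z.1 i (-1)).1 l.succ) ((moveX z.1 i (-1)).2 l + 1) -
        hitTime lam p x (y + 1)) else 0) =
      mu x * (hitTime lam p (x - 1) (y + 1) - hitTime lam p x (y + 1)) := by
    rw [Finset.sum_eq_single l.succ]
    · -- a blocked jump would not change the hitting time, which vanishes at the barrier
      by_cases hcon : y + 1 < x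
      · rw [if_pos]
        · simp [moveX, hx, hy, sub_eq_add_neg]
        · refine (moveX_down_mem_iff z.2 _).mpr ⟨?_, fun j hj => ?_⟩
          · exact SiteKind.mem_sites_of_le (z.2.2.1 l) (by omega)
          · rw [Fin.succ_injective _ hj]; exact hcon
      · rw [if_neg, hitTime_of_le (x := x) (by omega), hitTime_of_le (x := x - 1) (by omega)]
        · ring
        · intro hmem
          exact hcon (((moveX_down_mem_iff z.2 _).mp hmem).2 l rfl)
    · intro i _ hi
      simp [moveX, Function.update_of_ne hi.symm, hx, hy]
    · simp
  have e3 : (∑ j, dualBirth mu (z.1.2 j) * (hitTime lam p ((upY z.1 j).1 l.succ)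
      ((upY z.1 j).2 l + 1) - hitTime lam p x (y + 1))) =
      mu (y + 1) * (hitTime lam p x (y + 1 + 1) - hitTime lam p x (y + 1)) := by
    rw [Finset.sum_eq_single l]
    · simp only [upY, Function.update_self, dualBirth]
      rw [← hx, ← hy]
      split_ifs with hcon
      · rw [Function.update_self, hitTime_of_le (x := x + 1) (by omega),
          hitTime_of_le (x := x) (b := y + 1 + 1) (by omega)]
      · rfl
    · intro j _ hj
      have hne : l.succ ≠ j.succ := fun h => hj (Fin.succ_injective _ h.symm)
      simp only [upY, Function.update_of_ne hj.symm]
      split_ifs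
      · rw [Function.update_of_ne hne, ← hx, ← hy]; ring
      · rw [← hx, ← hy]; ring
    · simp
  have e4 : (∑ j, dualDeath lam (z.1.2 j) * (hitTime lam p ((downY z.1 j).1 l.succ)
      ((downY z.1 j).2 l + 1) - hitTime lam p x (y + 1))) =
      lam (y + 1 - 1) * (hitTime lam p x (y + 1 - 1) - hitTime lam p x (y + 1)) := by
    rw [Finset.sum_eq_single l]
    · simp only [downY, Function.update_self, dualDeath]
      rw [← hy, sub_add_cancel, add_sub_cancel_right]
      split_ifs with hcon
      · rw [Function.update_of_ne (hlast l).symm]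
      · rfl
    · intro j _ hj
      simp only [downY, Function.update_of_ne hj.symm]
      split_ifs
      · rw [Function.update_of_ne (hlast j).symm, ← hx, ← hy]; ring
      · rw [← hx, ← hy]; ring
    · simp
  rw [unkilledOp, e1, e2, e3, e4]
  have d1 := h.drift_fst (b := y + 1) (by omega) x
  have d2 := h.drift_snd (b := y + 1) (x := x) (by omega) (by omega)
  rw [if_pos (by omega)] at d1
  linarith

/-- The reflected version of `unkilledOp_top_le`, for the first particle of the first level. -/
theorem unkilledOp_bottom_le {m : ℕ} {p : ℤ → ℝ}
    (h : ∀ b₀, NaturalEnd (fun x => mu (-x)) (fun x => lam (-x)) p b₀)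
    (z : interlacing .line (m + 1)) :
    unkilledOp lam mu (fun q : Config (m + 1) =>
      hitTime (fun x => mu (-x)) p (-q.1 (Fin.castSucc 0)) (-q.2 0)) z ≤ 2 := by
  classical
  set l : Fin (m + 1) := 0 with hl
  have hz := z.2.2.2 l
  set x := z.1.1 l.castSucc with hx
  set y := z.1.2 l with hy
  set H := hitTime (fun x => mu (-x)) p with hH
  have hfirst : ∀ j : Fin (m + 1), j.succ ≠ l.castSucc := by
    intro j hj
    have := congrArg Fin.val hj
    simp [hl] at this
  have e1 : (∑ i, if moveX z.1 i 1 ∈ interlacing .line (m + 1) then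
      lam (z.1.1 i) * (H (-(moveX z.1 i 1).1 l.castSucc) (-(moveX z.1 i 1).2 l) -
        H (-x) (-y)) else 0) = lam x * (H (-(x + 1)) (-y) - H (-x) (-y)) := by
    rw [Finset.sum_eq_single l.castSucc]
    · by_cases hcon : x < y
      · rw [if_pos]
        · simp only [moveX, Function.update_self]
          rw [← hx, ← hy]
        · refine (moveX_up_mem_iff z.2 _).mpr fun j hj => ?_
          rw [Fin.castSucc_injective _ hj]; exact hcon
      · rw [if_neg, hH, hitTime_of_le (x := -x) (by omega),
          hitTime_of_le (x := -(x + 1)) (by omega)]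
        · ring
        · intro hmem
          exact hcon ((moveX_up_mem_iff z.2 _).mp hmem l rfl)
    · intro i _ hi
      simp only [moveX, Function.update_of_ne hi.symm]
      rw [← hx, ← hy, sub_self, mul_zero, ite_self]
    · simp
  have e2 : (∑ i, if moveX z.1 i (-1) ∈ interlacing .line (m + 1) then
      mu (z.1.1 i) * (H (-(moveX z.1 i (-1)).1 l.castSucc) (-(moveX z.1 i (-1)).2 l) -
        H (-x) (-y)) else 0) = mu x * (H (-(x - 1)) (-y) - H (-x) (-y)) := by
    rw [Finset.sum_eq_single l.castSucc]
    · rw [if_pos ((moveX_down_mem_iff z.2 _).mpr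
        ⟨mem_univ _, fun j hj => absurd hj (hfirst j)⟩)]
      simp only [moveX, Function.update_self]
      rw [← hx, ← hy, sub_eq_add_neg x 1]
    · intro i _ hi
      simp only [moveX, Function.update_of_ne hi.symm]
      rw [← hx, ← hy, sub_self, mul_zero, ite_self]
    · simp
  have e3 : (∑ j, dualBirth mu (z.1.2 j) * (H (-(upY z.1 j).1 l.castSucc)
      (-(upY z.1 j).2 l) - H (-x) (-y))) =
      mu (-(-y - 1)) * (H (-x) (-y - 1) - H (-x) (-y)) := by
    rw [Finset.sum_eq_single l]
    · simp only [upY, Function.update_self, dualBirth]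
      rw [← hy, show -(-y - 1) = y + 1 by ring, show -(y + 1) = -y - 1 by ring]
      split_ifs with hcon
      · rw [Function.update_of_ne (hfirst l).symm]
      · rfl
    · intro j _ hj
      simp only [upY, Function.update_of_ne hj.symm]
      split_ifs
      · rw [Function.update_of_ne (hfirst j).symm, ← hx, ← hy]; ring
      · rw [← hx, ← hy]; ring
    · simp
  have e4 : (∑ j, dualDeath lam (z.1.2 j) * (H (-(downY z.1 j).1 l.castSucc)
      (-(downY z.1 j).2 l) - H (-x) (-y))) =
      lam (- -y) * (H (-x) (-y + 1) - H (-x) (-y)) := by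
    rw [Finset.sum_eq_single l]
    · simp only [downY, Function.update_self, dualDeath]
      rw [← hx, ← hy, neg_neg, show -(y - 1) = -y + 1 by ring]
      split_ifs with hcon
      · rw [Function.update_self, hH, hitTime_of_le (x := -(x - 1)) (by omega),
          hitTime_of_le (x := -x) (b := -y + 1) (by omega)]
      · rfl
    · intro j _ hj
      have hne : l.castSucc ≠ j.castSucc := fun h => hj (Fin.castSucc_injective _ h.symm)
      simp only [downY, Function.update_of_ne hj.symm]
      split_ifs
      · rw [Function.update_of_ne hne, ← hx, ← hy]; ring
      · rw [← hx, ← hy]; ring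
    · simp
  rw [unkilledOp, e1, e2, e3, e4]
  have d1 := (h (-y)).drift_fst_neg le_rfl x
  have d2 := (h (-y - 1)).drift_snd (b := -y) (x := -x) le_rfl (by omega)
  rw [if_pos (by omega)] at d1
  simp only [← hH] at d1 d2
  linarith

/-- The push-block dynamics of a single first-level particle is its birth and death chain. -/
theorem unkilledOp_single_le {u : ℤ → ℝ} {c : ℝ} (hmu0 : ∀ a ∈ I.sites, a - 1 ∉ I.sites → mu a = 0)
    (hu : IsLyapunov lam mu u c) (z : interlacing I 0) :
    unkilledOp lam mu (fun q : Config 0 => u (q.1 0)) z ≤ c := by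
  classical
  have h1 : moveX z.1 0 1 ∈ interlacing I 0 := (moveX_up_mem_iff z.2 0).mpr fun j => j.elim0
  have h2 : (if moveX z.1 0 (-1) ∈ interlacing I 0 then
      mu (z.1.1 0) * (u (z.1.1 0 + -1) - u (z.1.1 0)) else 0) =
      mu (z.1.1 0) * (u (z.1.1 0 + -1) - u (z.1.1 0)) := by
    split_ifs with h
    · rfl
    · rw [hmu0 _ (z.2.1 0), zero_mul]
      exact fun hs => h ((moveX_down_mem_iff z.2 0).mpr ⟨hs, fun j => j.elim0⟩)
  have : Subsingleton (Fin (0 + 1)) := inferInstanceAs (Subsingleton (Fin 1))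
  have e1 : (moveX z.1 0 1).1 0 = z.1.1 0 + 1 := by simp [moveX]
  have e2 : (moveX z.1 0 (-1)).1 0 = z.1.1 0 + -1 := by simp [moveX]
  rw [unkilledOp, Fin.sum_univ_zero, Fin.sum_univ_zero, Fintype.sum_subsingleton _ 0,
    Fintype.sum_subsingleton _ 0, if_pos h1, e1, e2, h2, add_zero, add_zero]
  exact hu.drift (z.1.1 0)

theorem isTame_pushBlockRate_of (hlam : ∀ x, 0 ≤ lam x) (hmu : ∀ x, 0 ≤ mu x) {F : Config n → ℝ}
    {C : ℝ} (hF : ∀ z ∈ interlacing I n, 0 ≤ F z) (hF' : ∀ z ∈ interlacing I n, ∀ j,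
      0 ≤ F (upY z j) ∧ 0 ≤ F (downY z j)) (hC : 0 ≤ C)
    (hdrift : ∀ z : interlacing I n, unkilledOp lam mu F z ≤ C)
    (hfin : ∀ M, {z | z ∈ interlacing I n ∧ F z ≤ M}.Finite) :
    IsTame (pushBlockRate I n lam mu) (fun w => F w.1) C where
  offDiag := pushBlockRate_offDiag hlam hmu
  finite_row := pushBlockRate_finite_row
  row_nonpos z := by
    rw [genOp_pushBlockRate_one]
    exact neg_nonpos.mpr (killingRate_nonneg hlam hmu z)
  V_nonneg z := hF z.1 z.2
  C_nonneg := hC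
  drift z := (genOp_le_unkilledOp hlam hmu hF' z).trans (hdrift z)
  finite_sublevel M := by
    refine ((hfin M).preimage (f := Subtype.val) Subtype.val_injective.injOn).subset fun z hz => ?_
    exact ⟨z.2, hz⟩

/-- Interlacing configurations are controlled by the second level and by the two outermost
particles of the first level. -/
theorem finite_of_bounds {s : Set (Config n)} {Y : Set ℤ} (hY : Y.Finite) (L R : (Fin n → ℤ) → ℤ)
    (hs : ∀ z ∈ s, (∀ j, z.2 j ∈ Y) ∧ ∀ i, L z.2 ≤ z.1 i ∧ z.1 i ≤ R z.2) : s.Finite := by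
  have hYn : {y : Fin n → ℤ | ∀ j, y j ∈ Y}.Finite := Set.Finite.pi' fun _ => hY
  have hU : (⋃ y ∈ {y : Fin n → ℤ | ∀ j, y j ∈ Y},
      {x : Fin (n + 1) → ℤ | ∀ i, x i ∈ Set.Icc (L y) (R y)} ×ˢ {y}).Finite :=
    hYn.biUnion fun y _ => (Set.Finite.pi' fun _ => Set.finite_Icc _ _).prod (finite_singleton y)
  refine hU.subset fun z hz => ?_
  obtain ⟨h1, h2⟩ := hs z hz
  simp only [mem_iUnion]
  exact ⟨z.2, h1, fun i => h2 i, rfl⟩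

/-- The push-block dynamics has a Lyapunov function: the Lyapunov functions of the second-level
particles, plus the times which the outermost first-level particles would need to get to their
positions from their second-level neighbours. -/
theorem NaturalRates.exists_isTame_pushBlockRate (h : NaturalRates I lam mu) (n : ℕ) :
    ∃ V C, IsTame (pushBlockRate I n lam mu) V C := by
  have hlam := h.lam_nonneg
  have hmu := h.mu_nonneg
  cases n with
  | zero =>
    obtain ⟨u, c, hu⟩ := h.exists_lyapunov
    refine ⟨_, c, isTame_pushBlockRate_of hlam hmu (F := fun q => u (q.1 0))
      (fun z _ => hu.nonneg _) (fun z _ j => j.elim0) hu.const_nonneg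
      (fun z => unkilledOp_single_le (fun a ha ha' => h.mu_eq_zero ha ha') hu z) fun M => ?_⟩
    refine ((Set.Finite.pi' fun _ : Fin 1 => hu.finite_sublevel M).prod
      (Set.finite_univ (α := Fin 0 → ℤ))).subset fun z hz => ⟨fun i => ?_, mem_univ _⟩
    rw [Subsingleton.elim i 0]
    exact hz.2
  | succ m =>
    obtain ⟨v, c, hv, hc, hdrift, hfin⟩ := h.exists_dual_lyapunov
    have hvsum : ∀ z : Config (m + 1), 0 ≤ ∑ j, v (z.2 j) := fun z =>
      Finset.sum_nonneg fun j _ => hv _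
    have hvdrift : ∀ z : interlacing I (m + 1),
        unkilledOp lam mu (fun p => ∑ j, v (p.2 j)) z ≤ (m + 1) * c := by
      intro z
      rw [unkilledOp_sum]
      refine (Finset.sum_le_sum fun j _ => (unkilledOp_snd v j z).trans_le (hdrift _)).trans ?_
      simp
    have hvbound : ∀ (z : Config (m + 1)) (M : ℝ), ∑ j, v (z.2 j) ≤ M → ∀ j, v (z.2 j) ≤ M :=
      fun z M hz j => (Finset.single_le_sum (f := fun j => v (z.2 j)) (fun j _ => hv _)
        (Finset.mem_univ j)).trans hz
    cases I with
    | halfLine =>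
      have hN := naturalEnd_halfLine h
      have hnn : ∀ (z : Config (m + 1)), 0 ≤ z.2 (Fin.last m) + 1 → 0 ≤ ∑ j, v (z.2 j) +
          hitTime lam (symmMeasure lam mu) (z.1 (Fin.last m).succ) (z.2 (Fin.last m) + 1) :=
        fun z hz => add_nonneg (hvsum z) (hN.hitTime_nonneg hz _)
      refine ⟨_, (m + 1) * c + 2, isTame_pushBlockRate_of hlam hmu
        (F := fun q => ∑ j, v (q.2 j) +
          hitTime lam (symmMeasure lam mu) (q.1 (Fin.last m).succ) (q.2 (Fin.last m) + 1))
        (fun z hz => hnn z ?_) (fun z hz j => ⟨hnn _ ?_, hnn _ ?_⟩) (by positivity)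
        (fun z => ?_) fun M => ?_⟩
      · have : (0 : ℤ) ≤ z.2 (Fin.last m) := hz.2.1 _
        omega
      · have : (0 : ℤ) ≤ z.2 (Fin.last m) := hz.2.1 _
        simp only [upY, Function.update_apply]
        split_ifs with hj
        · rw [← hj]; omega
        · omega
      · have : (0 : ℤ) ≤ z.2 (Fin.last m) := hz.2.1 _
        simp only [downY, Function.update_apply]
        split_ifs with hj
        · rw [← hj]; omega
        · omega
      · rw [unkilledOp_add]
        exact add_le_add (hvdrift z) (unkilledOp_top_le hN z (z.2.2.1 _))
      · have hbd : ∀ y : Fin (m + 1) → ℤ, ∃ R : ℤ, 0 ≤ y (Fin.last m) + 1 → ∀ x,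
            hitTime lam (symmMeasure lam mu) x (y (Fin.last m) + 1) ≤ M → x ≤ R := by
          intro y
          by_cases hy : 0 ≤ y (Fin.last m) + 1
          · obtain ⟨R, hR⟩ := hN.exists_bound hy M
            exact ⟨R, fun _ => hR⟩
          · exact ⟨0, fun h => absurd h hy⟩
        choose R hR using hbd
        refine finite_of_bounds (hfin M) (fun _ => 0) R fun z hz => ?_
        have hy0 : (0 : ℤ) ≤ z.2 (Fin.last m) := hz.1.2.1 _
        have hle := hz.2
        have h1 := hvsum z
        have h2 := hN.hitTime_nonneg (b := z.2 (Fin.last m) + 1) (by omega)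
          (z.1 (Fin.last m).succ)
        refine ⟨fun j => ⟨hz.1.2.1 j, hvbound z M (by linarith) j⟩, fun i => ⟨hz.1.1 i, ?_⟩⟩
        refine ((interlacing_strictMono_fst hz.1).monotone (Fin.le_last i)).trans ?_
        exact hR z.2 (by omega) _ (by rw [← Fin.succ_last]; linarith)
    | line =>
      have hN := naturalEnd_right_line h
      have hN' := naturalEnd_left_line h
      set H := hitTime lam (symmMeasure lam mu) with hH
      set H' := hitTime (fun x => mu (-x)) (fun x => symmMeasure lam mu (-x)) with hH'
      have hp1 : ∀ x b, 0 ≤ H x b := fun x b => (hN b).hitTime_nonneg le_rfl x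
      have hp2 : ∀ x b, 0 ≤ H' x b := fun x b => (hN' b).hitTime_nonneg le_rfl x
      have hnn : ∀ z : Config (m + 1), 0 ≤ ∑ j, v (z.2 j) +
          H (z.1 (Fin.last m).succ) (z.2 (Fin.last m) + 1) +
          H' (-z.1 (Fin.castSucc 0)) (-z.2 0) :=
        fun z => add_nonneg (add_nonneg (hvsum z) (hp1 _ _)) (hp2 _ _)
      refine ⟨_, (m + 1) * c + 2 + 2, isTame_pushBlockRate_of hlam hmu
        (F := fun z => ∑ j, v (z.2 j) + H (z.1 (Fin.last m).succ) (z.2 (Fin.last m) + 1) +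
          H' (-z.1 (Fin.castSucc 0)) (-z.2 0))
        (fun z _ => hnn z) (fun z _ j => ⟨hnn _, hnn _⟩) (by positivity)
        (fun z => ?_) fun M => ?_⟩
      · rw [unkilledOp_add, unkilledOp_add]
        exact add_le_add (add_le_add (hvdrift z) (unkilledOp_top_le (hN _) z le_rfl))
          (unkilledOp_bottom_le hN' z)
      · choose R hR using fun y : Fin (m + 1) → ℤ =>
          (hN (y (Fin.last m) + 1)).exists_bound le_rfl M
        choose L hL using fun y : Fin (m + 1) → ℤ => (hN' (-y 0)).exists_bound le_rfl M
        refine finite_of_bounds (hfin M) (fun y => -L y) R fun z hz => ?_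
        have hle := hz.2
        have h1 := hvsum z
        have h2 := hp1 (z.1 (Fin.last m).succ) (z.2 (Fin.last m) + 1)
        have h3 := hp2 (-z.1 (Fin.castSucc 0)) (-z.2 0)
        refine ⟨fun j => ⟨hz.1.2.1 j, hvbound z M (by linarith) j⟩, fun i => ⟨?_, ?_⟩⟩
        · have h4 := hL z.2 (-z.1 (Fin.castSucc 0)) (by linarith)
          have h5 := (interlacing_strictMono_fst hz.1).monotone (Fin.zero_le i)
          rw [Fin.castSucc_zero] at h4
          omega
        · refine ((interlacing_strictMono_fst hz.1).monotone (Fin.le_last i)).trans ?_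
          exact hR z.2 _ (by rw [← Fin.succ_last]; linarith)

end pushBlock

/-! ### The straddling probabilities -/

theorem expect_zero_fun {S : Type*} (Q : S → S → ℝ) (t : ℝ) (x : S) :
    expect Q t (fun _ => 0) x = 0 := by
  simp [expect]

theorem expect_add {S : Type*} {Q : S → S → ℝ} {V : S → ℝ} {C : ℝ} (hQ : IsTame Q V C) {t : ℝ}
    (ht : 0 ≤ t) {a a' : S → ℝ} {B B' : ℝ} (ha : ∀ y, |a y| ≤ B) (ha' : ∀ y, |a' y| ≤ B') (x : S) :
    expect Q t (fun y => a y + a' y) x = expect Q t a x + expect Q t a' x := by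
  simp only [expect, mul_add]
  exact (hQ.summable_expect ht ha x).tsum_add (hQ.summable_expect ht ha' x)

theorem expect_sum_mul {S : Type*} {Q : S → S → ℝ} {V : S → ℝ} {C : ℝ} (hQ : IsTame Q V C) {t : ℝ}
    (ht : 0 ≤ t) {κ : Type*} (s : Finset κ) (c : κ → ℝ) {a : κ → S → ℝ} {B : ℝ}
    (ha : ∀ k y, |a k y| ≤ B) (x : S) :
    ∑ k ∈ s, c k * expect Q t (a k) x = expect Q t (fun y => ∑ k ∈ s, c k * a k y) x := by
  simp only [expect, Finset.mul_sum, ← tsum_mul_left]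
  rw [← Summable.tsum_finsetSum fun k _ => (hQ.summable_expect ht (ha k) x).mul_left (c k)]
  refine tsum_congr fun y => Finset.sum_congr rfl fun k _ => ?_
  ring

section straddle

variable {n : ℕ}

/-- Index set of the points of the flow started from `x_i`, `y_j` and `y_j + 1`. -/
abbrev TripleIndex (n : ℕ) : Type := Fin (n + 1) ⊕ (Fin n ⊕ Fin n)

/-- The points `x_i`, `y_j`, `y'_j` as one family. -/
def triple (x : Fin (n + 1) → ℤ) (y y' : Fin n → ℤ) : TripleIndex n → ℤ :=
  Sum.elim x (Sum.elim y y')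

/-- The points `x_i`, `y_j`, `y_j + 1`. -/
def lift (z : Config n) : TripleIndex n → ℤ := triple z.1 z.2 fun j => z.2 j + 1

/-- Indicator of the event that the points started from `x` are at `w.1` and that the points started
from `y_j` and `y'_j` straddle `w.2 j`. -/
def straddle (w : Config n) (p : TripleIndex n → ℤ) : ℝ :=
  if (∀ i, p (Sum.inl i) = w.1 i) ∧
    ∀ j, p (Sum.inr (Sum.inl j)) ≤ w.2 j ∧ w.2 j < p (Sum.inr (Sum.inr j)) then 1 else 0

theorem straddle_nonneg (w : Config n) (p : TripleIndex n → ℤ) : 0 ≤ straddle w p := by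
  unfold straddle
  split_ifs <;> norm_num

theorem abs_straddle_le (w : Config n) (p : TripleIndex n → ℤ) : |straddle w p| ≤ 1 := by
  unfold straddle
  split_ifs <;> norm_num

/-- The probability that the flow started from the points `p` is at time `t` at `w.1` and
straddles `w.2`. -/
noncomputable def straddleProb (lam mu : ℤ → ℝ) (w : Config n) (t : ℝ)
    (p : TripleIndex n → ℤ) : ℝ :=
  expect (flowRate lam mu) t (straddle w) p

variable {lam mu u : ℤ → ℝ} {c : ℝ} {w : Config n} {t : ℝ} {p : TripleIndex n → ℤ}

theorem straddleProb_nonneg (hu : IsLyapunov lam mu u c) (ht : 0 ≤ t) :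
    0 ≤ straddleProb lam mu w t p :=
  tsum_nonneg fun q => mul_nonneg ((isTame_flowRate hu).chain_nonneg ht p q) (straddle_nonneg w q)

theorem straddleProb_eq_zero (hu : IsLyapunov lam mu u c) (ht : 0 ≤ t)
    (h : ∀ q : TripleIndex n → ℤ, (∀ k l, p k ≤ p l → q k ≤ q l) → straddle w q = 0) :
    straddleProb lam mu w t p = 0 := by
  rw [straddleProb, expect_flow_congr (a' := fun _ => 0) (B' := 0) (isTame_flowRate hu)
    (abs_straddle_le w) (by simp) h ht, expect_zero_fun]

/-- Points which have coalesced do not straddle anything. -/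
theorem straddleProb_eq_zero_of_le (hu : IsLyapunov lam mu u c) (ht : 0 ≤ t) (j : Fin n)
    (h : p (Sum.inr (Sum.inr j)) ≤ p (Sum.inr (Sum.inl j))) : straddleProb lam mu w t p = 0 := by
  refine straddleProb_eq_zero hu ht fun q hq => if_neg fun hs => ?_
  have h1 := hq _ _ h
  have h2 := hs.2 j
  omega

/-- Splitting the interval between two straddling points at a point `m` in between. -/
theorem straddleProb_split (hu : IsLyapunov lam mu u c) (ht : 0 ≤ t) (j : Fin n) {m : ℤ}
    (h1 : p (Sum.inr (Sum.inl j)) ≤ m) (h2 : m ≤ p (Sum.inr (Sum.inr j))) :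
    straddleProb lam mu w t p =
      straddleProb lam mu w t (Function.update p (Sum.inr (Sum.inr j)) m) +
        straddleProb lam mu w t (Function.update p (Sum.inr (Sum.inl j)) m) := by
  have hQ := isTame_flowRate (ι := TripleIndex n) hu
  have hQ' := isTame_flowRate (ι := Option (TripleIndex n)) hu
  -- a flow with the additional point `m`, at index `none`
  set P : Option (TripleIndex n) → ℤ := fun o => o.elim m p with hP
  set σ : TripleIndex n → TripleIndex n → Option (TripleIndex n) :=
    fun k l => if l = k then none else some l with hσ
  have e0 : p = P ∘ some := rfl
  have e1 : ∀ k, Function.update p k m = P ∘ σ k := by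
    intro k
    ext l
    simp only [Function.update_apply, hσ, Function.comp_apply]
    split_ifs <;> rfl
  simp only [straddleProb]
  rw [e1, e1]
  conv_lhs => rw [e0]
  rw [expect_flow_comp hQ' hQ some (abs_straddle_le w) ht,
    expect_flow_comp hQ' hQ (σ _) (abs_straddle_le w) ht,
    expect_flow_comp hQ' hQ (σ _) (abs_straddle_le w) ht,
    ← expect_add hQ' ht (fun q => abs_straddle_le w _) (fun q => abs_straddle_le w _)]
  refine expect_flow_congr (B := 1) (B' := 1 + 1) hQ' (fun q => abs_straddle_le w _) (fun q =>
    (abs_add_le _ _).trans (add_le_add (abs_straddle_le w _) (abs_straddle_le w _)))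
    (fun q hq => ?_) ht
  have o1 : q (some (Sum.inr (Sum.inl j))) ≤ q none := hq (some _) none h1
  have o2 : q none ≤ q (some (Sum.inr (Sum.inr j))) := hq none (some _) h2
  have f1 : ∀ k l, l ≠ k → (q ∘ σ k) l = q (some l) := fun k l h => by simp [hσ, h]
  have f2 : ∀ k, (q ∘ σ k) k = q none := fun k => by simp [hσ]
  by_cases hm : w.2 j < q none
  · have z2 : straddle w (q ∘ σ (Sum.inr (Sum.inl j))) = 0 := by
      refine if_neg fun hs => ?_
      have := (hs.2 j).1
      rw [f2] at this
      omega
    rw [z2, add_zero]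
    simp only [straddle]
    refine if_congr (and_congr (forall_congr' fun i => ?_) (forall_congr' fun k => ?_)) rfl rfl
    · rw [f1 _ _ (by simp)]; rfl
    · rw [f1 _ (Sum.inr (Sum.inl k)) (by simp)]
      by_cases hk : k = j
      · subst hk
        rw [f2]
        simp only [Function.comp_apply]
        omega
      · rw [f1 _ _ (by simpa using hk)]; rfl
  · have z1 : straddle w (q ∘ σ (Sum.inr (Sum.inr j))) = 0 := by
      refine if_neg fun hs => ?_
      have := (hs.2 j).2
      rw [f2] at this
      omega
    rw [z1, zero_add]
    simp only [straddle]
    refine if_congr (and_congr (forall_congr' fun i => ?_) (forall_congr' fun k => ?_)) rfl rfl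
    · rw [f1 _ _ (by simp)]; rfl
    · rw [f1 _ (Sum.inr (Sum.inr k)) (by simp)]
      by_cases hk : k = j
      · subst hk
        rw [f2]
        simp only [Function.comp_apply]
        omega
      · rw [f1 _ _ (by simpa using hk)]; rfl

theorem straddleProb_zero (hu : IsLyapunov lam mu u c) (z : Config n) :
    straddleProb lam mu w 0 (lift z) = if z = w then 1 else 0 := by
  rw [straddleProb, (isTame_flowRate hu).expect_zero, straddle]
  refine if_congr ?_ rfl rfl
  rw [Prod.ext_iff, funext_iff, funext_iff]
  refine and_congr Iff.rfl (forall_congr' fun j => ?_)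
  simp only [lift, triple, Sum.elim_inr, Sum.elim_inl]
  omega

variable {I : SiteKind}

theorem moveSite_triple (x : Fin (n + 1) → ℤ) (y y' : Fin n → ℤ) (a b : ℤ) :
    moveSite (triple x y y') a b = triple (moveSite x a b) (moveSite y a b) (moveSite y' a b) := by
  ext k
  rcases k with i | j | j <;> rfl

theorem moveSite_eq_update {ι : Type*} [DecidableEq ι] {x : ι → ℤ} (hx : Function.Injective x)
    (i : ι) (b : ℤ) : moveSite x (x i) b = Function.update x i b := by
  ext k
  rw [moveSite, Function.update_apply]
  exact if_congr hx.eq_iff rfl rfl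

theorem moveSite_eq_self' {ι : Type*} {x : ι → ℤ} {a b : ℤ} (h : ∀ i, x i ≠ a) :
    moveSite x a b = x := by
  ext k
  rw [moveSite, if_neg (h k)]

theorem update_triple_left (x : Fin (n + 1) → ℤ) (y y' : Fin n → ℤ) (j : Fin n) (m : ℤ) :
    Function.update (triple x y y') (Sum.inr (Sum.inl j)) m =
      triple x (Function.update y j m) y' := by
  rw [triple, Sum.update_elim_inr, Sum.update_elim_inl, triple]

theorem update_triple_right (x : Fin (n + 1) → ℤ) (y y' : Fin n → ℤ) (j : Fin n) (m : ℤ) :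
    Function.update (triple x y y') (Sum.inr (Sum.inr j)) m =
      triple x y (Function.update y' j m) := by
  rw [triple, Sum.update_elim_inr, Sum.update_elim_inr, triple]

theorem lift_update (x : Fin (n + 1) → ℤ) (y : Fin n → ℤ) (j : Fin n) (m : ℤ) :
    lift (x, Function.update y j m) =
      triple x (Function.update y j m) (Function.update (fun k => y k + 1) j (m + 1)) := by
  have : (fun k => Function.update y j m k + 1) = Function.update (fun k => y k + 1) j (m + 1) := by
    ext k
    simp only [Function.update_apply]
    split_ifs <;> rfl
  rw [lift, this]

theorem eq_succ_of_eq {z : Config n} (hz : z ∈ interlacing I n) {i : Fin (n + 1)} {j : Fin n}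
    (h : z.1 i = z.2 j + 1) : i = j.succ := by
  have h1 : j.castSucc < i := by
    by_contra! hcon
    have := interlacing_le hz hcon
    omega
  refine le_antisymm ?_ (Fin.castSucc_lt_iff_succ_le.mp h1)
  by_contra! hcon
  have h2 := interlacing_strictMono_fst hz hcon
  have h3 := (hz.2.2 j).2
  omega

theorem eq_castSucc_of_eq {z : Config n} (hz : z ∈ interlacing I n) {i : Fin (n + 1)} {j : Fin n}
    (h : z.1 i = z.2 j) : i = j.castSucc := by
  have h1 : i ≤ j.castSucc := by
    by_contra! hcon
    have := interlacing_lt hz hcon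
    omega
  refine le_antisymm h1 ?_
  by_contra! hcon
  have h2 := interlacing_strictMono_fst hz hcon
  have h3 := (hz.2.2 j).1
  omega

theorem val_eq_succ_of_eq {z : Config n} (hz : z ∈ interlacing I n) {j k : Fin n}
    (h : z.2 j + 1 = z.2 k) : (k : ℕ) = j + 1 := by
  have hst := interlacing_strictMono_snd hz
  have h1 : j < k := hst.lt_iff_lt.mp (by omega)
  rw [Fin.lt_def] at h1
  by_contra hcon
  have h2 : j < (⟨j + 1, by omega⟩ : Fin n) := by rw [Fin.lt_def]; simp
  have h3 : (⟨j + 1, by omega⟩ : Fin n) < k := by rw [Fin.lt_def]; simp only; omega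
  have h4 := hst h2
  have h5 := hst h3
  omega

/-- Effect of an arrow at a site without second-level obstruction: only the first level moves. -/
theorem sum_moveX_eq {z : Config n} (hz : z ∈ interlacing I n) (f : Config n → ℝ) (a d : ℤ)
    (hmem : ∀ i, z.1 i = a → moveX z i d ∈ interlacing I n) [DecidablePred (· ∈ interlacing I n)] :
    f (moveSite z.1 a (a + d), z.2) - f z =
      ∑ i, if z.1 i = a then
        (if moveX z i d ∈ interlacing I n then f (moveX z i d) - f z else 0) else 0 := by
  have hinj := (interlacing_strictMono_fst hz).injective
  by_cases hex : ∃ i, z.1 i = a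
  · obtain ⟨i, hi⟩ := hex
    rw [Finset.sum_eq_single i, if_pos hi, if_pos (hmem i hi), ← hi, moveSite_eq_update hinj]
    · rfl
    · intro k _ hk
      exact if_neg fun h => hk (hinj (h.trans hi.symm))
    · simp
  · push Not at hex
    rw [moveSite_eq_self' hex, sub_self, Finset.sum_eq_zero fun i _ => if_neg (hex i)]

theorem sum_ite_eq_of_injective {κ : Type*} [Fintype κ] {y : κ → ℤ} (hy : Function.Injective y)
    (j : κ) (f : κ → ℝ) : (∑ k, if y k = y j then f k else 0) = f j := by
  rw [Finset.sum_eq_single j, if_pos rfl]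
  · intro k _ hk
    exact if_neg fun h => hk (hy h)
  · simp

open scoped Classical in
/-- Effect of an up arrow at `a` on the straddling probabilities. An up arrow at `y_j` coalesces
`y_j` with `y_j + 1`; an up arrow at `y_j + 1` lengthens the interval, which is then split. -/
theorem straddleProb_up (hu : IsLyapunov lam mu u c) (ht : 0 ≤ t) {z : Config n}
    (hz : z ∈ interlacing I n) (a : ℤ) :
    straddleProb lam mu w t (moveSite (lift z) a (a + 1)) - straddleProb lam mu w t (lift z) =
      (∑ i, if z.1 i = a then (if moveX z i 1 ∈ interlacing I n then
        straddleProb lam mu w t (lift (moveX z i 1)) - straddleProb lam mu w t (lift z) else 0)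
          else 0) +
      (∑ j, if z.2 j + 1 = a then (if upY z j ∈ interlacing I n then
        straddleProb lam mu w t (lift (upY z j)) else 0) else 0) -
      ∑ j, if z.2 j = a then straddleProb lam mu w t (lift z) else 0 := by
  have hinj := (interlacing_strictMono_snd hz).injective
  have hinj1 : Function.Injective fun j => z.2 j + 1 := fun j k h => hinj (add_right_cancel h)
  by_cases h1 : ∃ j, z.2 j = a
  · obtain ⟨j, rfl⟩ := h1
    rw [straddleProb_eq_zero_of_le hu ht j, sum_ite_eq_of_injective hinj j,
      Finset.sum_eq_zero, Finset.sum_eq_zero]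
    · ring
    · intro k _
      split_ifs with hk hmem
      · exact absurd hk ((upY_mem_iff hz k).mp hmem j (val_eq_succ_of_eq hz hk))
      · rfl
      · rfl
    · intro i _
      split_ifs with hi hmem
      · have := (moveX_up_mem_iff hz i).mp hmem j (eq_castSucc_of_eq hz hi).symm
        omega
      · rfl
      · rfl
    · simp [lift, triple, moveSite]
  · push Not at h1
    rw [Finset.sum_eq_zero fun j _ => if_neg (h1 j)]
    have hmem : ∀ i, z.1 i = a → moveX z i 1 ∈ interlacing I n := by
      intro i hi
      refine (moveX_up_mem_iff hz i).mpr ?_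
      rintro j rfl
      exact lt_of_le_of_ne (hz.2.2 j).1 fun h => h1 j (h.symm.trans hi)
    have hX := sum_moveX_eq hz (fun z => straddleProb lam mu w t (lift z)) a 1 hmem
    rw [← hX]
    by_cases h2 : ∃ j, z.2 j + 1 = a
    · obtain ⟨j, rfl⟩ := h2
      rw [sum_ite_eq_of_injective hinj1 j, if_pos]
      · have hup : upY z j = (moveSite z.1 (z.2 j + 1) (z.2 j + 1 + 1),
            Function.update z.2 j (z.2 j + 1)) := by
          rw [upY, Prod.mk.injEq]
          refine ⟨?_, rfl⟩
          split_ifs with hx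
          · rw [← hx, moveSite_eq_update (interlacing_strictMono_fst hz).injective]
          · refine (moveSite_eq_self' fun i hi => hx ?_).symm
            rw [← eq_succ_of_eq hz hi]; exact hi
        rw [hup, lift_update, lift, moveSite_triple, moveSite_eq_self' h1,
          moveSite_eq_update hinj1 j, straddleProb_split hu ht j (m := z.2 j + 1),
          update_triple_right, update_triple_left, Function.update_idem, lift]
        · have : Function.update (fun j => z.2 j + 1) j (z.2 j + 1) = fun j => z.2 j + 1 :=
            Function.update_eq_self j _
          rw [this]
          ring
        · change z.2 j ≤ z.2 j + 1
          omega
        · change z.2 j + 1 ≤ Function.update (fun j => z.2 j + 1) j (z.2 j + 1 + 1) j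
          rw [Function.update_self]
          omega
      · exact (upY_mem_iff hz j).mpr fun k _ hk => h1 k hk.symm
    · push Not at h2
      rw [Finset.sum_eq_zero fun j _ => if_neg (h2 j), lift, moveSite_triple,
        moveSite_eq_self' h1, moveSite_eq_self' h2, lift]
      ring

open scoped Classical in
/-- Effect of a down arrow at `a` on the straddling probabilities: at `y_j + 1` it coalesces a
straddling pair, at `y_j` it lengthens the interval. -/
theorem straddleProb_down (hu : IsLyapunov lam mu u c) (ht : 0 ≤ t) {z : Config n}
    (hz : z ∈ interlacing I n) {a : ℤ} (ha : a - 1 ∈ I.sites) :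
    straddleProb lam mu w t (moveSite (lift z) a (a - 1)) - straddleProb lam mu w t (lift z) =
      (∑ i, if z.1 i = a then (if moveX z i (-1) ∈ interlacing I n then
        straddleProb lam mu w t (lift (moveX z i (-1))) - straddleProb lam mu w t (lift z) else 0)
          else 0) +
      (∑ j, if z.2 j = a then (if downY z j ∈ interlacing I n then
        straddleProb lam mu w t (lift (downY z j)) else 0) else 0) -
      ∑ j, if z.2 j + 1 = a then straddleProb lam mu w t (lift z) else 0 := by
  have hinj := (interlacing_strictMono_snd hz).injective
  have hinj1 : Function.Injective fun j => z.2 j + 1 := fun j k h => hinj (add_right_cancel h)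
  by_cases h1 : ∃ j, z.2 j + 1 = a
  · obtain ⟨j, rfl⟩ := h1
    rw [straddleProb_eq_zero_of_le hu ht j, sum_ite_eq_of_injective hinj1 j,
      Finset.sum_eq_zero, Finset.sum_eq_zero]
    · ring
    · intro k _
      split_ifs with hk hmem
      · exact absurd hk.symm (((downY_mem_iff hz k).mp hmem).1 j (val_eq_succ_of_eq hz hk.symm))
      · rfl
      · rfl
    · intro i _
      split_ifs with hi hmem
      · have := ((moveX_down_mem_iff hz i).mp hmem).2 j (eq_succ_of_eq hz hi).symm
        omega
      · rfl
      · rfl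
    · simp [lift, triple, moveSite]
  · push Not at h1
    rw [Finset.sum_eq_zero fun j _ => if_neg (h1 j)]
    have hmem : ∀ i, z.1 i = a → moveX z i (-1) ∈ interlacing I n := by
      intro i hi
      refine (moveX_down_mem_iff hz i).mpr ⟨hi ▸ ha, ?_⟩
      rintro j rfl
      exact lt_of_le_of_ne (hz.2.2 j).2 fun h => h1 j (h.trans hi)
    have hX := sum_moveX_eq hz (fun z => straddleProb lam mu w t (lift z)) a (-1) hmem
    simp only [← sub_eq_add_neg] at hX
    rw [← hX]
    by_cases h2 : ∃ j, z.2 j = a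
    · obtain ⟨j, rfl⟩ := h2
      rw [sum_ite_eq_of_injective hinj j, if_pos]
      · have hdown : downY z j = (moveSite z.1 (z.2 j) (z.2 j - 1),
            Function.update z.2 j (z.2 j - 1)) := by
          rw [downY, Prod.mk.injEq]
          refine ⟨?_, rfl⟩
          split_ifs with hx
          · rw [← hx, moveSite_eq_update (interlacing_strictMono_fst hz).injective]
          · refine (moveSite_eq_self' fun i hi => hx ?_).symm
            rw [← eq_castSucc_of_eq hz hi]; exact hi
        rw [hdown, lift_update, lift, moveSite_triple, moveSite_eq_self' h1,
          moveSite_eq_update hinj j, straddleProb_split hu ht j (m := z.2 j),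
          update_triple_right, update_triple_left, Function.update_idem, lift,
          Function.update_eq_self, sub_add_cancel]
        · ring
        · change Function.update z.2 j (z.2 j - 1) j ≤ z.2 j
          rw [Function.update_self]
          omega
        · change z.2 j ≤ z.2 j + 1
          omega
      · refine (downY_mem_iff hz j).mpr ⟨fun k _ hk => h1 k hk, ?_⟩
        rintro ⟨-, h⟩
        exact h ha
    · push Not at h2
      rw [Finset.sum_eq_zero fun j _ => if_neg (h2 j), lift, moveSite_triple,
        moveSite_eq_self' h1, moveSite_eq_self' h2, lift]
      ring

open scoped Classical in
/-- The straddling probabilities solve a backward equation on interlacing configurations. Compared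
with the push-block dynamics, the jump rates of the second level are transposed. -/
theorem straddleProb_hasDerivAt (hu : IsLyapunov lam mu u c)
    (hmu0 : ∀ a ∈ I.sites, a - 1 ∉ I.sites → mu a = 0) (ht : 0 < t) {z : Config n}
    (hz : z ∈ interlacing I n) :
    HasDerivAt (fun s => straddleProb lam mu w s (lift z))
      ((∑ i, if moveX z i 1 ∈ interlacing I n then lam (z.1 i) *
          (straddleProb lam mu w t (lift (moveX z i 1)) - straddleProb lam mu w t (lift z))
            else 0) +
        (∑ i, if moveX z i (-1) ∈ interlacing I n then mu (z.1 i) *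
          (straddleProb lam mu w t (lift (moveX z i (-1))) - straddleProb lam mu w t (lift z))
            else 0) +
        (∑ j, ((if upY z j ∈ interlacing I n then
          lam (z.2 j + 1) * straddleProb lam mu w t (lift (upY z j)) else 0) -
            mu (z.2 j + 1) * straddleProb lam mu w t (lift z))) +
        (∑ j, ((if downY z j ∈ interlacing I n then
          mu (z.2 j) * straddleProb lam mu w t (lift (downY z j)) else 0) -
            lam (z.2 j) * straddleProb lam mu w t (lift z)))) t := by
  have hQ := isTame_flowRate (ι := TripleIndex n) hu
  refine ((hQ.isBddSolution_expect (abs_straddle_le w)).deriv t ht (lift z)).congr_deriv ?_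
  set T := Finset.univ.image (lift z) with hT
  have hTz : ∀ k, lift z k ∈ T := by simp [hT]
  have hT1 : ∀ i, z.1 i ∈ T := fun i => hTz (Sum.inl i)
  have hT2 : ∀ j, z.2 j ∈ T := fun j => hTz (Sum.inr (Sum.inl j))
  have hT3 : ∀ j, z.2 j + 1 ∈ T := fun j => hTz (Sum.inr (Sum.inr j))
  have hTs : ∀ a ∈ T, a ∈ I.sites := by
    intro a ha
    obtain ⟨k, -, rfl⟩ := Finset.mem_image.mp ha
    rcases k with i | j | j
    · exact hz.1 i
    · exact hz.2.1 j
    · exact SiteKind.mem_sites_of_le (hz.2.1 j) (by simp [lift, triple])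
  have hdown : ∀ a ∈ T, mu a * (straddleProb lam mu w t (moveSite (lift z) a (a - 1)) -
      straddleProb lam mu w t (lift z)) = mu a * (
      (∑ i, if z.1 i = a then (if moveX z i (-1) ∈ interlacing I n then
        straddleProb lam mu w t (lift (moveX z i (-1))) - straddleProb lam mu w t (lift z) else 0)
          else 0) +
      (∑ j, if z.2 j = a then (if downY z j ∈ interlacing I n then
        straddleProb lam mu w t (lift (downY z j)) else 0) else 0) -
      ∑ j, if z.2 j + 1 = a then straddleProb lam mu w t (lift z) else 0) := by
    intro a ha
    by_cases hs : a - 1 ∈ I.sites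
    · rw [straddleProb_down hu ht.le hz hs]
    · rw [hmu0 a (hTs a ha) hs, zero_mul, zero_mul]
  have hgen := genOp_flowRate lam mu (straddleProb lam mu w t) (lift z) hTz
  change genOp (flowRate lam mu) (straddleProb lam mu w t) (lift z) = _
  rw [hgen, Finset.sum_add_distrib, Finset.sum_congr rfl hdown]
  simp only [straddleProb_up hu ht.le hz]
  -- exchange the sums over sites and over particles
  have hswap : ∀ {κ : Type} [Fintype κ] (r : ℤ → ℝ) (y : κ → ℤ) (f : κ → ℝ), (∀ k, y k ∈ T) →
      ∑ a ∈ T, r a * (∑ k, if y k = a then f k else 0) = ∑ k, r (y k) * f k := by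
    intro κ _ r y f hy
    simp only [Finset.mul_sum]
    rw [Finset.sum_comm]
    refine Finset.sum_congr rfl fun k _ => ?_
    rw [Finset.sum_eq_single (y k), if_pos rfl]
    · intro a _ ha
      rw [if_neg (Ne.symm ha), mul_zero]
    · exact fun h => absurd (hy k) h
  have hite : ∀ (p : Prop) [Decidable p] (r b : ℝ),
      r * (if p then b else 0) = if p then r * b else 0 := by
    intros
    split_ifs <;> simp
  simp only [mul_add, mul_sub, Finset.sum_add_distrib, Finset.sum_sub_distrib]
  rw [hswap lam z.1 _ hT1, hswap lam (fun j => z.2 j + 1) _ hT3, hswap lam z.2 _ hT2,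
    hswap mu z.1 _ hT1, hswap mu z.2 _ hT2, hswap mu (fun j => z.2 j + 1) _ hT3]
  simp only [hite, mul_sub]
  ring

end straddle

/-! ### The two-level kernel as a straddling probability -/

section kernel

theorem sum_neg_one_pow_card_mul_prod {κ : Type*} [Fintype κ] [DecidableEq κ] (f g : κ → ℝ) :
    ∑ B : Finset κ, (-1 : ℝ) ^ B.card * ∏ i, (if i ∈ B then g i else f i) =
      ∏ i, (f i - g i) := by
  rw [Finset.prod_sub, Finset.powerset_univ]
  refine Finset.sum_congr rfl fun B _ => ?_
  rw [Finset.prod_ite, mul_assoc, mul_comm (∏ i ∈ Finset.univ \ B, f i)]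
  congr 3
  · ext i; simp
  · ext i; simp

open scoped Classical in
theorem flowCDF_eq_expect {ι : Type*} [Fintype ι] (lam mu : ℤ → ℝ) (t : ℝ) (z z' : ι → ℤ) :
    flowCDF lam mu t z z' =
      expect (flowRate lam mu) t (fun w => if ∀ i, w i ≤ z' i then 1 else 0) z := by
  simp only [flowCDF, expect, mul_ite, mul_one, mul_zero]

variable {n : ℕ}

/-- The selection of the points `x_i`, and of `y_j + 1` for `j ∈ A` and `y_j` for `j ∉ A`. -/
def raise (A : Finset (Fin n)) : Fin (n + 1) ⊕ Fin n → TripleIndex n :=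
  Sum.elim Sum.inl fun j => if j ∈ A then Sum.inr (Sum.inr j) else Sum.inr (Sum.inl j)

theorem lift_comp_raise (z : Config n) (A : Finset (Fin n)) :
    lift z ∘ raise A = Sum.elim z.1 fun i => if i ∈ A then z.2 i + 1 else z.2 i := by
  ext k
  rcases k with i | j
  · rfl
  · simp only [raise, Function.comp_apply, Sum.elim_inr]
    split_ifs <;> rfl

open scoped Classical in
/-- Pointwise form of the iterated differences: they cut out the event that the points started from
`x` are at `x'` and that those started from `y_j` and `y_j + 1` straddle `y'_j`. -/
theorem sum_sum_eq_straddle (w : Config n) {q : TripleIndex n → ℤ}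
    (hq : ∀ j, q (Sum.inr (Sum.inl j)) ≤ q (Sum.inr (Sum.inr j))) :
    ∑ A : Finset (Fin n), ∑ B : Finset (Fin (n + 1)), (-1 : ℝ) ^ (A.card + B.card) *
      (if ∀ k, (q ∘ raise A) k ≤
        (Sum.elim (fun i => if i ∈ B then w.1 i - 1 else w.1 i) w.2 : Fin (n + 1) ⊕ Fin n → ℤ) k
        then 1 else 0) = straddle w q := by
  have hX : ∑ B : Finset (Fin (n + 1)), (-1 : ℝ) ^ B.card *
      ∏ i, (if i ∈ B then if q (Sum.inl i) ≤ w.1 i - 1 then (1 : ℝ) else 0 else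
        if q (Sum.inl i) ≤ w.1 i then 1 else 0) = if ∀ i, q (Sum.inl i) = w.1 i then 1 else 0 := by
    rw [sum_neg_one_pow_card_mul_prod]
    have := Finset.prod_boole (M₀ := ℝ) (s := Finset.univ) (p := fun i => q (Sum.inl i) = w.1 i)
    simp only [Finset.mem_univ, true_implies] at this
    rw [← this]
    refine Finset.prod_congr rfl fun i _ => ?_
    split_ifs <;> first | omega | norm_num
  have hY : ∑ A : Finset (Fin n), (-1 : ℝ) ^ A.card *
      ∏ j, (if j ∈ A then if q (Sum.inr (Sum.inr j)) ≤ w.2 j then (1 : ℝ) else 0 else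
        if q (Sum.inr (Sum.inl j)) ≤ w.2 j then 1 else 0) =
      if ∀ j, q (Sum.inr (Sum.inl j)) ≤ w.2 j ∧ w.2 j < q (Sum.inr (Sum.inr j)) then 1 else 0 := by
    rw [sum_neg_one_pow_card_mul_prod]
    have := Finset.prod_boole (M₀ := ℝ) (s := Finset.univ)
      (p := fun j => q (Sum.inr (Sum.inl j)) ≤ w.2 j ∧ w.2 j < q (Sum.inr (Sum.inr j)))
    simp only [Finset.mem_univ, true_implies] at this
    rw [← this]
    refine Finset.prod_congr rfl fun j _ => ?_
    have := hq j
    split_ifs <;> first | omega | norm_num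
  have hs : straddle w q = (if ∀ j, q (Sum.inr (Sum.inl j)) ≤ w.2 j ∧
      w.2 j < q (Sum.inr (Sum.inr j)) then (1 : ℝ) else 0) *
        if ∀ i, q (Sum.inl i) = w.1 i then 1 else 0 := by
    rw [straddle, ite_and]
    split_ifs <;> norm_num
  rw [hs, ← hX, ← hY, Finset.sum_mul_sum]
  refine Finset.sum_congr rfl fun A _ => Finset.sum_congr rfl fun B _ => ?_
  have h := Finset.prod_boole (M₀ := ℝ) (s := Finset.univ) (p := fun k => (q ∘ raise A) k ≤
    (Sum.elim (fun i => if i ∈ B then w.1 i - 1 else w.1 i) w.2 : Fin (n + 1) ⊕ Fin n → ℤ) k)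
  simp only [Finset.mem_univ, true_implies] at h
  rw [← h, Fintype.prod_sum_type, pow_add]
  have e1 : ∀ i, (if (q ∘ raise A) (Sum.inl i) ≤
      (Sum.elim (fun i => if i ∈ B then w.1 i - 1 else w.1 i) w.2 : Fin (n + 1) ⊕ Fin n → ℤ)
        (Sum.inl i) then (1 : ℝ) else 0) =
      (if i ∈ B then if q (Sum.inl i) ≤ w.1 i - 1 then (1 : ℝ) else 0 else
        if q (Sum.inl i) ≤ w.1 i then 1 else 0) := by
    intro i
    simp only [raise, Function.comp_apply, Sum.elim_inl]
    by_cases hi : i ∈ B <;> simp only [hi, if_true, if_false]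
  have e2 : ∀ j, (if (q ∘ raise A) (Sum.inr j) ≤
      (Sum.elim (fun i => if i ∈ B then w.1 i - 1 else w.1 i) w.2 : Fin (n + 1) ⊕ Fin n → ℤ)
        (Sum.inr j) then (1 : ℝ) else 0) =
      (if j ∈ A then if q (Sum.inr (Sum.inr j)) ≤ w.2 j then (1 : ℝ) else 0 else
        if q (Sum.inr (Sum.inl j)) ≤ w.2 j then 1 else 0) := by
    intro j
    simp only [raise, Function.comp_apply, Sum.elim_inr]
    by_cases hj : j ∈ A <;> simp only [hj, if_true, if_false]
  simp only [e1, e2]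
  ring

theorem sum_flowCDF_eq_straddleProb {lam mu u : ℤ → ℝ} {c : ℝ} (hu : IsLyapunov lam mu u c) {t : ℝ}
    (ht : 0 ≤ t) (z w : Config n) :
    ∑ A : Finset (Fin n), ∑ B : Finset (Fin (n + 1)), (-1 : ℝ) ^ (A.card + B.card) *
      flowCDF lam mu t (Sum.elim z.1 (fun i => if i ∈ A then z.2 i + 1 else z.2 i))
        (Sum.elim (fun i => if i ∈ B then w.1 i - 1 else w.1 i) w.2) =
      straddleProb lam mu w t (lift z) := by
  classical
  have hQ := isTame_flowRate (ι := TripleIndex n) hu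
  have hQ' := isTame_flowRate (ι := Fin (n + 1) ⊕ Fin n) hu
  have hb : ∀ (q : Prop) [Decidable q], |if q then (1 : ℝ) else 0| ≤ 1 := by
    intro q _
    split_ifs <;> norm_num
  simp only [flowCDF_eq_expect, ← lift_comp_raise]
  simp only [expect_flow_comp hQ hQ' (raise _) (fun v => hb _) ht]
  rw [← Fintype.sum_prod_type', expect_sum_mul hQ ht Finset.univ
    (fun k : Finset (Fin n) × Finset (Fin (n + 1)) => (-1 : ℝ) ^ (k.1.card + k.2.card))
    (B := 1) (fun k q => hb _), straddleProb]
  refine expect_flow_congr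
    (B := ∑ k : Finset (Fin n) × Finset (Fin (n + 1)), |(-1 : ℝ) ^ (k.1.card + k.2.card)| * 1)
    hQ (fun q => ?_) (abs_straddle_le w) (fun q hq => ?_) ht
  · refine (Finset.abs_sum_le_sum_abs _ _).trans (Finset.sum_le_sum fun k _ => ?_)
    rw [abs_mul]
    exact mul_le_mul_of_nonneg_left (hb _) (abs_nonneg _)
  · rw [Fintype.sum_prod_type]
    refine sum_sum_eq_straddle w fun j => hq _ _ ?_
    change z.2 j ≤ z.2 j + 1
    omega

end kernel

/-! ### Weighted straddling probabilities -/

section weighted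

variable {n : ℕ} {p : ℤ → ℝ} {I : SiteKind}

/-- The weight `∏ p (y_j)` of a configuration. -/
def weight (p : ℤ → ℝ) (z : Config n) : ℝ := ∏ j, p (z.2 j)

theorem weight_pos (hp : ∀ y ∈ I.sites, 0 < p y) {z : Config n} (hz : z ∈ interlacing I n) :
    0 < weight p z :=
  Finset.prod_pos fun j _ => hp _ (hz.2.1 j)

theorem weight_update (x x' : Fin (n + 1) → ℤ) (y : Fin n → ℤ) (j : Fin n) (b : ℤ)
    (hp : p (y j) ≠ 0) :
    weight p (x', Function.update y j b) = weight p (x, y) * (p b / p (y j)) := by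
  have h1 : (fun k => p (Function.update y j b k)) =
      Function.update (fun k => p (y k)) j (p b) := by
    ext k
    simp only [Function.update_apply]
    split_ifs <;> rfl
  rw [weight, weight]
  change ∏ k, (fun k => p (Function.update y j b k)) k = _
  rw [h1, Finset.prod_update_of_mem (Finset.mem_univ j),
    ← Finset.mul_prod_erase Finset.univ (fun k => p (y k)) (Finset.mem_univ j),
    Finset.sdiff_singleton_eq_erase]
  field_simp

/-- The straddling probability conjugated by the weight `p` of the second level. -/
noncomputable def weightedProb (lam mu p : ℤ → ℝ) (w : Config n) (t : ℝ) (z : Config n) : ℝ :=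
  weight p w / weight p z * straddleProb lam mu w t (lift z)

open scoped Classical in
/-- The operator of the backward equation for the straddling probabilities, conjugated by the
weight `p` of the second level. -/
noncomputable def weightedOp (I : SiteKind) (lam mu p : ℤ → ℝ) (f : Config n → ℝ) (z : Config n) :
    ℝ :=
  (∑ i, if moveX z i 1 ∈ interlacing I n then lam (z.1 i) * (f (moveX z i 1) - f z) else 0) +
  (∑ i, if moveX z i (-1) ∈ interlacing I n then mu (z.1 i) * (f (moveX z i (-1)) - f z) else 0) +
  (∑ j, ((if upY z j ∈ interlacing I n then
    lam (z.2 j + 1) * (p (z.2 j + 1) / p (z.2 j)) * f (upY z j) else 0) - mu (z.2 j + 1) * f z)) +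
  (∑ j, ((if downY z j ∈ interlacing I n then
    mu (z.2 j) * (p (z.2 j - 1) / p (z.2 j)) * f (downY z j) else 0) - lam (z.2 j) * f z))

theorem weightedOp_sum (lam mu : ℤ → ℝ) {κ : Type*} (F : Finset κ) (f : κ → Config n → ℝ)
    (z : Config n) :
    ∑ k ∈ F, weightedOp I lam mu p (f k) z = weightedOp I lam mu p (fun v => ∑ k ∈ F, f k v) z := by
  simp only [weightedOp, Finset.sum_add_distrib]
  congr 1
  congr 1
  congr 1
  all_goals
    rw [Finset.sum_comm]
    refine Finset.sum_congr rfl fun i _ => ?_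
    split_ifs <;>
      simp only [Finset.sum_const_zero, ← Finset.mul_sum, Finset.sum_sub_distrib]

variable {lam mu u : ℤ → ℝ} {c : ℝ} {w z : Config n} {t : ℝ}

theorem weightedProb_zero (hu : IsLyapunov lam mu u c) (hp : ∀ y ∈ I.sites, 0 < p y)
    (hz : z ∈ interlacing I n) : weightedProb lam mu p w 0 z = if z = w then 1 else 0 := by
  rw [weightedProb, straddleProb_zero hu]
  split_ifs with h
  · rw [← h, div_self (weight_pos hp hz).ne', mul_one]
  · rw [mul_zero]

theorem weightedProb_nonneg (hu : IsLyapunov lam mu u c) (hp : ∀ y ∈ I.sites, 0 < p y)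
    (hw : w ∈ interlacing I n) (hz : z ∈ interlacing I n) (ht : 0 ≤ t) :
    0 ≤ weightedProb lam mu p w t z :=
  mul_nonneg (div_nonneg (weight_pos hp hw).le (weight_pos hp hz).le) (straddleProb_nonneg hu ht)

theorem weightedProb_continuousOn (hu : IsLyapunov lam mu u c) :
    ContinuousOn (fun t => weightedProb lam mu p w t z) (Ici 0) :=
  (((isTame_flowRate hu).isBddSolution_expect (abs_straddle_le w)).cont (lift z)).const_smul
    (weight p w / weight p z)

theorem weightedProb_hasDerivAt (hu : IsLyapunov lam mu u c)
    (hmu0 : ∀ a ∈ I.sites, a - 1 ∉ I.sites → mu a = 0) (hp : ∀ y ∈ I.sites, 0 < p y) (ht : 0 < t)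
    (hz : z ∈ interlacing I n) :
    HasDerivAt (fun s => weightedProb lam mu p w s z)
      (weightedOp I lam mu p (weightedProb lam mu p w t) z) t := by
  classical
  refine ((straddleProb_hasDerivAt hu hmu0 ht hz (w := w)).const_mul
    (weight p w / weight p z)).congr_deriv ?_
  have hp' : ∀ j, p (z.2 j) ≠ 0 := fun j => (hp _ (hz.2.1 j)).ne'
  have hup : ∀ j, weight p (upY z j) = weight p z * (p (z.2 j + 1) / p (z.2 j)) := fun j =>
    weight_update _ _ _ _ _ (hp' j)
  have hdown : ∀ j, weight p (downY z j) = weight p z * (p (z.2 j - 1) / p (z.2 j)) := fun j =>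
    weight_update _ _ _ _ _ (hp' j)
  have hmove : ∀ i d, weight p (moveX z i d) = weight p z := fun i d => rfl
  have hz0 := (weight_pos hp hz).ne'
  have key : ∀ (r ρ W W' G : ℝ), W ≠ 0 → W' = W * ρ → W' ≠ 0 →
      weight p w / W * (r * G) = r * ρ * (weight p w / W' * G) := by
    rintro r ρ W W' G hW rfl hW'
    have := right_ne_zero_of_mul hW'
    field_simp
  rw [weightedOp]
  simp only [mul_add, Finset.mul_sum, weightedProb, hmove]
  congr 1
  congr 1
  congr 1
  · refine Finset.sum_congr rfl fun i _ => ?_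
    split_ifs
    · ring
    · ring
  · refine Finset.sum_congr rfl fun i _ => ?_
    split_ifs
    · ring
    · ring
  · refine Finset.sum_congr rfl fun j _ => ?_
    split_ifs with h
    · rw [mul_sub, key _ _ _ _ _ hz0 (hup j) (weight_pos hp h).ne']
      ring
    · ring
  · refine Finset.sum_congr rfl fun j _ => ?_
    split_ifs with h
    · rw [mul_sub, key _ _ _ _ _ hz0 (hdown j) (weight_pos hp h).ne']
      ring
    · ring

/-! ### The total mass -/

/-- Configurations in the window `[-N, N]`. -/
def window (I : SiteKind) (n N : ℕ) : Set (Config n) :=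
  {z | z ∈ interlacing I n ∧ (∀ i, -(N : ℤ) ≤ z.1 i ∧ z.1 i ≤ N) ∧
    ∀ j, -(N : ℤ) ≤ z.2 j ∧ z.2 j < N}

theorem finite_window (I : SiteKind) (n N : ℕ) : (window I n N).Finite := by
  refine ((Set.Finite.pi' fun _ => finite_Icc (-(N : ℤ)) N).prod
    (Set.Finite.pi' fun _ => finite_Ico (-(N : ℤ)) N)).subset fun z hz => ?_
  exact ⟨fun i => hz.2.1 i, fun j => hz.2.2 j⟩

/-- In the equation for the rates truncated to a window, the second level loses mass at the
untruncated dual rates, but the jumps leaving the window do not take place. So the total mass cannot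
grow, by the maximum principle on the window. -/
theorem sum_weightedProb_trunc_le_one (hlam : ∀ x, 0 ≤ lam x) (hmu : ∀ x, 0 ≤ mu x)
    (hmu0 : ∀ a ∈ I.sites, a - 1 ∉ I.sites → mu a = 0) (hp : ∀ y ∈ I.sites, 0 < p y)
    (hbal : ∀ y ∈ I.sites, lam (y + 1) * (p (y + 1) / p y) = mu (y + 1))
    (hbal' : ∀ y ∈ I.sites, y - 1 ∈ I.sites → mu y * (p (y - 1) / p y) = lam y)
    (N : ℕ) (ht : 0 ≤ t) (F : Finset (Config n))
    (hz : z ∈ window I n N) :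
    ∑ w ∈ F, weightedProb (truncBirth N lam) (truncDeath N mu) p w t z ≤ 1 := by
  classical
  have hu := isLyapunov_trunc hlam hmu N
  have hmuN : ∀ a ∈ I.sites, a - 1 ∉ I.sites → truncDeath N mu a = 0 := by
    intro a ha ha'
    rw [truncDeath, hmu0 a ha ha', ite_self]
  set s : ℝ → Config n → ℝ := fun t z =>
    ∑ w ∈ F, weightedProb (truncBirth N lam) (truncDeath N mu) p w t z with hs
  have hs0 : ∀ v ∈ window I n N, s 0 v - 1 ≤ 0 := by
    intro v hv
    simp only [hs, weightedProb_zero hu hp hv.1, Finset.sum_ite_eq]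
    split_ifs <;> norm_num
  have h := finite_max_principle (finite_window I n N) ht (f := fun t z => s t z - 1)
    (fun v _ => ((continuousOn_finsetSum F fun w _ => weightedProb_continuousOn hu).mono
      Icc_subset_Ici_self).sub continuousOn_const) hs0 (fun r hr v hv hpos hmax => ?_) z hz
  · simpa using h
  have hd : HasDerivAt (fun t => s t v)
      (weightedOp I (truncBirth N lam) (truncDeath N mu) p (s r) v) r := by
    rw [hs, ← weightedOp_sum]
    exact HasDerivAt.fun_sum fun w _ => weightedProb_hasDerivAt hu hmuN hp hr.1 hv.1
  -- at a maximum, every jump contributes nonpositively; the jumps with a nonzero rate stay in the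
  -- window
  refine ⟨_, ?_, hd.sub_const 1⟩
  have hpos' : 0 < s r v := by linarith
  have hmax' : ∀ v' ∈ window I n N, s r v' ≤ s r v := fun v' hv' => by linarith [hmax v' hv']
  have hlN := hu.lam_nonneg
  have hmN := hu.mu_nonneg
  obtain ⟨hvI, hvx, hvy⟩ := hv
  have hX : ∀ (i : Fin (n + 1)) (d : ℤ), -(N : ℤ) ≤ v.1 i + d → v.1 i + d ≤ N →
      moveX v i d ∈ interlacing I n → moveX v i d ∈ window I n N := by
    intro i d h1 h2 hm
    refine ⟨hm, fun k => ?_, hvy⟩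
    simp only [moveX, Function.update_apply]
    split_ifs with hk
    · omega
    · exact hvx k
  refine add_nonpos (add_nonpos (add_nonpos ?_ ?_) ?_) ?_ <;>
    refine Finset.sum_nonpos fun j _ => ?_
  · split_ifs with hm
    · by_cases hj : v.1 j < N
      · refine mul_nonpos_of_nonneg_of_nonpos (hlN _) (sub_nonpos.mpr (hmax' _ ?_))
        exact hX j 1 (by have := hvx j; omega) (by omega) hm
      · rw [truncBirth, if_neg (by omega), zero_mul]
    · exact le_rfl
  · split_ifs with hm
    · by_cases hj : -(N : ℤ) < v.1 j
      · refine mul_nonpos_of_nonneg_of_nonpos (hmN _) (sub_nonpos.mpr (hmax' _ ?_))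
        exact hX j (-1) (by omega) (by have := hvx j; omega) hm
      · rw [truncDeath, if_neg (by omega), zero_mul]
    · exact le_rfl
  · have hj := hvy j
    rw [sub_nonpos]
    have h0 := mul_nonneg (hmN (v.2 j + 1)) hpos'.le
    split_ifs with hm
    · by_cases hj' : v.2 j + 1 < N
      · rw [truncBirth, if_pos (by omega), hbal _ (hvI.2.1 j), truncDeath, if_pos (by omega)]
        refine mul_le_mul_of_nonneg_left (hmax' _ ⟨hm, fun k => ?_, fun k => ?_⟩) (hmu _)
        · have := hvx k
          simp only [upY]
          split_ifs with hx
          · simp only [Function.update_apply]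
            split_ifs with hk <;> omega
          · omega
        · have := hvy k
          simp only [upY, Function.update_apply]
          split_ifs <;> omega
      · rw [truncBirth, if_neg (by omega), zero_mul, zero_mul]
        exact h0
    · exact h0
  · have hj := hvy j
    rw [sub_nonpos]
    have h0 := mul_nonneg (hlN (v.2 j)) hpos'.le
    split_ifs with hm
    · by_cases hj' : -(N : ℤ) < v.2 j
      · have hsite : v.2 j - 1 ∈ I.sites := by
          have := hm.2.1 j
          simpa only [downY, Function.update_self] using this
        rw [truncDeath, if_pos (by omega), hbal' _ (hvI.2.1 j) hsite, truncBirth,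
          if_pos (by omega)]
        refine mul_le_mul_of_nonneg_left (hmax' _ ⟨hm, fun k => ?_, fun k => ?_⟩) (hlam _)
        · have := hvx k
          simp only [downY]
          split_ifs with hx
          · simp only [Function.update_apply]
            split_ifs with hk <;> omega
          · omega
        · have := hvy k
          simp only [downY, Function.update_apply]
          split_ifs <;> omega
      · rw [truncDeath, if_neg (by omega), zero_mul, zero_mul]
        exact h0
    · exact h0

theorem mem_window_eventually (hz : z ∈ interlacing I n) :
    ∀ᶠ N : ℕ in atTop, z ∈ window I n N := by
  have h1 : ∀ a : ℤ, ∀ᶠ N : ℕ in atTop, |a| < N := by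
    intro a
    filter_upwards [eventually_gt_atTop a.natAbs] with N hN
    rw [abs_lt]
    omega
  filter_upwards [eventually_all.mpr fun i => h1 (z.1 i), eventually_all.mpr fun j => h1 (z.2 j)]
    with N hx hy
  refine ⟨hz, fun i => ?_, fun j => ?_⟩
  · have := abs_lt.mp (hx i); omega
  · have := abs_lt.mp (hy j); omega

theorem sum_weightedProb_le_one (hu : IsLyapunov lam mu u c)
    (hmu0 : ∀ a ∈ I.sites, a - 1 ∉ I.sites → mu a = 0) (hp : ∀ y ∈ I.sites, 0 < p y)
    (hbal : ∀ y ∈ I.sites, lam (y + 1) * (p (y + 1) / p y) = mu (y + 1))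
    (hbal' : ∀ y ∈ I.sites, y - 1 ∈ I.sites → mu y * (p (y - 1) / p y) = lam y)
    (ht : 0 ≤ t) (F : Finset (Config n)) (hz : z ∈ interlacing I n) :
    ∑ w ∈ F, weightedProb lam mu p w t z ≤ 1 := by
  refine le_of_tendsto (tendsto_finsetSum F fun w _ => (tendsto_expect_trunc hu.lam_nonneg
    hu.mu_nonneg (isTame_flowRate hu) (abs_straddle_le w) ht (lift z)).const_mul
      (weight p w / weight p z)) ?_
  filter_upwards [mem_window_eventually hz] with N hN
  exact sum_weightedProb_trunc_le_one hu.lam_nonneg hu.mu_nonneg hmu0 hp hbal hbal' N ht F hN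

end weighted

/-! ### Identification of the two-level kernel -/

section dualMeasure

variable {I : SiteKind} {lam mu : ℤ → ℝ}

theorem NaturalRates.dualSymmMeasure_pos (h : NaturalRates I lam mu) :
    ∀ y ∈ I.sites, 0 < dualSymmMeasure lam mu y := by
  intro y hy
  cases I with
  | halfLine =>
    exact symmMeasure_pos_of_nonneg (fun x hx => h.2.1 _ (by omega))
      (fun x hx => h.1 x (by omega)) hy
  | line => exact symmMeasure_pos (fun x => h.2.1 _) (fun x => h.1 x) y

theorem NaturalRates.dualSymmMeasure_balance (h : NaturalRates I lam mu) {y : ℤ}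
    (hy : y ∈ I.sites) :
    mu (y + 1) * dualSymmMeasure lam mu y = lam (y + 1) * dualSymmMeasure lam mu (y + 1) := by
  cases I with
  | halfLine =>
    have hy' : (0 : ℤ) ≤ y := hy
    exact symmMeasure_balance (lam := dualBirth mu) (mu := dualDeath lam)
      (h.2.1 _ (by omega)).ne' (h.1 _ (by omega)).ne'
  | line =>
    exact symmMeasure_balance (lam := dualBirth mu) (mu := dualDeath lam)
      (h.2.1 _).ne' (h.1 _).ne'

theorem NaturalRates.lam_mul_ratio (h : NaturalRates I lam mu) :
    ∀ y ∈ I.sites, lam (y + 1) * (dualSymmMeasure lam mu (y + 1) / dualSymmMeasure lam mu y) =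
      mu (y + 1) := by
  intro y hy
  rw [← mul_div_assoc, ← h.dualSymmMeasure_balance hy, mul_div_assoc,
    div_self (h.dualSymmMeasure_pos y hy).ne', mul_one]

theorem NaturalRates.mu_mul_ratio (h : NaturalRates I lam mu) :
    ∀ y ∈ I.sites, y - 1 ∈ I.sites →
      mu y * (dualSymmMeasure lam mu (y - 1) / dualSymmMeasure lam mu y) = lam y := by
  intro y hy hy'
  have := h.dualSymmMeasure_balance hy'
  rw [sub_add_cancel] at this
  rw [← mul_div_assoc, this, mul_div_assoc, div_self (h.dualSymmMeasure_pos y hy).ne', mul_one]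

variable {n : ℕ}

/-- Conjugation by `π̂` turns the transposed second-level rates into the dual rates. -/
theorem NaturalRates.weightedOp_eq (h : NaturalRates I lam mu) (f : Config n → ℝ)
    (z : interlacing I n) :
    weightedOp I lam mu (dualSymmMeasure lam mu) f z.1 =
      genOp (pushBlockRate I n lam mu) (fun v => f v.1) z := by
  classical
  have hext : ∀ p : Config n, p ∈ interlacing I n →
      extendZero (I := I) (fun v => f v.1) p = f p := fun p hp => extendZero_of_mem _ hp
  rw [weightedOp, genOp_pushBlockRate]
  congr 1
  congr 1
  congr 1
  · refine Finset.sum_congr rfl fun i _ => ?_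
    split_ifs with hm
    · rw [hext _ hm]
    · rfl
  · refine Finset.sum_congr rfl fun i _ => ?_
    split_ifs with hm
    · rw [hext _ hm]
    · rfl
  · refine Finset.sum_congr rfl fun j _ => ?_
    rw [dualBirth, mul_sub]
    split_ifs with hm
    · rw [hext _ hm, h.lam_mul_ratio _ (z.2.2.1 j)]
    · rw [extendZero_of_notMem _ hm, mul_zero]
  · refine Finset.sum_congr rfl fun j _ => ?_
    rw [dualDeath, mul_sub]
    split_ifs with hm
    · have hs : z.1.2 j - 1 ∈ I.sites := by
        have := hm.2.1 j
        simpa only [downY, Function.update_self] using this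
      rw [hext _ hm, h.mu_mul_ratio _ (z.2.2.1 j) hs]
    · rw [extendZero_of_notMem _ hm, mul_zero]

theorem NaturalRates.twoLevelKernel_eq_weightedProb (h : NaturalRates I lam mu) {t : ℝ} (ht : 0 ≤ t)
    (z w : interlacing I n) : twoLevelKernel I n lam mu t z w =
      weightedProb lam mu (dualSymmMeasure lam mu) w.1 t z.1 := by
  obtain ⟨u, c, hu⟩ := h.exists_lyapunov
  rw [twoLevelKernel, sum_flowCDF_eq_straddleProb hu ht z.1 w.1]
  rfl

theorem NaturalRates.isBddSolution_weightedProb (h : NaturalRates I lam mu) (w : interlacing I n) :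
    IsBddSolution (pushBlockRate I n lam mu)
      (fun t z => weightedProb lam mu (dualSymmMeasure lam mu) w.1 t z.1) 1 := by
  obtain ⟨u, c, hu⟩ := h.exists_lyapunov
  have hp := h.dualSymmMeasure_pos
  have hmu0 : ∀ a ∈ I.sites, a - 1 ∉ I.sites → mu a = 0 := fun a => h.mu_eq_zero
  refine ⟨fun z => weightedProb_continuousOn hu, fun t ht z => ?_, fun t ht z => ?_⟩
  · exact (weightedProb_hasDerivAt hu hmu0 hp ht z.2).congr_deriv (h.weightedOp_eq _ z)
  · rw [abs_of_nonneg (weightedProb_nonneg hu hp w.2 z.2 ht)]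
    simpa using sum_weightedProb_le_one hu hmu0 hp h.lam_mul_ratio h.mu_mul_ratio ht {w.1} z.2

/-- The two-level kernel is the transition function of the push-block dynamics. -/
theorem NaturalRates.twoLevelKernel_eq_chain (h : NaturalRates I lam mu) {t : ℝ} (ht : 0 ≤ t)
    (z w : interlacing I n) :
    twoLevelKernel I n lam mu t z w = chainTransition (pushBlockRate I n lam mu) t z w := by
  classical
  obtain ⟨V, C, hV⟩ := h.exists_isTame_pushBlockRate n
  obtain ⟨u, c, hu⟩ := h.exists_lyapunov
  rw [h.twoLevelKernel_eq_weightedProb ht]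
  refine hV.eq_chain (h.isBddSolution_weightedProb w) w (fun z => ?_) ht z
  rw [weightedProb_zero hu h.dualSymmMeasure_pos z.2]
  by_cases hzw : z = w
  · rw [if_pos hzw, if_pos (congrArg Subtype.val hzw)]
  · rw [if_neg hzw, if_neg fun h => hzw (Subtype.ext h)]

end dualMeasure

/-! ### The chain with cemetery state -/

section cemetery

variable {I : SiteKind} {n : ℕ} {lam mu : ℤ → ℝ} {V : interlacing I n → ℝ} {C : ℝ}

/-- Before absorption the dynamics with cemetery is the killed dynamics. -/
theorem chainTransition_cemeteryRate_some (hlam : ∀ x, 0 ≤ lam x) (hmu : ∀ x, 0 ≤ mu x)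
    (hV : IsTame (pushBlockRate I n lam mu) V C) {t : ℝ} (ht : 0 ≤ t)
    (o : Option (interlacing I n)) (w : interlacing I n) :
    chainTransition (cemeteryRate I n lam mu) t o (some w) =
      o.elim 0 fun z => chainTransition (pushBlockRate I n lam mu) t z w := by
  classical
  have s := hV.isBddSolution_chain w
  have hs : IsBddSolution (cemeteryRate I n lam mu) (fun t o => Option.elim o 0 fun z =>
      chainTransition (pushBlockRate I n lam mu) t z w) 1 := by
    refine ⟨fun o => ?_, fun t ht o => ?_, fun t ht o => ?_⟩
    · cases o with
      | none => exact continuousOn_const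
      | some z => exact s.cont z
    · cases o with
      | none =>
        rw [genOp_cemeteryRate_none]
        exact hasDerivAt_const t 0
      | some z =>
        refine (s.deriv t ht z).congr_deriv ?_
        rw [genOp_cemeteryRate_some]
        simp only [Option.elim, mul_zero, zero_add]
    · cases o with
      | none => simp
      | some z => exact s.bdd t ht z
  refine ((hV.cemetery hlam hmu).eq_chain hs (some w) (fun o => ?_) ht o).symm
  cases o with
  | none => simp
  | some z =>
    simp only [Option.elim, hV.chain_zero, Option.some.injEq]
    congr

/-- The dynamics with cemetery is honest, so that the missing mass sits at the cemetery. -/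
theorem chainTransition_cemeteryRate_none (hlam : ∀ x, 0 ≤ lam x) (hmu : ∀ x, 0 ≤ mu x)
    (hV : IsTame (pushBlockRate I n lam mu) V C) {t : ℝ} (ht : 0 ≤ t)
    (o : Option (interlacing I n)) :
    chainTransition (cemeteryRate I n lam mu) t o none =
      1 - ∑' w, chainTransition (cemeteryRate I n lam mu) t o (some w) := by
  have hD := hV.cemetery hlam hmu
  have h1 := hasSum_option (f := fun w => chainTransition (cemeteryRate I n lam mu) t o w)
    ((hD.summable_chain ht o).comp_injective (Option.some_injective _)).hasSum
  exact eq_sub_of_add_eq (h1.unique (hD.hasSum_chain genOp_cemeteryRate_one ht o))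

theorem NaturalRates.cemeteryKernel_eq_chain (h : NaturalRates I lam mu) {t : ℝ} (ht : 0 ≤ t) :
    cemeteryKernel I n lam mu t = chainTransition (cemeteryRate I n lam mu) t := by
  obtain ⟨V, C, hV⟩ := h.exists_isTame_pushBlockRate n
  funext o w
  match o, w with
  | none, none =>
    rw [chainTransition_cemeteryRate_none h.lam_nonneg h.mu_nonneg hV ht]
    simp [chainTransition_cemeteryRate_some h.lam_nonneg h.mu_nonneg hV ht, cemeteryKernel]
  | none, some w =>
    rw [chainTransition_cemeteryRate_some h.lam_nonneg h.mu_nonneg hV ht]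
    rfl
  | some z, none =>
    rw [chainTransition_cemeteryRate_none h.lam_nonneg h.mu_nonneg hV ht]
    simp only [chainTransition_cemeteryRate_some h.lam_nonneg h.mu_nonneg hV ht, cemeteryKernel,
      Option.elim, h.twoLevelKernel_eq_chain ht]
  | some z, some w =>
    rw [chainTransition_cemeteryRate_some h.lam_nonneg h.mu_nonneg hV ht]
    exact h.twoLevelKernel_eq_chain ht z w

end cemetery

/-! ### Characterizations of the transition function -/

section characterization

variable {S : Type*} {Q : S → S → ℝ} {V : S → ℝ} {C : ℝ} {P : ℝ → S → S → ℝ}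

theorem IsTame.hasDerivAt_of_eq_chain (hQ : IsTame Q V C)
    (hP : ∀ t, 0 ≤ t → P t = chainTransition Q t) {t : ℝ} (ht : 0 < t) (x y : S) :
    HasDerivAt (fun s => P s x y) (∑' z, Q x z * P t z y) t := by
  rw [hP t ht.le]
  refine ((hQ.isBddSolution_chain y).deriv t ht x).congr_of_eventuallyEq ?_
  filter_upwards [lt_mem_nhds ht] with s hs
  rw [hP s hs.le]

theorem IsTame.isBackwardSolution_of_eq_chain (hQ : IsTame Q V C)
    (hP : ∀ t, 0 ≤ t → P t = chainTransition Q t) : IsBackwardSolution Q P where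
  init x y := by rw [hP 0 le_rfl, hQ.chain_zero]
  continuous_zero x y :=
    ((hQ.isBddSolution_chain y).cont x 0 self_mem_Ici).congr (fun t ht => by rw [hP t ht])
      (by rw [hP 0 le_rfl])
  backward t ht x y := hQ.hasDerivAt_of_eq_chain hP ht x y
  nonneg t ht x y := by
    rw [hP t ht]
    exact hQ.chain_nonneg ht x y
  summable t ht x := by
    rw [hP t ht]
    exact hQ.summable_chain ht x
  tsum_le_one t ht x := by
    rw [hP t ht]
    exact (hQ.summable_chain ht x).tsum_le_of_sum_le fun F => hQ.sum_chain_le_one F ht x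

/-- The columns of a substochastic backward solution are bounded solutions, hence unique. -/
theorem IsTame.eq_chain_of_isBackwardSolution (hQ : IsTame Q V C) (hP : IsBackwardSolution Q P)
    {t : ℝ} (ht : 0 ≤ t) : P t = chainTransition Q t := by
  classical
  funext x y
  refine hQ.eq_chain (f := fun t x => P t x y) (B := 1) ⟨fun x s hs => ?_,
    fun s hs x => hP.backward s hs x y, fun s hs x => ?_⟩ y (fun x => ?_) ht x
  · rcases (mem_Ici.mp hs).eq_or_lt with rfl | hs
    · exact hP.continuous_zero x y
    · exact (hP.backward s hs x y).continuousAt.continuousWithinAt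
  · rw [abs_of_nonneg (hP.nonneg s hs x y)]
    exact ((hP.summable s hs x).le_tsum y fun z _ => hP.nonneg s hs x z).trans
      (hP.tsum_le_one s hs x)
  · rw [hP.init]

theorem IsTame.isStochasticTransitionFunction_of_eq_chain (hQ : IsTame Q V C)
    (hcons : ∀ x, genOp Q (fun _ => 1) x = 0) (hP : ∀ t, 0 ≤ t → P t = chainTransition Q t) :
    IsStochasticTransitionFunction Q P where
  init x y := by rw [hP 0 le_rfl, hQ.chain_zero]
  nonneg t ht x y := by
    rw [hP t ht]
    exact hQ.chain_nonneg ht x y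
  hasSum_one t ht x := by
    rw [hP t ht]
    exact hQ.hasSum_chain hcons ht x
  chapman_kolmogorov s t hs ht x y := by
    rw [hP s hs, hP t ht, hP (s + t) (add_nonneg hs ht)]
    exact hQ.chapman_kolmogorov hs ht x y
  rates x y := by
    classical
    have h := (hQ.isBddSolution_chain y).hasDerivWithinAt_zero hQ.finite_row x
    have h0 : genOp Q (fun x => chainTransition Q 0 x y) x = Q x y := by
      simp only [genOp, hQ.chain_zero, mul_ite, mul_one, mul_zero, tsum_ite_eq]
    rw [h0] at h
    exact h.congr (fun t ht => by rw [hP t ht]) (by rw [hP 0 le_rfl])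

theorem IsTame.isConservativeRateMatrix (hQ : IsTame Q V C)
    (hcons : ∀ x, genOp Q (fun _ => 1) x = 0) : IsConservativeRateMatrix Q := by
  refine ⟨hQ.offDiag, fun x => ?_⟩
  have h := (summable_genOp hQ.finite_row (fun _ => 1) x).hasSum
  change HasSum _ (genOp Q (fun _ => 1) x) at h
  simpa only [hcons, mul_one] using h

end characterization

end PushBlock

theorem mainTheorem5 (I : PushBlock.SiteKind) (n : ℕ) (lam mu : ℤ → ℝ)
    (hrates : PushBlock.NaturalRates I lam mu) :
    -- the two-level kernel solves the backward equation of the killed push-block dynamics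
    (∀ t : ℝ, 0 < t → ∀ z w : PushBlock.interlacing I n,
      HasDerivAt (fun s => PushBlock.twoLevelKernel I n lam mu s z w)
        (∑' u, PushBlock.pushBlockRate I n lam mu z u *
          PushBlock.twoLevelKernel I n lam mu t u w) t) ∧
    -- with the cemetery state, it is a solution of the backward equation, and the only one
    IsConservativeRateMatrix (PushBlock.cemeteryRate I n lam mu) ∧
    IsBackwardSolution (PushBlock.cemeteryRate I n lam mu)
      (PushBlock.cemeteryKernel I n lam mu) ∧
    (∀ P : ℝ → Option (PushBlock.interlacing I n) → Option (PushBlock.interlacing I n) → ℝ,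
      IsBackwardSolution (PushBlock.cemeteryRate I n lam mu) P →
        ∀ t, 0 ≤ t → P t = PushBlock.cemeteryKernel I n lam mu t) ∧
    -- it is the transition function of the push-block dynamics absorbed at the cemetery state
    IsStochasticTransitionFunction (PushBlock.cemeteryRate I n lam mu)
      (PushBlock.cemeteryKernel I n lam mu) ∧
    (∀ t, 0 ≤ t → PushBlock.cemeteryKernel I n lam mu t =
      chainTransition (PushBlock.cemeteryRate I n lam mu) t) ∧
    -- and its restriction is the transition function of the killed push-block dynamics
    (∀ t, 0 ≤ t → PushBlock.twoLevelKernel I n lam mu t =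
      chainTransition (PushBlock.pushBlockRate I n lam mu) t) := by
  obtain ⟨V, C, hV⟩ := hrates.exists_isTame_pushBlockRate n
  have hD := hV.cemetery hrates.lam_nonneg hrates.mu_nonneg
  have hcons := PushBlock.genOp_cemeteryRate_one (I := I) (n := n) (lam := lam) (mu := mu)
  have hq : ∀ t, 0 ≤ t → PushBlock.twoLevelKernel I n lam mu t =
      chainTransition (PushBlock.pushBlockRate I n lam mu) t := fun t ht =>
    funext fun z => funext fun w => hrates.twoLevelKernel_eq_chain ht z w
  have hc : ∀ t, 0 ≤ t → PushBlock.cemeteryKernel I n lam mu t =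
      chainTransition (PushBlock.cemeteryRate I n lam mu) t := fun t ht =>
    hrates.cemeteryKernel_eq_chain ht
  exact ⟨fun t ht z w => hV.hasDerivAt_of_eq_chain hq ht z w, hD.isConservativeRateMatrix hcons,
    hD.isBackwardSolution_of_eq_chain hc,
    fun P hP t ht => (hD.eq_chain_of_isBackwardSolution hP ht).trans (hc t ht).symm,
    hD.isStochasticTransitionFunction_of_eq_chain hcons hc, hc, hq⟩
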